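/- A \emph{polynomial pMDP} consists of a finite set $S$ of states, an initial state $\iota\in S$, a finite set $\mathrm{Act}$ of actions, a finite set $X$ of parameters, and, for each state $s$ and each action $\alpha$ of a non-empty set $\mathrm{Act}(s)\subseteq\mathrm{Act}$ of available actions, polynomials $\mathcal P(s,\alpha,s')\in\mathbb Q[X]$ ($s'\in S$). It is \emph{simple} if, for all $s\in S$ and $\alpha\in\mathrm{Act}(s)$, every $\mathcal P(s,\alpha,s')$ lies in $\{x,1-x\mid x\in X\}\cup\mathbb Q_{\ge 0}$ and $\sum_{s'}\mathcal P(s,\alpha,s')=1$ as polynomials. A valuation $\mathrm{val}\colon X\to\mathbb R$ is \emph{well-defined} if substituting it into the polynomials gives probability distributions, so that an MDP $\mathcal M[\mathrm{val}]$ results; it is \emph{graph-preserving} if, moreover, no transition polynomial $\mathcal P(s,\alpha,s')\neq 0$ ($\alpha\in\mathrm{Act}(s)$) takes the value $0$; it is \emph{Boolean} if it is well-defined and takes values in $\{0,1\}$. For a set $T\subseteq S$ of targets and a deterministic memoryless strategy $\sigma$ (a choice of an action in $\mathrm{Act}(s)$ for every state $s$), $\Pr^{\sigma}_{\mathcal M[\mathrm{val}]}(\lozenge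 T)$ is the probability to reach $T$ from $\iota$ in the induced Markov chain, i.e. the sum of the masses of the finite paths from $\iota$ that end in $T$ and visit $T$ only in their last state. \textbf{Theorem.} For each of the three classes $R(\mathcal M)$ of all well-defined, all graph-preserving, and all Boolean valuations, each quantifier $\mathcal Q\in\{\exists,\forall\}$, and each comparison $\bowtie\lambda$ among $>0$, $<1$, $\le 0$, $\ge 1$, the following problem is in NP: given a simple pMDP $\mathcal M$ and a set $T$ of target states, decide whether \[ \exists\,\mathrm{val}\in R(\mathcal M)\;\;\mathcal Q\,\sigma:\quad \Pr^{\sigma}_{\mathcal M[\mathrm{val}]}(\lozenge T)\bowtie\lambda , \] where $\sigma$ ranges over the deterministic memoryless strategies. Here a pMDP is given by the sizes of $S$, $\mathrm{Act}$ and $X$ in unary and an explicit table of its transitions, with rational constants written as pairs of binary integers. -/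

import Mathlib

/-! ## The class NP over Mathlib's (multi-stack) Turing machines -/

namespace NPTime

/-- The input word of a verifier: a word over `Γ`, followed by a certificate over `Bool`; the two
parts are written in disjoint alphabets. -/
def pairWord {Γ : Type} (x : List Γ × List Bool) : List (Γ ⊕ Bool) :=
  x.1.map Sum.inl ++ x.2.map Sum.inr

/-- `L ∈ NP`: there are a polynomial `p` and a verifier `V`, computable by a Turing machine in time
polynomial in the total length of its two arguments, such that `w ∈ L` if and only if `V` accepts
`w` together with some certificate of length at most `p |w|`. -/
def InNP {Γ : Type} (L : Language Γ) : Prop :=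
  ∃ (p : Polynomial ℕ) (V : List Γ → List Bool → Bool),
    Nonempty (Turing.TM2ComputableInPolyTime (pairWord (Γ := Γ)) Computability.encodeBool
      (fun x : List Γ × List Bool => V x.1 x.2)) ∧
    ∀ w : List Γ, w ∈ L ↔ ∃ c : List Bool, c.length ≤ p.eval w.length ∧ V w c = true

end NPTime

namespace ParamMDP

/-! ## Markov chains, Markov decision processes, reachability probabilities -/

/-- A finite (discrete-time) Markov chain. -/
structure MC (S : Type*) [Fintype S] where
  /-- the initial state -/
  init : S
  /-- the transition probabilities -/
  P : S → S → ℝ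
  nonneg : ∀ s s', 0 ≤ P s s'
  sum_one : ∀ s, ∑ s', P s s' = 1

namespace MC

variable {S : Type*} [Fintype S]

/-- The mass of a finite path `s₀ s₁ … sₙ`: the product of the `P (sᵢ, sᵢ₊₁)`. -/
def mass (D : MC S) : List S → ℝ
  | s :: s' :: l => D.P s s' * D.mass (s' :: l)
  | _ => 1

/-- The finite paths of `D` that start in `s`, end in `T`, and of which no proper prefix
visits `T`. -/
def pathsTo (D : MC S) (s : S) (T : Set S) : Set (List S) :=
  {π | π.head? = some s ∧ π.IsChain (fun a b => D.P a b ≠ 0) ∧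
    (∃ t ∈ T, π.getLast? = some t) ∧ ∀ u ∈ π.dropLast, u ∉ T}

/-- The probability to reach `T` from the initial state: the sum of the masses of the paths in
`pathsTo`, taken in `[0, ∞]`, so that it always exists. -/
noncomputable def reachProb (D : MC S) (T : Set S) : ENNReal :=
  ∑' π : D.pathsTo D.init T, ENNReal.ofReal (D.mass π.1)

end MC

/-- A finite Markov decision process. `P s a = none` means that action `a` is unavailable in
state `s`; otherwise `P s a = some p` with a probability distribution `p` on the states. Every
state has an available action. -/
structure MDP (S Act : Type*) [Fintype S] where
  /-- the initial state -/
  init : S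
  /-- the partial transition probability function -/
  P : S → Act → Option (S → ℝ)
  nonneg : ∀ s a p, P s a = some p → ∀ s', 0 ≤ p s'
  sum_one : ∀ s a p, P s a = some p → ∑ s', p s' = 1
  exists_available : ∀ s, ∃ a, (P s a).isSome

namespace MDP

variable {S Act : Type*} [Fintype S]

/-- Deterministic memoryless strategies: functions that choose an available action in each
state. -/
def DMStrategy (M : MDP S Act) : Type _ :=
  {σ : S → Act // ∀ s, (M.P s (σ s)).isSome}

/-- The Markov chain induced by a deterministic memoryless strategy. -/
def induced (M : MDP S Act) (σ : M.DMStrategy) : MC S where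
  init := M.init
  P s := (M.P s (σ.1 s)).get (σ.2 s)
  nonneg s := M.nonneg s (σ.1 s) _ (Option.some_get (σ.2 s)).symm
  sum_one s := M.sum_one s (σ.1 s) _ (Option.some_get (σ.2 s)).symm

end MDP

/-! ## Parametric Markov decision processes -/

/-- A (polynomial) parametric Markov decision process with parameters in `X`. Unavailable actions
are treated as in `MDP`. -/
structure PMDP (S Act X : Type*) where
  /-- the initial state -/
  init : S
  /-- the parametric transition function -/
  P : S → Act → Option (S → MvPolynomial X ℚ)
  exists_available : ∀ s, ∃ a, (P s a).isSome

namespace PMDP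

variable {S Act X : Type*} [Fintype S]

/-- A pMDP is simple if each transition is labelled by `x`, by `1 - x` (for a parameter `x`), or by
a nonnegative rational constant, and the labels of each available action sum up to `1`
identically. -/
def IsSimple (M : PMDP S Act X) : Prop :=
  ∀ s a p, M.P s a = some p →
    (∀ s', (∃ x : X, p s' = MvPolynomial.X x ∨ p s' = 1 - MvPolynomial.X x) ∨
      ∃ q : ℚ, 0 ≤ q ∧ p s' = MvPolynomial.C q) ∧
    ∑ s', p s' = 1

/-- A real valuation of the parameters is well-defined if it yields an MDP. -/
def WellDefined (M : PMDP S Act X) (v : X → ℝ) : Prop :=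
  ∀ s a p, M.P s a = some p →
    (∀ s', 0 ≤ MvPolynomial.aeval v (p s')) ∧ ∑ s', MvPolynomial.aeval v (p s') = 1

/-- The instantiation of a pMDP by a well-defined valuation. -/
noncomputable def instantiate (M : PMDP S Act X) (v : X → ℝ) (hv : M.WellDefined v) :
    MDP S Act where
  init := M.init
  P s a := (M.P s a).map fun p s' => MvPolynomial.aeval v (p s')
  nonneg s a p h := by
    obtain ⟨q, hq, rfl⟩ := Option.map_eq_some_iff.1 h
    exact (hv s a q hq).1
  sum_one s a p h := by
    obtain ⟨q, hq, rfl⟩ := Option.map_eq_some_iff.1 h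
    exact (hv s a q hq).2
  exists_available s := by
    obtain ⟨a, ha⟩ := M.exists_available s
    exact ⟨a, by simpa using ha⟩

/-- The transition `(s, a, s')` vanishes under the valuation `v`. -/
def Vanishes (M : PMDP S Act X) (v : X → ℝ) (s : S) (a : Act) (s' : S) : Prop :=
  ∃ p, M.P s a = some p ∧ p s' ≠ 0 ∧ MvPolynomial.aeval v (p s') = 0

/-- A valuation under which no transition vanishes. -/
def GraphPreserving (M : PMDP S Act X) (v : X → ℝ) : Prop :=
  ∀ s a s', ¬ M.Vanishes v s a s'

end PMDP

/-! ## The qualitative reachability problems -/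

/-- The sets of valuations over which the problems range: all well-defined valuations, the
graph-preserving ones, and the Boolean ones. -/
inductive ValuationClass
  | wellDefined
  | graphPreserving
  | boolean

/-- The condition, besides well-definedness, for a valuation to belong to a class. -/
def ValuationClass.Mem {S Act X : Type*} [Fintype S] (M : PMDP S Act X) (v : X → ℝ) :
    ValuationClass → Prop
  | wellDefined => True
  | graphPreserving => M.GraphPreserving v
  | boolean => ∀ x, v x = 0 ∨ v x = 1

/-- The qualitative conditions on a reachability probability. -/
inductive QualCond
  | positive
  | unsure
  | safe
  | almostSure

/-- `> 0`, `< 1`, `≤ 0` and `≥ 1`, respectively. -/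
def QualCond.Sat (r : ENNReal) : QualCond → Prop
  | positive => r > 0
  | unsure => r < 1
  | safe => r ≤ 0
  | almostSure => r ≥ 1

/-- The resolution of the nondeterminism by strategies: existential or universal. -/
inductive Quant
  | ex
  | all

/-- `Q σ, Pr_M^σ(◇ T) ⋈ λ`, where `σ` ranges over the deterministic memoryless strategies. -/
def MDP.Satisfies {S Act : Type*} [Fintype S] (M : MDP S Act) (T : Set S) (c : QualCond) :
    Quant → Prop
  | Quant.ex => ∃ σ : M.DMStrategy, c.Sat ((M.induced σ).reachProb T)
  | Quant.all => ∀ σ : M.DMStrategy, c.Sat ((M.induced σ).reachProb T)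

/-- The pMDP `M` with targets `T` is a yes-instance of the qualitative reachability problem: some
valuation of the given class yields an MDP that has the required property. -/
def PMDP.YesInstance {S Act X : Type*} [Fintype S] (R : ValuationClass) (Q : Quant) (c : QualCond)
    (M : PMDP S Act X) (T : Set S) : Prop :=
  ∃ (v : X → ℝ) (hv : M.WellDefined v), R.Mem M v ∧ (M.instantiate v hv).Satisfies T c Q

/-! ## Encoding of simple pMDPs as words -/

/-- The alphabet. -/
inductive Sym
  | bit (b : Bool)
  | sep
  | unavailable
  | param
  | compl
  | const
  deriving DecidableEq, Fintype

/-- A transition label of a simple pMDP with `k` parameters, as it is written down: `x`, `1 - x`, or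
a fraction given by its numerator and denominator (not necessarily in lowest terms). -/
inductive Label (k : ℕ)
  | param (x : Fin k)
  | compl (x : Fin k)
  | const (num den : ℕ)

namespace Label

variable {k : ℕ}

/-- The polynomial that a label denotes. -/
noncomputable def toPoly : Label k → MvPolynomial (Fin k) ℚ
  | param x => MvPolynomial.X x
  | compl x => 1 - MvPolynomial.X x
  | const num den => MvPolynomial.C ((num : ℚ) / (den : ℚ))

/-- Fractions must have a nonzero denominator. -/
def Valid : Label k → Prop
  | const _ den => den ≠ 0
  | _ => True

end Label

/-- Names of states and parameters and the sizes of the finite sets, in unary (an explicit list of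
the elements of a finite set takes at least as much space). -/
def encodeUnary (n : ℕ) : List Sym :=
  List.replicate n (Sym.bit true) ++ [Sym.sep]

/-- Integers, in binary, least significant bit first. -/
def encodeBinary (n : ℕ) : List Sym :=
  n.bits.map Sym.bit ++ [Sym.sep]

/-- The word of a label. -/
def Label.encode {k : ℕ} : Label k → List Sym
  | param x => Sym.param :: encodeUnary x
  | compl x => Sym.compl :: encodeUnary x
  | const num den => Sym.const :: (encodeBinary num ++ encodeBinary den)

/-- The word of the labels of an action: a marker if the action is unavailable, and the list of all
labels otherwise. -/
def encodeRow {n k : ℕ} : Option (Fin n → Label k) → List Sym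
  | none => [Sym.unavailable]
  | some f => (List.finRange n).flatMap fun s' => (f s').encode

/-- The word of an instance: the numbers of states, of actions and of parameters, the initial state,
the indicator vector of the target set, and the table of the transition function. -/
def encodeInstance {n m k : ℕ} (init : Fin n) (T : Finset (Fin n))
    (table : Fin n → Fin m → Option (Fin n → Label k)) : List Sym :=
  encodeUnary n ++ encodeUnary m ++ encodeUnary k ++ encodeUnary init ++
    ((List.finRange n).map fun s => Sym.bit (decide (s ∈ T))) ++
    (List.finRange n).flatMap fun s => (List.finRange m).flatMap fun a => encodeRow (table s a)

/-- The word `w` is a description of the pMDP `M` with target set `T`. -/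
def Represents {n m k : ℕ} (w : List Sym) (M : PMDP (Fin n) (Fin m) (Fin k))
    (T : Finset (Fin n)) : Prop :=
  ∃ table : Fin n → Fin m → Option (Fin n → Label k),
    (∀ s a f, table s a = some f → ∀ s', (f s').Valid) ∧
    (∀ s a, M.P s a = (table s a).map fun f s' => (f s').toPoly) ∧
    w = encodeInstance M.init T table

/-- The qualitative reachability problem for simple pMDPs, with valuations in `R`, strategies
quantified by `Q`, and condition `c`: the language of all descriptions of yes-instances. -/
def qualReach (R : ValuationClass) (Q : Quant) (c : QualCond) : Language Sym :=
  {w | ∃ (n m k : ℕ) (M : PMDP (Fin n) (Fin m) (Fin k)) (T : Finset (Fin n)),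
    M.IsSimple ∧ Represents w M T ∧ M.YesInstance R Q c (T : Set (Fin n))}

end ParamMDP

/-!
# Qualitative reachability in simple parametric MDPs is in NP

Whether a reachability probability in a finite Markov chain is `> 0`, `< 1`, `≤ 0` or `≥ 1` depends
only on the graph of the chain (`MC.sat_iff`): it is positive iff a target can be reached, and it is
one iff a target remains reachable until one is visited. For the latter, the least probability
among the states that can be visited before the targets is preserved by successors, hence equals
the probability at a target.

Under a valuation, a label `x`, `1 - x` or `q` of a simple pMDP vanishes iff `x = 0`, `x = 1` or
`q = 0`. Hence the graph depends only on the *abstract valuation* that distinguishes the values `0`,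
`1` and all others, and every assignment of these three values comes from a well-defined valuation,
with `1 / 2` as the third value. Graph-preserving valuations all yield the graph of the abstract
valuation that is constantly `2`.

It remains to certify that in a finite graph game a graph condition holds for one given memoryless
strategy, or for all of them. In both cases a *ranking* of the states serves that obeys a local
condition at each ranked state (`QualCond.RankOK`, `QualCond.ValidRanking.graphSat`). If the
condition holds for all strategies then a ranking exists (`exists_validRanking`). For `> 0` and
`< 1`, a maximal ranking leaves over a set of states from which a single memoryless strategy
falsifies the condition; for `≤ 0` and `≥ 1`, the states that some strategy can reach (before the
targets, in the case of `≥ 1`) are ranked. Thus yes-instances have polynomial certificates, which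
consist of an abstract valuation, a strategy and a ranking (`yesInstance_iff`). That the labels of
an action sum up to `1` identically is checked on the lists of the terms `x` and `1 - x`
and on the sum of the constants (`sum_eq_one_iff`).

The verifier has to be run by a Turing machine. Structured programs on finitely many stacks are
compiled to Mathlib's multi-stack machines with exact step counts
(`Prog.computableInPolyTime_of_exec`). Data are encoded by binary trees, and `PolyTime f` says that
some program replaces the code of an argument on a stack by the code of its image in polynomial
time, whatever lies below it. These functions are closed under composition, pairing, case
distinction and bounded iteration, hence under the usual operations on lists and numbers, so that
`fun_prop` proves the verifier `Certificate.check` to be polynomial-time. A certificate contains a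
copy of the instance in parsed form; the verifier prints this copy and compares it with the input
word, so that it does not have to parse the input. The size of certificates is bounded in
`Certificate.sz_ofWitness`.
-/

namespace StackProg

/-! ### Structured stack programs and their Turing machines -/

variable {K : Type} {Γ : K → Type}

/-- Structured programs that work on a family of stacks. `case k c` pops the stack `k` and continues
with `c` at the popped symbol (`none` if the stack was empty); `loop k final c` pops the stack `k`
and, unless the popped symbol satisfies `final`, runs `c` at that symbol and starts again. -/
inductive Prog (Γ : K → Type) : Type
  | skip
  | push (k : K) (a : Γ k)
  | seq (c d : Prog Γ)
  | case (k : K) (c : Option (Γ k) → Prog Γ)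
  | loop (k : K) (final : Option (Γ k) → Bool) (c : Option (Γ k) → Prog Γ)

namespace Prog

/-- The program points of a program, which serve as labels of a Turing machine. -/
def Point : Prog Γ → Type
  | skip => Unit
  | push _ _ => Unit
  | seq c d => Point c ⊕ Point d
  | case _ c => Option (Σ a, Point (c a))
  | loop _ _ c => Option (Σ a, Point (c a))

theorem finite_point [∀ k, Finite (Γ k)] : ∀ c : Prog Γ, Finite (Point c)
  | skip => inferInstanceAs (Finite Unit)
  | push _ _ => inferInstanceAs (Finite Unit)
  | seq c d => by
    have := finite_point c
    have := finite_point d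
    exact inferInstanceAs (Finite (Point c ⊕ Point d))
  | case _ c => by
    have := fun a => finite_point (c a)
    exact inferInstanceAs (Finite (Option (Σ a, Point (c a))))
  | loop _ _ c => by
    have := fun a => finite_point (c a)
    exact inferInstanceAs (Finite (Option (Σ a, Point (c a))))

/-- The program point at which the execution of a program starts. -/
def entry : (c : Prog Γ) → Point c
  | skip => ()
  | push _ _ => ()
  | seq c _ => Sum.inl (entry c)
  | case _ _ => none
  | loop _ _ _ => none

variable [DecidableEq K]

open Turing.TM2 (Stmt) in
/-- The statements at the points of a program, when the points are embedded into a type of labels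
and the program continues at the label `exit`. The internal state of the machine records the
symbol popped last from each stack. -/
def compile {Λ : Type} : (c : Prog Γ) → (Point c → Λ) → Λ → Point c →
    Stmt Γ Λ (∀ k, Option (Γ k))
  | skip, _, exit, _ => Stmt.goto fun _ => exit
  | push k a, _, exit, _ => Stmt.push k (fun _ => a) (Stmt.goto fun _ => exit)
  | seq c d, emb, _, Sum.inl l => compile c (emb ∘ Sum.inl) (emb (Sum.inr d.entry)) l
  | seq _ d, emb, exit, Sum.inr l => compile d (emb ∘ Sum.inr) exit l
  | case k c, emb, _, none =>
    Stmt.pop k (fun v a => Function.update v k a)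
      (Stmt.goto fun v => emb (some ⟨v k, (c (v k)).entry⟩))
  | case _ c, emb, exit, some ⟨a, l⟩ => compile (c a) (fun l => emb (some ⟨a, l⟩)) exit l
  | loop k final c, emb, exit, none =>
    Stmt.pop k (fun v a => Function.update v k a)
      (Stmt.goto fun v => if final (v k) then exit else emb (some ⟨v k, (c (v k)).entry⟩))
  | loop _ _ c, emb, _, some ⟨a, l⟩ => compile (c a) (fun l => emb (some ⟨a, l⟩)) (emb none) l

/-- `Exec c s s' t`: started on the stacks `s`, the program `c` stops with the stacks `s'` after
`t` steps. -/
inductive Exec : Prog Γ → (∀ k, List (Γ k)) → (∀ k, List (Γ k)) → ℕ → Prop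
  | skip (s) : Exec skip s s 1
  | push (k a s) : Exec (push k a) s (Function.update s k (a :: s k)) 1
  | seq {c d s s' s'' t u} : Exec c s s' t → Exec d s' s'' u → Exec (seq c d) s s'' (t + u)
  | case {k c s s' t} : Exec (c (s k).head?) (Function.update s k (s k).tail) s' t →
      Exec (case k c) s s' (t + 1)
  | final {k final c s} : final (s k).head? = true →
      Exec (loop k final c) s (Function.update s k (s k).tail) 1
  | loop {k final c s s' s'' t u} : final (s k).head? = false →
      Exec (c (s k).head?) (Function.update s k (s k).tail) s' t →
      Exec (loop k final c) s' s'' u → Exec (loop k final c) s s'' (t + u + 1)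

/-- Each step pushes at most one symbol. -/
theorem Exec.length_le {c : Prog Γ} {s s' t} (h : Exec c s s' t) (k : K) :
    (s' k).length ≤ (s k).length + t := by
  have tl : ∀ (s : ∀ k, List (Γ k)) (j : K),
      (Function.update s j (s j).tail k).length ≤ (s k).length := by
    intro s j
    by_cases hj : k = j
    · subst hj; simp
    · simp [Function.update_of_ne hj]
  induction h with
  | skip => simp
  | push j a s =>
    by_cases hj : k = j
    · subst hj; simp
    · simp [Function.update_of_ne hj]
  | seq _ _ h₁ h₂ => omega
  | case _ ih => have := tl (by assumption) (by assumption); grind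
  | final => have := tl (by assumption) (by assumption); grind
  | loop _ _ _ ih₁ ih₂ => have := tl (by assumption) (by assumption); grind

open Turing

/-- The machine `M` goes from the configuration `a` to `b` in `n` steps. -/
def StepsTo {Λ σ : Type} (M : Λ → TM2.Stmt Γ Λ σ) (n : ℕ) (a b : TM2.Cfg Γ Λ σ) : Prop :=
  (flip bind (TM2.step M))^[n] (some a) = some b

theorem StepsTo.trans {Λ σ : Type} {M : Λ → TM2.Stmt Γ Λ σ} {m n : ℕ} {a b c : TM2.Cfg Γ Λ σ}
    (h₁ : StepsTo M m a b) (h₂ : StepsTo M n b c) : StepsTo M (m + n) a c := by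
  unfold StepsTo at *
  rw [Nat.add_comm, Function.iterate_add_apply, h₁, h₂]

theorem StepsTo.single {Λ σ : Type} {M : Λ → TM2.Stmt Γ Λ σ} {a b : TM2.Cfg Γ Λ σ}
    (h : TM2.step M a = some b) : StepsTo M 1 a b := h

/-- A machine that contains the compiled program simulates its executions step by step. -/
theorem Exec.stepsTo {c : Prog Γ} {s s' t} (h : Exec c s s' t) {Λ : Type}
    {M : Λ → TM2.Stmt Γ Λ (∀ k, Option (Γ k))} {emb : Point c → Λ} {exit : Λ}
    (hM : ∀ l, M (emb l) = compile c emb exit l) (v : ∀ k, Option (Γ k)) :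
    ∃ v', StepsTo M t ⟨some (emb c.entry), v, s⟩ ⟨some exit, v', s'⟩ := by
  induction h generalizing exit v with
  | skip s => exact ⟨v, StepsTo.single (by simp [hM, compile])⟩
  | push k a s => exact ⟨v, StepsTo.single (by simp [hM, compile])⟩
  | @seq c d s s' s'' t u _ _ ih₁ ih₂ =>
    obtain ⟨v₁, h₁⟩ := ih₁ (emb := emb ∘ Sum.inl) (exit := emb (Sum.inr d.entry))
      (fun l => by have := hM (Sum.inl l); simp only [compile] at this; exact this) v
    obtain ⟨v₂, h₂⟩ := ih₂ (emb := emb ∘ Sum.inr) (exit := exit)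
      (fun l => by have := hM (Sum.inr l); simp only [compile] at this; exact this) v₁
    exact ⟨v₂, h₁.trans h₂⟩
  | @case k c s s' t _ ih =>
    obtain ⟨v₁, h₁⟩ := ih (emb := fun l => emb (some ⟨(s k).head?, l⟩)) (exit := exit)
      (fun l => by have := hM (some ⟨_, l⟩); simp only [compile] at this; exact this)
      (Function.update v k (s k).head?)
    refine ⟨v₁, ?_⟩
    rw [Nat.add_comm]
    refine StepsTo.trans (StepsTo.single ?_) h₁
    rw [TM2.step, hM (entry _)]
    simp only [entry, compile, TM2.stepAux]
    rw [Function.update_self]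
  | @final k final c s h =>
    refine ⟨Function.update v k (s k).head?, StepsTo.single ?_⟩
    rw [TM2.step, hM (entry _)]
    simp [entry, compile, h]
  | @loop k final c s s' s'' t u h _ _ ih₁ ih₂ =>
    obtain ⟨v₁, h₁⟩ := ih₁ (emb := fun l => emb (some ⟨(s k).head?, l⟩)) (exit := emb none)
      (fun l => by have := hM (some ⟨_, l⟩); simp only [compile] at this; exact this)
      (Function.update v k (s k).head?)
    obtain ⟨v₂, h₂⟩ := ih₂ (emb := emb) (exit := exit) hM v₁
    refine ⟨v₂, ?_⟩
    rw [Nat.add_comm]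
    refine StepsTo.trans (StepsTo.single ?_) (h₁.trans h₂)
    rw [TM2.step, hM (entry _)]
    simp only [entry, compile, TM2.stepAux]
    rw [Function.update_self]
    simp [h]

/-- The Turing machine of a program; the extra label `none` resets the internal state and halts. -/
noncomputable def machine [Fintype K] [∀ k, Fintype (Γ k)] (k₀ k₁ : K) (c : Prog Γ) : FinTM2 :=
  haveI := finite_point c
  haveI : Fintype (Point c) := Fintype.ofFinite _
  { K := K
    k₀ := k₀
    k₁ := k₁
    Γ := Γ
    Λ := Option (Point c)
    main := some c.entry
    σ := ∀ k, Option (Γ k)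
    initialState := fun _ => none
    m := fun l => l.elim (TM2.Stmt.load (fun _ _ => none) TM2.Stmt.halt)
      (compile c some none) }

/-- The initial stacks of a machine in terms of `Function.update`. -/
theorem dite_eq_update (k₀ : K) (x : List (Γ k₀)) :
    (fun k => if h : k = k₀ then (by rw [h]; exact x : List (Γ k)) else []) =
      Function.update (fun _ => []) k₀ x := by
  funext k
  by_cases hk : k = k₀
  · subst hk; simp
  · simp [hk]

/-- A program with polynomially long executions that leave nothing but the output on the stacks
yields a polynomial-time Turing machine. -/
theorem computableInPolyTime_of_exec [Fintype K] [∀ k, Fintype (Γ k)] (k₀ k₁ : K) (c : Prog Γ)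
    {α β αΓ βΓ : Type} (ea : α → List αΓ) (eb : β → List βΓ) (f : α → β)
    (ei : Γ k₀ ≃ αΓ) (eo : Γ k₁ ≃ βΓ) (p : Polynomial ℕ)
    (h : ∀ a, ∃ t ≤ p.eval (ea a).length,
      Exec c (Function.update (fun _ => []) k₀ ((ea a).map ei.symm))
        (Function.update (fun _ => []) k₁ ((eb (f a)).map eo.symm)) t) :
    Nonempty (TM2ComputableInPolyTime ea eb f) := by
  refine ⟨{ tm := machine k₀ k₁ c, inputAlphabet := ei, outputAlphabet := eo, time := p + 1,
            outputsFun := fun a => Classical.choice ?_ }⟩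
  obtain ⟨t, ht, hx⟩ := h a
  obtain ⟨v, hv⟩ := hx.stepsTo (M := (machine k₀ k₁ c).m) (emb := some) (exit := none)
    (fun l => rfl) (fun _ => none)
  have hall : StepsTo (machine k₀ k₁ c).m (t + 1) _
      ⟨none, fun _ => none, Function.update (fun _ => []) k₁ ((eb (f a)).map eo.symm)⟩ :=
    hv.trans (StepsTo.single rfl)
  refine ⟨⟨⟨t + 1, ?_⟩, by simpa using ht⟩⟩
  have e₁ : initList (machine k₀ k₁ c) ((ea a).map ei.symm) =
      ⟨some (some c.entry), fun _ => none,
        Function.update (fun _ => []) k₀ ((ea a).map ei.symm)⟩ :=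
    congrArg (TM2.Cfg.mk _ _) (dite_eq_update k₀ _)
  have e₂ : haltList (machine k₀ k₁ c) ((eb (f a)).map eo.symm) =
      ⟨none, fun _ => none, Function.update (fun _ => []) k₁ ((eb (f a)).map eo.symm)⟩ :=
    congrArg (TM2.Cfg.mk _ _) (dite_eq_update k₁ _)
  exact (congrArg (fun x => (flip bind (machine k₀ k₁ c).step)^[t + 1] (some x)) e₁).trans
    (Eq.trans hall (congrArg some e₂.symm))

end Prog

end StackProg

namespace StackProg

/-! ### Trees and stacks -/

open StackProg.Prog

/-- Binary trees, the universal data type of the programs. -/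
inductive Tree
  | nil
  | node (l r : Tree)
  deriving DecidableEq

namespace Tree

/-- The prefix code of a tree. -/
def word : Tree → List Bool
  | nil => [false]
  | node l r => true :: (word l ++ word r)

/-- The size of a tree is the length of its code. -/
def size (x : Tree) : ℕ := x.word.length

/-- The left subtree; that of `nil` is `nil`. -/
def fst : Tree → Tree
  | nil => nil
  | node l _ => l

/-- The right subtree; that of `nil` is `nil`. -/
def snd : Tree → Tree
  | nil => nil
  | node _ r => r

@[simp] theorem fst_nil : nil.fst = nil := rfl
@[simp] theorem snd_nil : nil.snd = nil := rfl
@[simp] theorem fst_node (l r : Tree) : (node l r).fst = l := rfl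
@[simp] theorem snd_node (l r : Tree) : (node l r).snd = r := rfl
@[simp] theorem size_nil : nil.size = 1 := rfl
@[simp] theorem size_node (l r : Tree) : (node l r).size = l.size + r.size + 1 := by
  simp [size, word]

theorem one_le_size (x : Tree) : 1 ≤ x.size := by cases x <;> simp

end Tree

open StackProg.Tree

/-- The stacks: input, output, the main stack of data, and two auxiliary stacks. -/
inductive Stk
  | inp
  | out
  | main
  | sav
  | cnt
  deriving DecidableEq

instance : Fintype Stk :=
  ⟨{.inp, .out, .main, .sav, .cnt}, fun k => by cases k <;> simp⟩

/-- The alphabets of the stacks. On the auxiliary stacks, `none` marks the bottom of the part that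
is in use. -/
def Alph (G : Type) : Stk → Type
  | .inp => G
  | .out => Bool
  | .main => Bool
  | .sav => Option Bool
  | .cnt => Option Bool

instance (G : Type) [Fintype G] : ∀ k, Fintype (Alph G k)
  | .inp => inferInstanceAs (Fintype G)
  | .out => inferInstanceAs (Fintype Bool)
  | .main => inferInstanceAs (Fintype Bool)
  | .sav => inferInstanceAs (Fintype (Option Bool))
  | .cnt => inferInstanceAs (Fintype (Option Bool))

variable {G : Type}

/-- The family of stacks with the given contents. -/
def conf (i : List G) (o a : List Bool) (b d : List (Option Bool)) : ∀ k, List (Alph G k)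
  | .inp => i
  | .out => o
  | .main => a
  | .sav => b
  | .cnt => d

section update

variable (i : List G) (o a : List Bool) (b d : List (Option Bool))

theorem update_inp (x : List G) :
    Function.update (conf i o a b d) .inp x = conf x o a b d := by
  funext k; cases k <;> rfl

theorem update_out (x : List Bool) :
    Function.update (conf i o a b d) .out x = conf i x a b d := by
  funext k; cases k <;> rfl

theorem update_main (x : List Bool) :
    Function.update (conf i o a b d) .main x = conf i o x b d := by
  funext k; cases k <;> rfl

theorem update_sav (x : List (Option Bool)) :
    Function.update (conf i o a b d) .sav x = conf i o a x d := by
  funext k; cases k <;> rfl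

theorem update_cnt (x : List (Option Bool)) :
    Function.update (conf i o a b d) .cnt x = conf i o a b x := by
  funext k; cases k <;> rfl

end update

theorem Prog.Exec.congr {c : Prog (Alph G)} {s s' s₁ s₁' : ∀ k, List (Alph G k)}
    {t : ℕ} (h : Exec c s s' t) (e : s = s₁) (e' : s' = s₁') : Exec c s₁ s₁' t := by
  subst e e'
  exact h

/-- The program `c` turns the contents `a`, `b`, `d` of the three working stacks into `a'`, `b'`,
`d'` in at most `t` steps, and leaves the input and output stacks as they are. -/
def Runs (c : Prog (Alph G)) (a : List Bool) (b d : List (Option Bool)) (a' : List Bool)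
    (b' d' : List (Option Bool)) (t : ℕ) : Prop :=
  ∀ i o, ∃ t' ≤ t, Exec c (conf i o a b d) (conf i o a' b' d') t'

namespace Runs

variable {a a' a'' : List Bool} {b b' b'' d d' d'' : List (Option Bool)} {t u : ℕ}

theorem mono {c : Prog (Alph G)} (h : Runs c a b d a' b' d' t) (htu : t ≤ u) :
    Runs c a b d a' b' d' u := fun i o =>
  let ⟨t', ht, hx⟩ := h i o
  ⟨t', ht.trans htu, hx⟩

theorem congr {c : Prog (Alph G)} (h : Runs c a b d a' b' d' t) {a₁ a₁' : List Bool}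
    {b₁' : List (Option Bool)} (e : a = a₁) (e' : a' = a₁') (eb : b' = b₁') (htu : t ≤ u) :
    Runs c a₁ b d a₁' b₁' d' u := by
  subst e e' eb
  exact h.mono htu

theorem skip : Runs (G := G) skip a b d a b d 1 := fun _ _ => ⟨1, le_rfl, Exec.skip _⟩

theorem seq {c e : Prog (Alph G)} (h₁ : Runs c a b d a' b' d' t)
    (h₂ : Runs e a' b' d' a'' b'' d'' u) : Runs (seq c e) a b d a'' b'' d'' (t + u) := by
  intro i o
  obtain ⟨t₁, h₁, hx₁⟩ := h₁ i o
  obtain ⟨t₂, h₂, hx₂⟩ := h₂ i o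
  exact ⟨t₁ + t₂, by omega, Exec.seq hx₁ hx₂⟩

theorem push_main (x : Bool) : Runs (G := G) (push .main x) a b d (x :: a) b d 1 := fun i o =>
  ⟨1, le_rfl,
    (Exec.push (Γ := Alph G) .main x (conf i o a b d)).congr rfl (update_main i o a b d (x :: a))⟩

theorem push_sav (x : Option Bool) : Runs (G := G) (push .sav x) a b d a (x :: b) d 1 := fun i o =>
  ⟨1, le_rfl,
    (Exec.push (Γ := Alph G) .sav x (conf i o a b d)).congr rfl (update_sav i o a b d (x :: b))⟩

theorem push_cnt (x : Option Bool) : Runs (G := G) (push .cnt x) a b d a b (x :: d) 1 := fun i o =>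
  ⟨1, le_rfl,
    (Exec.push (Γ := Alph G) .cnt x (conf i o a b d)).congr rfl (update_cnt i o a b d (x :: d))⟩

theorem case_main {c : Option Bool → Prog (Alph G)} {x : Bool}
    (h : Runs (c (some x)) a b d a' b' d' t) :
    Runs (case .main c) (x :: a) b d a' b' d' (t + 1) := by
  intro i o
  obtain ⟨t', ht, hx⟩ := h i o
  refine ⟨t' + 1, by omega, Exec.case ?_⟩
  exact hx.congr (update_main i o (x :: a) b d a).symm rfl

theorem final_sav {c : Option (Option Bool) → Prog (Alph G)} {final : Option (Option Bool) → Bool}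
    {x : Option Bool} (h : final (some x) = true) :
    Runs (loop .sav final c) a (x :: b) d a b d 1 := by
  intro i o
  refine ⟨1, le_rfl, ?_⟩
  exact (Exec.final (Γ := Alph G) (k := .sav) (final := final) (c := c) (s := conf i o a (x :: b) d)
    h).congr rfl (update_sav i o a (x :: b) d b)

theorem loop_sav {c : Option (Option Bool) → Prog (Alph G)} {final : Option (Option Bool) → Bool}
    {x : Option Bool} (h : final (some x) = false) (h₁ : Runs (c (some x)) a b d a' b' d' t)
    (h₂ : Runs (loop .sav final c) a' b' d' a'' b'' d'' u) :
    Runs (loop .sav final c) a (x :: b) d a'' b'' d'' (t + u + 1) := by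
  intro i o
  obtain ⟨t₁, h₁, hx₁⟩ := h₁ i o
  obtain ⟨t₂, h₂, hx₂⟩ := h₂ i o
  refine ⟨t₁ + t₂ + 1, by omega, Exec.loop (Γ := Alph G) (k := .sav) h ?_ hx₂⟩
  exact hx₁.congr (update_sav i o a (x :: b) d b).symm rfl

theorem final_cnt {c : Option (Option Bool) → Prog (Alph G)} {final : Option (Option Bool) → Bool}
    {x : Option Bool} (h : final (some x) = true) :
    Runs (loop .cnt final c) a b (x :: d) a b d 1 := by
  intro i o
  refine ⟨1, le_rfl, ?_⟩
  exact (Exec.final (Γ := Alph G) (k := .cnt) (final := final) (c := c) (s := conf i o a b (x :: d))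
    h).congr rfl (update_cnt i o a b (x :: d) d)

theorem loop_cnt {c : Option (Option Bool) → Prog (Alph G)} {final : Option (Option Bool) → Bool}
    {x : Option Bool} (h : final (some x) = false) (h₁ : Runs (c (some x)) a b d a' b' d' t)
    (h₂ : Runs (loop .cnt final c) a' b' d' a'' b'' d'' u) :
    Runs (loop .cnt final c) a b (x :: d) a'' b'' d'' (t + u + 1) := by
  intro i o
  obtain ⟨t₁, h₁, hx₁⟩ := h₁ i o
  obtain ⟨t₂, h₂, hx₂⟩ := h₂ i o
  refine ⟨t₁ + t₂ + 1, by omega, Exec.loop (Γ := Alph G) (k := .cnt) h ?_ hx₂⟩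
  exact hx₁.congr (update_cnt i o a b (x :: d) d).symm rfl

end Runs

/-! ### Programs that handle single trees on the main stack -/

/-- Reads one tree off the main stack, with one `true` on the stack `cnt` for each subtree still to
be read; the code read is pushed onto the stack `sav` if `keep` holds. -/
def readLoop (G : Type) (keep : Bool) : Prog (Alph G) :=
  loop .cnt (fun x : Option (Option Bool) => x != some (some true)) fun _ =>
    case .main fun x : Option Bool =>
      match x with
      | some true =>
        seq (if keep then push .sav (some true) else skip)
          (seq (push .cnt (some true)) (push .cnt (some true)))
      | _ => if keep then push .sav (some false) else skip

theorem runs_keep (keep : Bool) (x : Bool) {a : List Bool} {b d : List (Option Bool)} :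
    Runs (G := G) (if keep then push .sav (some x) else skip) a b d a
      (if keep then some x :: b else b) d 1 := by
  cases keep
  · exact Runs.skip
  · exact Runs.push_sav _

/-- The loop reads the tree on top; `h` says how it goes on with the subtrees still to be read. -/
theorem runs_readLoop (keep : Bool) (x : Tree) {r a : List Bool} {b d b' d' : List (Option Bool)}
    {u : ℕ}
    (h : Runs (readLoop G keep) r (if keep then x.word.reverse.map some ++ b else b) d a b' d' u) :
    Runs (readLoop G keep) (x.word ++ r) b (some true :: d) a b' d' (u + 5 * x.size) := by
  induction x generalizing r b d u with
  | nil =>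
    refine (Runs.loop_cnt rfl (Runs.case_main (x := false) (runs_keep keep false)) ?_).mono
      (t := 1 + 1 + u + 1) (by simp; omega)
    cases keep <;> exact h
  | node l s ihl ihs =>
    have h₂ := ihl (r := s.word ++ r) (b := if keep then some true :: b else b)
      (d := some true :: d) (u := u + 5 * s.size) (ihs (by
        cases keep <;> simpa [word] using h))
    exact Runs.congr (Runs.loop_cnt rfl (Runs.case_main (x := true)
      ((runs_keep keep true).seq ((Runs.push_cnt _).seq (Runs.push_cnt _)))) h₂)
      (by simp [word]) rfl rfl (by simp; omega)

/-- Reads one tree off the main stack. -/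
def readTree (G : Type) (keep : Bool) : Prog (Alph G) :=
  seq (push .cnt none) (seq (push .cnt (some true)) (readLoop G keep))

theorem runs_readTree (keep : Bool) (x : Tree) (r : List Bool) (b d : List (Option Bool)) :
    Runs (readTree G keep) (x.word ++ r) b d r
      (if keep then x.word.reverse.map some ++ b else b) d (5 * x.size + 3) :=
  ((Runs.push_cnt _).seq ((Runs.push_cnt _).seq
    (runs_readLoop keep x (Runs.final_cnt rfl)))).mono (by omega)

/-- Moves the upper part of the stack `sav`, up to the marker, to the main stack. -/
def restore (G : Type) : Prog (Alph G) :=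
  loop .sav (fun x : Option (Option Bool) => x.join.isNone)
    fun x : Option (Option Bool) => push .main (x.join.getD false)

theorem runs_restore (l a : List Bool) (b d : List (Option Bool)) :
    Runs (restore G) a (l.map some ++ none :: b) d (l.reverse ++ a) b d (2 * l.length + 1) := by
  induction l generalizing a with
  | nil => exact Runs.final_sav rfl
  | cons x l ih =>
    exact Runs.congr (Runs.loop_sav rfl (Runs.push_main x) (ih _)) rfl (by simp) rfl
      (by simp; omega)

/-- Copies the tree on top of the main stack, with a marker below it, to the stack `sav`. -/
def save (G : Type) : Prog (Alph G) :=
  seq (push .sav none) <| seq (readTree G true) <| seq (push .cnt none) <|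
    seq (loop .sav (fun x : Option (Option Bool) => x.join.isNone)
      fun x : Option (Option Bool) =>
        seq (push .main (x.join.getD false)) (push .cnt (some (x.join.getD false)))) <|
    seq (push .sav none) <|
      loop .cnt (fun x : Option (Option Bool) => x.join.isNone)
        fun x : Option (Option Bool) => push .sav (some (x.join.getD false))

theorem runs_save (x : Tree) (r : List Bool) (b d : List (Option Bool)) :
    Runs (save G) (x.word ++ r) b d (x.word ++ r) (x.word.reverse.map some ++ none :: b) d
      (10 * x.size + 8) := by
  have h₁ : ∀ (l a : List Bool) (d : List (Option Bool)), Runs (G := G)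
      (loop .sav (fun x : Option (Option Bool) => x.join.isNone) fun x : Option (Option Bool) =>
        seq (push .main (x.join.getD false)) (push .cnt (some (x.join.getD false))))
      a (l.map some ++ none :: b) d (l.reverseAux a) b ((l.map some).reverseAux d)
      (3 * l.length + 1) := by
    intro l
    induction l with
    | nil => exact fun a d => Runs.final_sav rfl
    | cons x l ih =>
      intro a d
      exact Runs.congr (Runs.loop_sav rfl ((Runs.push_main x).seq (Runs.push_cnt (some x)))
        (ih _ _)) rfl rfl rfl (by simp; omega)
  have h₂ : ∀ (l a : List Bool) (b : List (Option Bool)), Runs (G := G)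
      (loop .cnt (fun x : Option (Option Bool) => x.join.isNone)
        fun x : Option (Option Bool) => push .sav (some (x.join.getD false)))
      a b (l.map some ++ none :: d) a (l.reverse.map some ++ b) d (2 * l.length + 1) := by
    intro l
    induction l with
    | nil => exact fun a b => Runs.final_cnt rfl
    | cons x l ih =>
      intro a b
      exact Runs.congr (Runs.loop_cnt rfl (Runs.push_sav (some x)) (ih _ _)) rfl rfl (by simp)
        (by simp; omega)
  have h₃ := h₂ x.word (x.word ++ r) (none :: b)
  have h₄ := h₁ x.word.reverse r (none :: d)
  simp only [List.reverseAux_eq, List.reverse_reverse, ← List.map_reverse] at h₄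
  exact ((Runs.push_sav none).seq <| (runs_readTree true x r _ d).seq <|
    (Runs.push_cnt none).seq <| h₄.seq <| (Runs.push_sav none).seq h₃).mono
    (by simp [size]; omega)

/-! ### Functions computable in polynomial time -/

theorem eval_mono (p : Polynomial ℕ) {m n : ℕ} (h : m ≤ n) : p.eval m ≤ p.eval n := by
  simp only [Polynomial.eval_eq_sum_range]
  gcongr

/-- A representation of the elements of a type by trees. -/
class TreeEnc (α : Type) where
  /-- the tree that represents an element -/
  enc : α → Tree

open TreeEnc

/-- The size of the tree that represents an element. -/
def sz {α : Type} [TreeEnc α] (a : α) : ℕ := (enc a).size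

instance : TreeEnc Tree := ⟨id⟩

instance {α β : Type} [TreeEnc α] [TreeEnc β] : TreeEnc (α × β) :=
  ⟨fun x => .node (enc x.1) (enc x.2)⟩

instance : TreeEnc Bool := ⟨fun b => if b then .node .nil .nil else .nil⟩

/-- The tree of a list: its elements are the left subtrees along the right spine. -/
def encList {α : Type} [TreeEnc α] : List α → Tree
  | [] => .nil
  | a :: l => .node (enc a) (encList l)

instance {α : Type} [TreeEnc α] : TreeEnc (List α) := ⟨encList⟩

/-- Natural numbers are represented in unary. -/
def encNat : ℕ → Tree
  | 0 => .nil
  | n + 1 => .node .nil (encNat n)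

instance : TreeEnc ℕ := ⟨encNat⟩

section enc

variable {α β : Type} [TreeEnc α] [TreeEnc β]

@[simp] theorem enc_tree (x : Tree) : enc x = x := rfl
@[simp] theorem enc_prod (x : α × β) : enc x = .node (enc x.1) (enc x.2) := rfl
@[simp] theorem enc_true : enc true = .node .nil .nil := rfl
@[simp] theorem enc_false : enc false = .nil := rfl
@[simp] theorem enc_nil : enc ([] : List α) = .nil := rfl
@[simp] theorem enc_cons (a : α) (l : List α) : enc (a :: l) = .node (enc a) (enc l) := rfl
@[simp] theorem enc_zero : enc 0 = .nil := rfl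
@[simp] theorem enc_succ (n : ℕ) : enc (n + 1) = .node .nil (enc n) := rfl

@[simp] theorem sz_prod (x : α × β) : sz x = sz x.1 + sz x.2 + 1 := by simp [sz]
@[simp] theorem sz_nil : sz ([] : List α) = 1 := rfl
@[simp] theorem sz_cons (a : α) (l : List α) : sz (a :: l) = sz a + sz l + 1 := by simp [sz]
@[simp] theorem sz_nat (n : ℕ) : sz n = 2 * n + 1 := by
  induction n with
  | zero => rfl
  | succ n ih => simp [sz] at ih ⊢; omega

theorem one_le_sz (a : α) : 1 ≤ sz a := one_le_size _

theorem sz_bool (b : Bool) : sz b ≤ 3 := by cases b <;> decide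

theorem length_lt_sz (l : List α) : l.length < sz l := by
  induction l with
  | nil => simp
  | cons a l ih => simp; omega

theorem sz_le_of_mem {a : α} {l : List α} (h : a ∈ l) : sz a ≤ sz l := by
  induction l with
  | nil => simp at h
  | cons b l ih =>
    rcases List.mem_cons.1 h with rfl | h
    · simp; omega
    · have := ih h; simp; omega

end enc

/-- A function is computable in polynomial time if some program replaces the code of an argument on
top of the main stack by the code of its image, whatever lies below it. -/
def PolyTime {α β : Type} [TreeEnc α] [TreeEnc β] (f : α → β) : Prop :=
  ∀ G : Type, ∃ (c : Prog (Alph G)) (p : Polynomial ℕ), ∀ a r b d,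
    Runs c ((enc a).word ++ r) b d ((enc (f a)).word ++ r) b d (p.eval (sz a))

attribute [fun_prop] PolyTime

namespace PolyTime

variable {α β γ σ : Type} [TreeEnc α] [TreeEnc β] [TreeEnc γ] [TreeEnc σ]

theorem sz_le {f : α → β} (hf : PolyTime f) :
    ∃ p : Polynomial ℕ, ∀ a, sz (f a) ≤ p.eval (sz a) := by
  -- A program pushes at most one symbol per step, so its running time bounds the output size.
  obtain ⟨c, p, hc⟩ := hf Unit
  refine ⟨p + Polynomial.X, fun x => ?_⟩
  obtain ⟨t, ht, hx⟩ := hc x [] [] [] [] []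
  have := hx.length_le .main
  simp only [conf, List.append_nil] at this
  change sz (f x) ≤ sz x + t at this
  simp only [Polynomial.eval_add, Polynomial.eval_X]
  omega

/-- Functions that do not change the representation cost nothing. -/
theorem recode {f : α → β} (h : ∀ a, enc (f a) = enc a) : PolyTime f := fun _ =>
  ⟨.skip, 1, fun a _ _ _ => by simpa [h a] using Runs.skip⟩

@[fun_prop]
theorem id : PolyTime fun a : α => a := recode fun _ => rfl

@[fun_prop]
theorem comp {f : β → γ} {g : α → β} (hf : PolyTime f) (hg : PolyTime g) :
    PolyTime fun a => f (g a) := by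
  intro G
  obtain ⟨q, hq⟩ := hg.sz_le
  obtain ⟨c, p, hc⟩ := hf G
  obtain ⟨c', p', hc'⟩ := hg G
  refine ⟨seq c' c, p' + p.comp q, fun x r b d => ((hc' x r b d).seq (hc _ r b d)).mono ?_⟩
  simp only [Polynomial.eval_add, Polynomial.eval_comp]
  gcongr
  exact eval_mono _ (hq x)

/-- A function may be computed on the representing trees. -/
theorem of_tree {f : α → β} {g : Tree → Tree} (hg : PolyTime g) (h : ∀ a, g (enc a) = enc (f a)) :
    PolyTime f := by
  have h₁ : PolyTime fun a : α => g (enc a) := hg.comp (recode fun _ => rfl)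
  intro G
  obtain ⟨c, p, hc⟩ := h₁ G
  exact ⟨c, p, fun a r b d => by simpa [← h a] using hc a r b d⟩

theorem treeNil : PolyTime fun _ : α => Tree.nil := fun G =>
  ⟨seq (readTree G false) (push .main false), 5 * Polynomial.X + 4, fun x r b d =>
    ((runs_readTree false (enc x) r b d).seq (Runs.push_main _)).mono (by simp [sz])⟩

theorem treeFst : PolyTime Tree.fst := by
  intro G
  -- The left subtree is parked on the stack `sav` while the right one is discarded.
  refine ⟨case .main fun x : Option Bool =>
    match x with
    | some true =>
      seq (push .sav none) (seq (readTree G true) (seq (readTree G false) (restore G)))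
    | _ => push .main false, 10 * Polynomial.X + 9, fun x r b d => ?_⟩
  cases x with
  | nil => exact (Runs.case_main (x := false) (Runs.push_main _)).mono (by simp)
  | node l s =>
    have := runs_restore (G := G) l.word.reverse r b d
    rw [List.reverse_reverse] at this
    have h := (Runs.push_sav none).seq <|
      (runs_readTree (G := G) true l (s.word ++ r) (none :: b) d).seq <|
      (runs_readTree (G := G) false s r _ d).seq this
    exact Runs.congr (Runs.case_main (x := true) h) (by simp [word]) rfl rfl
      (by simp [sz, ← size.eq_1]; omega)

theorem treeSnd : PolyTime Tree.snd := by
  intro G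
  refine ⟨case .main fun x : Option Bool =>
    match x with
    | some true => readTree G false
    | _ => push .main false,
    5 * Polynomial.X + 4, fun x r b d => ?_⟩
  cases x with
  | nil => exact (Runs.case_main (x := false) (Runs.push_main _)).mono (by simp)
  | node l s =>
    have h := runs_readTree (G := G) false l (s.word ++ r) b d
    exact Runs.congr (Runs.case_main (x := true) h) (by simp [word]) rfl rfl
      (by simp [sz]; omega)

@[fun_prop]
theorem prodMk {f : α → β} {g : α → γ} (hf : PolyTime f) (hg : PolyTime g) :
    PolyTime fun a => (f a, g a) := by
  intro G
  obtain ⟨c, p, hc⟩ := hf G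
  obtain ⟨c', p', hc'⟩ := hg G
  -- A copy of the argument survives the computation of `g` on the stack `sav`.
  refine ⟨seq (save G) (seq c' (seq (restore G) (seq c (push .main true)))),
    p + p' + 12 * Polynomial.X + 10, fun x r b d => ?_⟩
  have := runs_restore (G := G) (enc x).word.reverse ((enc (g x)).word ++ r) b d
  rw [List.reverse_reverse] at this
  have h := (runs_save (G := G) (enc x) r b d).seq <| (hc' x r _ d).seq <| this.seq <|
    (hc x _ b d).seq (Runs.push_main true)
  exact h.congr rfl (by simp [word]) rfl (by simp [sz, size]; omega)

@[fun_prop]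
theorem fst {f : α → β × γ} (hf : PolyTime f) : PolyTime fun a => (f a).1 :=
  comp (f := Prod.fst) (treeFst.of_tree fun _ => rfl) hf

@[fun_prop]
theorem snd {f : α → β × γ} (hf : PolyTime f) : PolyTime fun a => (f a).2 :=
  comp (f := Prod.snd) (treeSnd.of_tree fun _ => rfl) hf

@[fun_prop]
theorem const (b : β) : PolyTime fun _ : α => b := by
  have h : ∀ x : Tree, PolyTime fun _ : α => x := by
    intro x
    induction x with
    | nil => exact treeNil
    | node l r hl hr =>
      exact comp (f := fun x : Tree × Tree => Tree.node x.1 x.2)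
        (recode fun _ => rfl) (hl.prodMk hr)
  intro G
  obtain ⟨c, p, hc⟩ := h (enc b) G
  exact ⟨c, p, hc⟩

/-- Case distinction on whether the first component is empty. -/
theorem cases {f g : β → γ} (hf : PolyTime f) (hg : PolyTime g) :
    PolyTime fun x : Tree × β => if x.1 = .nil then f x.2 else g x.2 := by
  intro G
  obtain ⟨c, p, hc⟩ := hf G
  obtain ⟨c', p', hc'⟩ := hg G
  refine ⟨case .main fun x : Option Bool =>
    match x with
    | some true =>
      case .main fun y : Option Bool =>
        match y with
        | some true => seq (push .main true) (seq (readTree G false) c')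
        | _ => c
    | _ => seq (push .main false) c,
    p + p' + 5 * Polynomial.X + 6, fun x r b d => ?_⟩
  obtain ⟨l, s⟩ := x
  cases l with
  | nil =>
    refine Runs.congr (Runs.case_main (x := true) (Runs.case_main (x := false) (hc s r b d)))
      (by simp [word]) rfl rfl ?_
    have := eval_mono p (show sz s ≤ sz (Tree.nil, s) by simp; omega)
    simp at this ⊢
    omega
  | node u v =>
    have h := (Runs.push_main true).seq <|
      (runs_readTree (G := G) false (.node u v) ((enc s).word ++ r) b d).seq (hc' s r b d)
    refine Runs.congr (Runs.case_main (x := true) (Runs.case_main (x := true) h))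
      (by simp [word]) rfl rfl ?_
    have := eval_mono p' (show sz s ≤ sz (Tree.node u v, s) by simp; omega)
    simp [sz] at this ⊢
    omega

/-- Iteration of a function until the first component is empty. -/
theorem iterWhile {f : σ → σ} {init F : α → σ} (hf : PolyTime f) (hi : PolyTime init)
    (q : Polynomial ℕ)
    (h : ∀ a, ∃ n ≤ q.eval (sz a), f^[n] (init a) = F a ∧ (enc (F a)).fst = .nil ∧
      ∀ i < n, (enc (f^[i] (init a))).fst ≠ .nil ∧ sz (f^[i] (init a)) ≤ q.eval (sz a)) :
    PolyTime F := by
  intro G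
  obtain ⟨c, p, hc⟩ := hf G
  obtain ⟨c', p', hc'⟩ := hi G
  -- The test of the first component leaves its result on the stack `cnt`, where a loop finds it.
  let test : Prog (Alph G) := case .main fun x : Option Bool =>
    match x with
    | some true =>
      case .main fun y : Option Bool =>
        match y with
        | some true => seq (push .main true) (seq (push .main true) (push .cnt (some true)))
        | _ => seq (push .main false) (seq (push .main true) (push .cnt none))
    | _ => seq (push .main false) (push .cnt none)
  have htest : ∀ (x : Tree) r b d, Runs test (x.word ++ r) b d (x.word ++ r) b
      ((if x.fst = .nil then none else some true) :: d) 5 := by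
    intro x r b d
    cases x with
    | nil =>
      exact (Runs.case_main (x := false) ((Runs.push_main false).seq (Runs.push_cnt none))).mono
        (by simp)
    | node l s =>
      cases l with
      | nil =>
        exact Runs.case_main (x := true) (Runs.case_main (x := false)
          ((Runs.push_main false).seq ((Runs.push_main true).seq (Runs.push_cnt none))))
      | node u v =>
        exact Runs.case_main (x := true) (Runs.case_main (x := true)
          ((Runs.push_main true).seq ((Runs.push_main true).seq (Runs.push_cnt (some true)))))
  let lp : Prog (Alph G) :=
    loop .cnt (fun x : Option (Option Bool) => x != some (some true)) fun _ => seq c test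
  have hloop : ∀ (n B : ℕ) (x : σ) r b d, (enc (f^[n] x)).fst = .nil →
      (∀ i < n, (enc (f^[i] x)).fst ≠ .nil ∧ sz (f^[i] x) ≤ B) →
      Runs lp ((enc x).word ++ r) b ((if (enc x).fst = .nil then none else some true) :: d)
        ((enc (f^[n] x)).word ++ r) b d (n * (p.eval B + 6) + 1) := by
    intro n B
    induction n with
    | zero =>
      intro x r b d h₁ _
      simp only [Function.iterate_zero, id_eq] at h₁ ⊢
      rw [if_pos h₁]
      exact (Runs.final_cnt rfl).mono (by omega)
    | succ n ih =>
      intro x r b d h₁ h₂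
      obtain ⟨h₃, h₄⟩ := h₂ 0 (by omega)
      simp only [Function.iterate_zero, id_eq] at h₃ h₄
      rw [if_neg h₃]
      refine (Runs.loop_cnt rfl ((hc x r b d).seq (htest _ r b d)) (ih (f x) r b d h₁
        fun i hi => h₂ (i + 1) (by omega))).mono ?_
      have := eval_mono p h₄
      rw [Nat.succ_mul]
      omega
  refine ⟨seq c' (seq test lp), p' + q * (p.comp q + 6) + 6, fun x r b d => ?_⟩
  obtain ⟨n, hn, hF, h₁, h₂⟩ := h x
  rw [← hF] at h₁ ⊢
  refine ((hc' x r b d).seq ((htest _ r b d).seq (hloop n _ _ r b d h₁ h₂))).mono ?_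
  simp only [Polynomial.eval_add, Polynomial.eval_mul, Polynomial.eval_comp,
    Polynomial.eval_ofNat]
  have := Nat.mul_le_mul_right (p.eval (q.eval (sz x)) + 6) hn
  omega

end PolyTime

end StackProg

namespace StackProg

open TreeEnc

/-! ### Case distinctions, lists and numbers -/

namespace PolyTime

variable {α β γ σ : Type} [TreeEnc α] [TreeEnc β] [TreeEnc γ] [TreeEnc σ]

@[fun_prop]
theorem ite {c : α → Bool} {f g : α → β} (hc : PolyTime c) (hf : PolyTime f) (hg : PolyTime g) :
    PolyTime fun a => if c a = true then f a else g a := by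
  have h := (cases hg hf).comp
    (g := fun a => (enc (c a), a)) ((comp (f := enc) (recode fun _ => rfl) hc).prodMk id)
  convert h using 2 with a
  cases c a <;> simp

@[fun_prop]
theorem and {f g : α → Bool} (hf : PolyTime f) (hg : PolyTime g) :
    PolyTime fun a => f a && g a := by
  have : (fun a => f a && g a) = fun a => if f a = true then g a else false := by
    funext a; cases f a <;> simp
  rw [this]
  fun_prop

@[fun_prop]
theorem or {f g : α → Bool} (hf : PolyTime f) (hg : PolyTime g) :
    PolyTime fun a => f a || g a := by
  have : (fun a => f a || g a) = fun a => if f a = true then true else g a := by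
    funext a; cases f a <;> simp
  rw [this]
  fun_prop

@[fun_prop]
theorem not {f : α → Bool} (hf : PolyTime f) : PolyTime fun a => !f a := by
  have : (fun a => !f a) = fun a => if f a = true then false else true := by
    funext a; cases f a <;> simp
  rw [this]
  fun_prop

@[fun_prop]
theorem xor {f g : α → Bool} (hf : PolyTime f) (hg : PolyTime g) :
    PolyTime fun a => Bool.xor (f a) (g a) := by
  have : (fun a => Bool.xor (f a) (g a)) = fun a => if f a = true then !g a else g a := by
    funext a; cases f a <;> simp
  rw [this]
  fun_prop

@[fun_prop]
theorem cons {f : α → β} {g : α → List β} (hf : PolyTime f) (hg : PolyTime g) :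
    PolyTime fun a => f a :: g a :=
  comp (f := fun x : β × List β => x.1 :: x.2) (recode fun _ => rfl) (hf.prodMk hg)

@[fun_prop]
theorem tail {f : α → List β} (hf : PolyTime f) : PolyTime fun a => (f a).tail :=
  comp (f := List.tail) (treeSnd.of_tree fun l => by cases l <;> rfl) hf

@[fun_prop]
theorem isEmpty {f : α → List β} (hf : PolyTime f) : PolyTime fun a => (f a).isEmpty := by
  have h := (cases (const (α := α) true) (const false)).comp
    (g := fun a => (enc (f a), a)) ((comp (f := enc) (recode fun _ => rfl) hf).prodMk id)
  convert h using 2 with a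
  cases f a <;> simp

@[fun_prop]
theorem headD {f : α → List β} {d : α → β} (hf : PolyTime f) (hd : PolyTime d) :
    PolyTime fun a => (f a).headD (d a) := by
  have h : PolyTime fun x : Tree × Tree => if x.1 = .nil then x.2 else x.1.fst := by
    have := (cases (f := fun x : Tree × Tree => x.2) (g := fun x => x.1.fst)
      (by fun_prop) (treeFst.comp (by fun_prop))).comp
      (g := fun x : Tree × Tree => (x.1, x)) (by fun_prop)
    exact this
  have h' : PolyTime fun x : List β × β => x.1.headD x.2 :=
    (h.comp (g := fun x : Tree => (x.fst, x.snd)) (treeFst.prodMk treeSnd)).of_tree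
      fun x => by obtain ⟨l, y⟩ := x; cases l <;> simp
  exact h'.comp (hf.prodMk hd)

/-- Iteration over a list: the intermediate results have to be of polynomial size. -/
theorem foldl {l : α → List β} {g : α → σ} {h : α → σ → β → σ} (hl : PolyTime l) (hg : PolyTime g)
    (hh : PolyTime fun x : α × σ × β => h x.1 x.2.1 x.2.2) (q : Polynomial ℕ)
    (hq : ∀ a l', l' <+: l a → sz (l'.foldl (h a) (g a)) ≤ q.eval (sz a)) :
    PolyTime fun a => (l a).foldl (h a) (g a) := by
  rcases isEmpty_or_nonempty β with hβ | ⟨⟨y⟩⟩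
  · have : (fun a => (l a).foldl (h a) (g a)) = g := by
      funext a
      have : l a = [] := List.eq_nil_iff_forall_not_mem.2 fun y => hβ.elim y
      rw [this, List.foldl_nil]
    rwa [this]
  let step : List β × σ × α → List β × σ × α := fun x =>
    (x.1.tail, h x.2.2 x.2.1 (x.1.headD y), x.2.2)
  have hstep : PolyTime step := by
    have : PolyTime fun x : List β × σ × α => h x.2.2 x.2.1 (x.1.headD y) :=
      hh.comp (g := fun x : List β × σ × α => (x.2.2, x.2.1, x.1.headD y)) (by fun_prop)
    fun_prop
  have hiter : ∀ (l₁ l₂ : List β) (s : σ) (a : α),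
      step^[l₁.length] (l₁ ++ l₂, s, a) = (l₂, l₁.foldl (h a) s, a) := by
    intro l₁
    induction l₁ with
    | nil => intros; rfl
    | cons b l₁ ih => intro l₂ s a; simpa [step] using ih l₂ (h a s b) a
  obtain ⟨p, hp⟩ := hl.sz_le
  have hF : PolyTime fun a => (([] : List β), (l a).foldl (h a) (g a), a) := by
    refine hstep.iterWhile (init := fun a => (l a, g a, a)) (by fun_prop)
      (p + q + Polynomial.X + 2) fun a => ⟨(l a).length, ?_, ?_, rfl, ?_⟩
    · have := length_lt_sz (l a)
      have := hp a
      simp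
      omega
    · simpa using hiter (l a) [] (g a) a
    · intro i hi
      have h₁ : step^[i] (l a, g a, a) =
          ((l a).drop i, ((l a).take i).foldl (h a) (g a), a) := by
        have := hiter ((l a).take i) ((l a).drop i) (g a) a
        rwa [List.take_append_drop, List.length_take, min_eq_left hi.le] at this
      have h₂ : sz ((l a).drop i) ≤ sz (l a) := by
        generalize l a = m
        clear h₁ hi
        induction m generalizing i with
        | nil => simp
        | cons b m ih =>
          cases i with
          | zero => simp
          | succ i => have := ih i; simp; omega
      have h₃ := hq a _ (List.take_prefix i (l a))
      rw [h₁]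
      constructor
      · obtain ⟨b, m, hb⟩ : ∃ b m, (l a).drop i = b :: m :=
          ⟨_, _, List.drop_eq_getElem_cons hi⟩
        simp [hb]
      · have := hp a
        simp
        omega
  exact (hF.snd).fst

/-- Iteration over a list, where each step adds a polynomially bounded amount. -/
theorem foldl_of_add {l : α → List β} {g : α → σ} {h : α → σ → β → σ} (hl : PolyTime l)
    (hg : PolyTime g) (hh : PolyTime fun x : α × σ × β => h x.1 x.2.1 x.2.2) (q : Polynomial ℕ)
    (hq : ∀ a s b, b ∈ l a → sz (h a s b) ≤ sz s + q.eval (sz a)) :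
    PolyTime fun a => (l a).foldl (h a) (g a) := by
  obtain ⟨p, hp⟩ := hl.sz_le
  obtain ⟨r, hr⟩ := hg.sz_le
  refine foldl hl hg hh (r + p * q) fun a l' hl' => ?_
  have key : ∀ (m : List β), (∀ b ∈ m, b ∈ l a) → ∀ s,
      sz (m.foldl (h a) s) ≤ sz s + m.length * q.eval (sz a) := by
    intro m
    induction m with
    | nil => simp
    | cons b m ih =>
      intro hm s
      have h₁ := ih (fun b hb => hm b (by simp [hb])) (h a s b)
      have h₂ := hq a s b (hm b (by simp))
      rw [List.foldl_cons, List.length_cons, Nat.succ_mul]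
      omega
  have h₁ := key l' (fun b hb => hl'.subset hb) (g a)
  have h₂ : l'.length ≤ p.eval (sz a) :=
    (hl'.length_le.trans (length_lt_sz _).le).trans (hp a)
  have h₃ := Nat.mul_le_mul_right (q.eval (sz a)) h₂
  have := hr a
  simp only [Polynomial.eval_add, Polynomial.eval_mul]
  omega

@[fun_prop]
theorem reverse {l : α → List β} (hl : PolyTime l) : PolyTime fun a => (l a).reverse := by
  obtain ⟨p, hp⟩ := hl.sz_le
  have := foldl_of_add (h := fun _ s b => b :: s) hl (const []) (by fun_prop) (p + 1)
    fun a s b hb => by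
      have := sz_le_of_mem hb
      have := hp a
      simp
      omega
  convert this using 2 with a
  simp

/-- Elements of a list, and values at them, are of polynomial size. -/
theorem sz_apply_le {l : α → List β} {f : α → β → γ} (hl : PolyTime l)
    (hf : PolyTime fun x : α × β => f x.1 x.2) :
    ∃ q : Polynomial ℕ, ∀ a, ∀ b ∈ l a, sz (f a b) ≤ q.eval (sz a) := by
  obtain ⟨p, hp⟩ := hl.sz_le
  obtain ⟨r, hr⟩ := hf.sz_le
  refine ⟨r.comp (Polynomial.X + p + 1), fun a b hb => (hr (a, b)).trans ?_⟩
  rw [Polynomial.eval_comp]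
  refine eval_mono r ?_
  have := sz_le_of_mem hb
  have := hp a
  simp
  omega

@[fun_prop]
theorem map {l : α → List β} {f : α → β → γ} (hl : PolyTime l)
    (hf : PolyTime fun x : α × β => f x.1 x.2) : PolyTime fun a => (l a).map (f a) := by
  obtain ⟨q, hq⟩ := sz_apply_le hl hf
  have hf' : PolyTime fun x : α × List γ × β => f x.1 x.2.2 :=
    hf.comp (g := fun x : α × List γ × β => (x.1, x.2.2)) (by fun_prop)
  have := (foldl_of_add (h := fun a (s : List γ) b => f a b :: s) hl (const []) (by fun_prop)
    (q + 1) fun a s b hb => by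
      have := hq a b hb
      simp
      omega).reverse
  convert this using 2 with a
  generalize l a = m
  have : ∀ (m : List β) (s : List γ),
      m.foldl (fun s b => f a b :: s) s = (m.map (f a)).reverse ++ s := by
    intro m
    induction m with
    | nil => simp
    | cons b m ih => simp [ih]
  simp [this]

@[fun_prop]
theorem all {l : α → List β} {f : α → β → Bool} (hl : PolyTime l)
    (hf : PolyTime fun x : α × β => f x.1 x.2) : PolyTime fun a => (l a).all (f a) := by
  have hf' : PolyTime fun x : α × Bool × β => f x.1 x.2.2 :=
    hf.comp (g := fun x : α × Bool × β => (x.1, x.2.2)) (by fun_prop)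
  have := foldl_of_add (h := fun a (s : Bool) b => s && f a b) hl (const true) (by fun_prop)
    3 fun a s b _ => by
      have := sz_bool (s && f a b)
      simp
      omega
  convert this using 2 with a
  have : ∀ (m : List β) (s : Bool), m.foldl (fun s b => s && f a b) s = (s && m.all (f a)) := by
    intro m
    induction m with
    | nil => simp
    | cons b m ih => simp [ih, Bool.and_assoc]
  simp [this]

@[fun_prop]
theorem any {l : α → List β} {f : α → β → Bool} (hl : PolyTime l)
    (hf : PolyTime fun x : α × β => f x.1 x.2) : PolyTime fun a => (l a).any (f a) := by
  have : (fun a => (l a).any (f a)) = fun a => !(l a).all fun b => !f a b := by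
    funext a
    rw [List.not_all_eq_any_not]
    simp
  rw [this]
  fun_prop

@[fun_prop]
theorem append {f g : α → List β} (hf : PolyTime f) (hg : PolyTime g) :
    PolyTime fun a => f a ++ g a := by
  obtain ⟨p, hp⟩ := hf.sz_le
  have := foldl_of_add (h := fun _ (s : List β) b => b :: s) (hf.reverse) hg (by fun_prop) (p + 1)
    fun a s b hb => by
      have := sz_le_of_mem (List.mem_reverse.1 hb)
      have := hp a
      simp
      omega
  convert this using 2 with a
  simp

theorem sz_append (l m : List β) : sz (l ++ m) + 1 = sz l + sz m := by
  induction l with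
  | nil => simp; omega
  | cons a l ih => simp; omega

@[fun_prop]
theorem flatMap {l : α → List β} {f : α → β → List γ} (hl : PolyTime l)
    (hf : PolyTime fun x : α × β => f x.1 x.2) : PolyTime fun a => (l a).flatMap (f a) := by
  obtain ⟨q, hq⟩ := sz_apply_le hl hf
  have hf' : PolyTime fun x : α × List γ × β => f x.1 x.2.2 :=
    hf.comp (g := fun x : α × List γ × β => (x.1, x.2.2)) (by fun_prop)
  have := foldl_of_add (h := fun a (s : List γ) b => s ++ f a b) hl (const []) (by fun_prop)
    (q + 1) fun a s b hb => by
      have := hq a b hb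
      have := sz_append s (f a b)
      simp
      omega
  convert this using 2 with a
  have : ∀ (m : List β) (s : List γ),
      m.foldl (fun s b => s ++ f a b) s = s ++ m.flatMap (f a) := by
    intro m
    induction m with
    | nil => simp
    | cons b m ih => simp [ih]
  simp [this]

/-- The representation of a number is also the representation of a list of trees. -/
theorem encNat_eq (n : ℕ) : enc n = enc (List.replicate n Tree.nil) := by
  induction n with
  | zero => rfl
  | succ n ih => simp [List.replicate_succ, ih]

theorem units {f : α → ℕ} (hf : PolyTime f) :
    PolyTime fun a => List.replicate (f a) Tree.nil :=
  comp (f := fun n => List.replicate n Tree.nil) (recode fun n => (encNat_eq n).symm) hf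

@[fun_prop]
theorem length {f : α → List β} (hf : PolyTime f) : PolyTime fun a => (f a).length := by
  have h : PolyTime fun l : List β => l.map fun _ => Tree.nil := by fun_prop
  have h' : PolyTime (List.length : List β → ℕ) := by
    intro G
    obtain ⟨c, p, hc⟩ := h G
    refine ⟨c, p, fun a r b d => ?_⟩
    simpa [encNat_eq] using hc a r b d
  exact h'.comp hf

@[fun_prop]
theorem replicate {f : α → ℕ} {g : α → β} (hf : PolyTime f) (hg : PolyTime g) :
    PolyTime fun a => List.replicate (f a) (g a) := by
  have h : PolyTime fun a => (List.replicate (f a) Tree.nil).map fun _ => g a :=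
    map hf.units (by fun_prop)
  simpa using h

@[fun_prop]
theorem succ {f : α → ℕ} (hf : PolyTime f) : PolyTime fun a => f a + 1 := by
  have : (fun a => f a + 1) = fun a => (Tree.nil :: List.replicate (f a) Tree.nil).length := by
    funext a; simp
  rw [this]
  have := hf.units
  fun_prop

@[fun_prop]
theorem range {f : α → ℕ} (hf : PolyTime f) : PolyTime fun a => List.range (f a) := by
  have h := hf.units
  obtain ⟨p, hp⟩ := hf.sz_le
  have key : ∀ (n : ℕ), (List.replicate n Tree.nil).foldl
      (fun (s : List ℕ) _ => s ++ [s.length]) [] = List.range n := by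
    intro n
    induction n with
    | zero => simp
    | succ n ih => rw [List.replicate_succ', List.foldl_append, ih]; simp [List.range_succ]
  have hsz : ∀ n, sz (List.range n) ≤ (2 * n + 2) * n + 1 := by
    intro n
    induction n with
    | zero => simp
    | succ n ih =>
      have := sz_append (List.range n) [n]
      rw [List.range_succ]
      simp at this ⊢
      nlinarith
  have := foldl (h := fun _ (s : List ℕ) _ => s ++ [s.length]) h (const []) (by fun_prop)
    ((2 * p + 2) * p + 1) fun a l' hl' => by
      have hl : l' = List.replicate l'.length Tree.nil :=
        List.eq_replicate_of_mem fun b hb => List.eq_of_mem_replicate (hl'.subset hb)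
      have h₁ := hl'.length_le
      rw [List.length_replicate] at h₁
      have h₂ := hp a
      rw [sz_nat] at h₂
      rw [hl, key]
      refine (hsz _).trans ?_
      simp only [Polynomial.eval_add, Polynomial.eval_mul, Polynomial.eval_ofNat,
        Polynomial.eval_one]
      have h₃ : l'.length ≤ p.eval (sz a) := by omega
      gcongr
  simpa only [key] using this

@[fun_prop]
theorem drop {f : α → ℕ} {g : α → List β} (hf : PolyTime f) (hg : PolyTime g) :
    PolyTime fun a => (g a).drop (f a) := by
  have := foldl_of_add (h := fun _ (s : List β) _ => s.tail) hf.units hg (by fun_prop) 0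
    fun a s b hb => by cases s <;> simp; omega
  convert this using 2 with a
  generalize g a = l
  induction f a generalizing l with
  | zero => simp
  | succ n ih => simp [List.replicate_succ, ← ih]

@[fun_prop]
theorem getD {f : α → ℕ} {g : α → List β} {d : α → β} (hf : PolyTime f) (hg : PolyTime g)
    (hd : PolyTime d) : PolyTime fun a => (g a).getD (f a) (d a) := by
  have : (fun a => (g a).getD (f a) (d a)) = fun a => ((g a).drop (f a)).headD (d a) := by
    funext a
    simp [List.headD_eq_head?_getD]
  rw [this]
  fun_prop

@[fun_prop]
theorem decide_lt {f g : α → ℕ} (hf : PolyTime f) (hg : PolyTime g) :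
    PolyTime fun a => decide (f a < g a) := by
  have : (fun a => decide (f a < g a)) =
      fun a => !((List.replicate (g a) Tree.nil).drop (f a)).isEmpty := by
    funext a
    by_cases h : f a < g a <;> simp [h] <;> omega
  rw [this]
  fun_prop

@[fun_prop]
theorem decide_eq_nat {f g : α → ℕ} (hf : PolyTime f) (hg : PolyTime g) :
    PolyTime fun a => decide (f a = g a) := by
  have : (fun a => decide (f a = g a)) = fun a => !decide (f a < g a) && !decide (g a < f a) := by
    funext a
    by_cases h : f a = g a
    · simp [h]
    · rcases lt_or_gt_of_ne h with h' | h' <;> simp [h, h']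
  rw [this]
  fun_prop

/-- Functions on finite types are given by tables. -/
theorem of_finite [Finite α] (hα : Function.Injective (enc : α → Tree)) (f : α → β) :
    PolyTime f := by
  have heq : ∀ y : Tree, PolyTime fun x : Tree => decide (x = y) := by
    intro y
    have h₀ : PolyTime fun x : Tree => decide (x = .nil) := by
      have := (cases (const (α := Tree) true) (const false)).comp
        (g := fun x : Tree => (x, x)) (by fun_prop)
      convert this using 2 with x
      by_cases h : x = .nil <;> simp [h]
    induction y with
    | nil => exact h₀
    | node l r hl hr =>
      have h₁ : PolyTime fun x : Tree => decide (x.fst = l) := hl.comp treeFst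
      have h₂ : PolyTime fun x : Tree => decide (x.snd = r) := hr.comp treeSnd
      have : (fun x : Tree => decide (x = .node l r)) =
          fun x => !decide (x = .nil) && (decide (x.fst = l) && decide (x.snd = r)) := by
        funext x
        cases x with
        | nil => simp
        | node u v =>
          change decide (Tree.node u v = .node l r) =
            (!decide (Tree.node u v = .nil) && (decide (u = l) && decide (v = r)))
          by_cases hu : u = l <;> by_cases hv : v = r <;> simp [hu, hv]
      rw [this]
      fun_prop
  have hl : ∀ l : List α, ∃ g : α → β, PolyTime g ∧ ∀ a ∈ l, g a = f a := by
    intro l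
    induction l with
    | nil =>
      rcases isEmpty_or_nonempty α with h | ⟨⟨a₀⟩⟩
      · exact ⟨f, fun _ => ⟨.skip, 1, fun a => h.elim a⟩, by simp⟩
      · exact ⟨fun _ => f a₀, const _, by simp⟩
    | cons a l ih =>
      obtain ⟨g, hg, h⟩ := ih
      have h₁ : PolyTime fun x : α => decide (enc x = enc a) :=
        (heq (enc a)).comp (recode fun _ => rfl)
      refine ⟨fun x => if decide (enc x = enc a) then f a else g x, by fun_prop, ?_⟩
      intro x hx
      by_cases hxa : x = a
      · simp [hxa]
      · have : enc x ≠ enc a := fun h => hxa (hα h)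
        simp [this, h x ((List.mem_cons.1 hx).resolve_left hxa)]
  obtain ⟨l, -, hl'⟩ := Finite.exists_univ_list α
  obtain ⟨g, hg, h⟩ := hl l
  have : g = f := funext fun a => h a (hl' a)
  rwa [← this]

end PolyTime

end StackProg

namespace StackProg

open TreeEnc

/-! ### From functions on lists to Turing machines -/

section machine

open Prog

variable {G : Type}

/-- Pushes a word onto the stack `sav`, the first letter first. -/
def pushWord (G : Type) : List Bool → Prog (Alph G)
  | [] => skip
  | x :: l => seq (push .sav (some x)) (pushWord G l)

theorem runs_pushWord (l a : List Bool) (b d : List (Option Bool)) :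
    Runs (pushWord G l) a b d a ((l.map some).reverse ++ b) d (l.length + 1) := by
  induction l generalizing b with
  | nil => exact Runs.skip
  | cons x l ih =>
    exact Runs.congr ((Runs.push_sav (some x)).seq (ih (some x :: b))) rfl rfl (by simp)
      (by simp; omega)

/-- Moves the truth value on the main stack to the output stack. -/
def writeOutput (G : Type) : Prog (Alph G) :=
  case .main fun x : Option Bool =>
    match x with
    | some true => case .main fun _ : Option Bool => case .main fun _ : Option Bool =>
        push .out true
    | _ => push .out false

theorem exec_writeOutput (v : Bool) :
    ∃ t ≤ 4, Exec (writeOutput G) (conf [] [] (enc v).word [] []) (conf [] [v] [] [] []) t := by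
  cases v with
  | false =>
    refine ⟨2, by omega, Exec.case (k := Stk.main) ((Exec.push (Γ := Alph G) .out false
      (conf [] [] [] [] [])).congr ?_ (update_out _ _ _ _ _ _))⟩
    exact (update_main _ _ _ _ _ _).symm
  | true =>
    have h₀ := (Exec.push (Γ := Alph G) .out true (conf [] [] [] [] [])).congr rfl
      (update_out _ _ _ _ _ [true])
    have h₁ : Exec (Γ := Alph G) (case .main fun _ : Option Bool => push .out true)
        (conf [] [] [false] [] []) (conf [] [true] [] [] []) 2 :=
      Exec.case (k := Stk.main) (h₀.congr (update_main [] [] [false] [] [] []).symm rfl)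
    have h₂ : Exec (Γ := Alph G)
        (case .main fun _ : Option Bool => case .main fun _ : Option Bool => push .out true)
        (conf [] [] [false, false] [] []) (conf [] [true] [] [] []) 3 :=
      Exec.case (k := Stk.main)
        (h₁.congr (update_main [] [] [false, false] [] [] [false]).symm rfl)
    exact ⟨4, le_rfl, Exec.case (k := Stk.main)
      (h₂.congr (update_main [] [] [true, false, false] [] [] [false, false]).symm rfl)⟩

variable [TreeEnc G]

theorem word_list (l : List G) :
    (enc l).word = (l.flatMap fun a => true :: (enc a).word) ++ [false] := by
  induction l with
  | nil => rfl
  | cons a l ih => simp [Tree.word, ih]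

/-- Moves the input, as the code of a list, to the stack `sav`. -/
def readInput (G : Type) [TreeEnc G] : Prog (Alph G) :=
  loop .inp (fun x : Option G => x.isNone) fun x : Option G =>
    match x with
    | some a => pushWord G (true :: (enc a).word)
    | none => skip

theorem exec_readInput {M : ℕ} (hM : ∀ a : G, sz a ≤ M) (i : List G) (b : List (Option Bool)) :
    ∃ t ≤ (M + 3) * i.length + 1, Exec (readInput G) (conf i [] [] b [])
      (conf [] [] [] (((i.flatMap fun a => true :: (enc a).word).map some).reverse ++ b) []) t := by
  induction i generalizing b with
  | nil => exact ⟨1, by simp, (Exec.final (k := Stk.inp) rfl).congr rfl (update_inp _ _ _ _ _ _)⟩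
  | cons a i ih =>
    obtain ⟨t₁, ht₁, hx₁⟩ := runs_pushWord (G := G) (true :: (enc a).word) [] b [] i []
    obtain ⟨t₂, ht₂, hx₂⟩ := ih (((true :: (enc a).word).map some).reverse ++ b)
    refine ⟨t₁ + t₂ + 1, ?_, Exec.loop (k := Stk.inp) rfl
      (hx₁.congr (update_inp (a :: i) [] [] b [] i).symm rfl) (hx₂.congr rfl (by simp))⟩
    have := hM a
    simp only [sz, Tree.size] at this
    simp only [List.length_cons] at ht₁ ⊢
    rw [Nat.mul_succ]
    omega

/-- A decision procedure on words that is computable in polynomial time in the sense of `PolyTime`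
is computable by a Turing machine in polynomial time. -/
theorem PolyTime.computableInPolyTime [Fintype G] {F : List G → Bool} (hF : PolyTime F)
    {α : Type} (ea : α → List G) :
    Nonempty (Turing.TM2ComputableInPolyTime ea Computability.encodeBool fun x => F (ea x)) := by
  obtain ⟨c, p, hc⟩ := hF G
  obtain ⟨M, hM⟩ : ∃ M, ∀ a : G, sz a ≤ M := Finite.exists_le _
  have hsz : ∀ l : List G, sz l ≤ (M + 1) * l.length + 1 := by
    intro l
    induction l with
    | nil => simp
    | cons a l ih =>
      have := hM a
      rw [sz_cons, List.length_cons, Nat.mul_succ]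
      omega
  let B : Polynomial ℕ := ((M + 1 : ℕ) : Polynomial ℕ) * Polynomial.X + 1
  have hB : ∀ n, B.eval n = (M + 1) * n + 1 := fun n => by simp [B]
  -- The code of the input list is built on the stack `sav`, above a marker and in reverse, and then
  -- moved to the main stack.
  refine computableInPolyTime_of_exec (Γ := Alph G) .inp .out
    (seq (push .sav none) (seq (readInput G) (seq (push .sav (some false))
      (seq (restore G) (seq c (writeOutput G))))))
    ea Computability.encodeBool (fun x => F (ea x)) (Equiv.refl G) (Equiv.refl Bool)
    (((M + 3 : ℕ) : Polynomial ℕ) * Polynomial.X + 2 * B + p.comp B + 8) fun x => ?_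
  obtain ⟨t₁, ht₁, hx₁⟩ := exec_readInput hM (ea x) [none]
  obtain ⟨W, hW⟩ : ∃ W, ((ea x).flatMap fun a => true :: (enc a).word) = W := ⟨_, rfl⟩
  have hw := word_list (ea x)
  rw [hW] at hw hx₁
  obtain ⟨t₂, ht₂, hx₂⟩ := runs_restore (G := G) (false :: W.reverse) [] [] [] [] []
  obtain ⟨t₃, ht₃, hx₃⟩ := hc (ea x) [] [] [] [] []
  obtain ⟨t₄, ht₄, hx₄⟩ := exec_writeOutput (G := G) (F (ea x))
  have e : (fun _ => [] : ∀ k, List (Alph G k)) = conf [] [] [] [] [] := by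
    funext k; cases k <;> rfl
  have e₁ : conf (ea x) [] [] [] [] = Function.update (β := fun k => List (Alph G k))
      (fun _ => []) Stk.inp ((ea x).map (Equiv.refl G).symm) := by
    rw [e]
    exact (update_inp [] [] [] [] [] (ea x)).symm.trans
      (congrArg (Function.update (conf (G := G) [] [] [] [] []) Stk.inp) (List.map_id _).symm)
  have e₂ : conf [] [F (ea x)] [] [] [] = Function.update (β := fun k => List (Alph G k))
      (fun _ => []) Stk.out ((Computability.encodeBool (F (ea x))).map (Equiv.refl Bool).symm) := by
    rw [e]
    exact (update_out [] [] [] [] [] _).symm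
  refine ⟨1 + (t₁ + (1 + (t₂ + (t₃ + t₄)))), ?_, ?_⟩
  · have h₁ := hsz (ea x)
    have h₂ := eval_mono p h₁
    have h₃ : sz (ea x) = W.length + 1 := by
      rw [sz, Tree.size, hw, List.length_append, List.length_singleton]
    simp only [List.length_cons, List.length_reverse] at ht₂
    simp only [Polynomial.eval_add, Polynomial.eval_mul, Polynomial.eval_comp, hB,
      Polynomial.eval_natCast, Polynomial.eval_X, Polynomial.eval_ofNat, Nat.cast_id]
    omega
  · refine Exec.congr ?_ e₁ e₂
    exact Exec.seq ((Exec.push (Γ := Alph G) .sav none _).congr rfl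
        (update_sav _ _ _ _ _ [none])) <|
      Exec.seq hx₁ <| Exec.seq ((Exec.push (Γ := Alph G) .sav (some false) _).congr rfl
        (update_sav _ _ _ _ _ (some false :: ((W.map some).reverse ++ [none])))) <|
      Exec.seq (hx₂.congr (by simp) (show _ = conf [] [] (enc (ea x)).word [] [] by
        rw [hw]; simp)) <|
      Exec.seq (hx₃.congr (by simp) rfl) (hx₄.congr (by simp) rfl)

end machine

end StackProg

namespace StackProg

open TreeEnc

/-! ### Decoding of trees and bit strings -/

/-- Types with a polynomial-time decoding function, total on all trees. -/
class TreeDec (α : Type) [TreeEnc α] where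
  /-- the element that a tree is read as -/
  dec : Tree → α
  dec_enc (a : α) : dec (enc a) = a
  polyTime_dec : PolyTime dec

namespace Tree

/-- The left subtrees along the right spine. -/
def spine : Tree → List Tree
  | nil => []
  | node l r => l :: spine r

theorem enc_spine (x : Tree) : enc x.spine = x := by
  induction x with
  | nil => rfl
  | node l r _ ih => simp [spine, ih]

@[fun_prop]
theorem polyTime_spine : PolyTime spine := PolyTime.recode enc_spine

end Tree

open StackProg.Tree StackProg.TreeDec

@[fun_prop]
theorem PolyTime.treeNode {α : Type} [TreeEnc α] {f g : α → Tree} (hf : PolyTime f)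
    (hg : PolyTime g) : PolyTime fun a => Tree.node (f a) (g a) :=
  comp (f := fun x : Tree × Tree => Tree.node x.1 x.2) (recode fun _ => rfl) (hf.prodMk hg)

attribute [fun_prop] PolyTime.treeFst PolyTime.treeSnd TreeDec.polyTime_dec

instance : TreeDec Bool where
  dec x := !x.spine.isEmpty
  dec_enc b := by cases b <;> rfl
  polyTime_dec := by fun_prop

instance : TreeDec ℕ where
  dec x := x.spine.length
  dec_enc n := by
    induction n with
    | zero => rfl
    | succ n ih => simpa [spine] using ih
  polyTime_dec := by fun_prop

instance {α β : Type} [TreeEnc α] [TreeEnc β] [TreeDec α] [TreeDec β] : TreeDec (α × β) where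
  dec x := (dec x.fst, dec x.snd)
  dec_enc x := by simp [dec_enc]
  polyTime_dec := by fun_prop

instance {α : Type} [TreeEnc α] [TreeDec α] : TreeDec (List α) where
  dec x := x.spine.map dec
  dec_enc l := by
    induction l with
    | nil => rfl
    | cons a l ih => simpa [spine, dec_enc] using ih
  polyTime_dec := by fun_prop

/-- Decoding of a type that is represented like another one. -/
abbrev TreeDec.ofEquiv {α β : Type} [TreeEnc α] [TreeEnc β] [TreeDec β] (e : β ≃ α)
    (h : ∀ b, enc (e b) = enc b) : TreeDec α where
  dec x := e (dec x)
  dec_enc a := by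
    obtain ⟨b, rfl⟩ := e.surjective a
    rw [h, dec_enc]
  polyTime_dec := (PolyTime.recode h).comp polyTime_dec

theorem enc_injective {α : Type} [TreeEnc α] [TreeDec α] : Function.Injective (enc : α → Tree) :=
  fun a b h => by rw [← dec_enc a, h, dec_enc]

theorem PolyTime.of_equiv {α β γ : Type} [TreeEnc α] [TreeEnc β] [TreeEnc γ] (e : β ≃ α)
    (h : ∀ a, enc (e.symm a) = enc a) {f : β → γ} (hf : PolyTime f) :
    PolyTime fun a => f (e.symm a) :=
  hf.comp (recode h)

/-- One step of the reading of a prefix code from right to left: the list holds the trees read so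
far. -/
def parseStep (s : List Tree) (b : Bool) : List Tree :=
  if b = true then .node (s.headD .nil) (s.tail.headD .nil) :: s.tail.tail else .nil :: s

/-- The tree with a given code (and some tree, if the word is not a code). -/
def parseTree (l : List Bool) : Tree := (l.reverse.foldl parseStep []).headD .nil

theorem foldl_parseStep (x : Tree) (s : List Tree) :
    x.word.reverse.foldl parseStep s = x :: s := by
  induction x generalizing s with
  | nil => simp [word, parseStep]
  | node l r hl hr => simp [word, List.foldl_append, hl, hr, parseStep]

theorem parseTree_word (x : Tree) : parseTree x.word = x := by
  rw [parseTree, foldl_parseStep]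
  rfl

@[fun_prop]
theorem polyTime_parseTree : PolyTime parseTree := by
  have h := PolyTime.foldl_of_add (l := fun l : List Bool => l.reverse) (g := fun _ => [])
    (h := fun _ => parseStep) (by fun_prop) (by fun_prop)
    (by unfold parseStep; fun_prop) 5 fun a s b _ => by
      unfold parseStep
      rcases s with _ | ⟨x, _ | ⟨y, s⟩⟩ <;> cases b <;> simp [sz] <;> omega
  unfold parseTree
  fun_prop

namespace PolyTime

variable {α β γ σ : Type} [TreeEnc α] [TreeEnc β] [TreeEnc γ] [TreeEnc σ]

/-! ### Equality of lists -/

theorem decide_eq_list [DecidableEq β] (h : PolyTime fun x : β × β => decide (x.1 = x.2))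
    {f g : α → List β} (hf : PolyTime f) (hg : PolyTime g) :
    PolyTime fun a => decide (f a = g a) := by
  rcases isEmpty_or_nonempty β with hβ | ⟨⟨y⟩⟩
  · have : (fun a => decide (f a = g a)) = fun _ => true := by
      funext a
      simp [Subsingleton.elim (f a) (g a)]
    rw [this]
    fun_prop
  let step : List β × Bool → β → List β × Bool := fun s b =>
    (s.1.tail, s.2 && (!s.1.isEmpty && decide (s.1.headD y = b)))
  have hstep : PolyTime fun x : α × (List β × Bool) × β => step x.2.1 x.2.2 := by
    have : PolyTime fun x : α × (List β × Bool) × β => decide (x.2.1.1.headD y = x.2.2) :=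
      h.comp (g := fun x : α × (List β × Bool) × β => (x.2.1.1.headD y, x.2.2)) (by fun_prop)
    simp only [step]
    fun_prop
  have key : ∀ (l m : List β) (b : Bool), (l.foldl step (m, b)).2 = true ∧
      (l.foldl step (m, b)).1 = [] ↔ b = true ∧ m = l := by
    intro l
    induction l with
    | nil => intro m b; simp
    | cons x l ih =>
      intro m b
      rw [List.foldl_cons, ih]
      cases m with
      | nil => simp
      | cons z m => simp; tauto
  have := foldl_of_add (h := fun _ => step) (g := fun a => (f a, true)) hg (by fun_prop) hstep 4
    fun a s b _ => by
      obtain ⟨m, c⟩ := s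
      have := sz_bool (step (m, c) b).2
      have := one_le_sz c
      have h : sz m.tail ≤ sz m := by cases m <;> simp; omega
      simp only [sz_prod, Polynomial.eval_ofNat]
      have : sz (step (m, c) b).1 ≤ sz m := h
      omega
  have h' : PolyTime fun a => ((g a).foldl step (f a, true)).2 &&
    ((g a).foldl step (f a, true)).1.isEmpty := by fun_prop
  convert h' using 2 with a
  have := key (g a) (f a) true
  rw [Bool.eq_iff_iff]
  simp only [decide_eq_true_eq, Bool.and_eq_true, List.isEmpty_iff]
  simpa using this.symm

end PolyTime

/-! ### Binary arithmetic -/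

/-- The value of a binary numeral, least significant bit first. -/
def bval (l : List Bool) : ℕ := l.foldr Nat.bit 0

@[simp] theorem bval_nil : bval [] = 0 := rfl
@[simp] theorem bval_cons (b : Bool) (l : List Bool) : bval (b :: l) = Nat.bit b (bval l) := rfl

theorem bval_append (l m : List Bool) : bval (l ++ m) = bval l + 2 ^ l.length * bval m := by
  induction l with
  | nil => simp
  | cons b l ih => cases b <;> simp [ih, Nat.bit_val, pow_succ] <;> ring

theorem bval_bits (n : ℕ) : bval n.bits = n := by
  induction n using Nat.binaryRec' with
  | zero => simp
  | bit b n h ih => rw [Nat.bits_append_bit _ _ h, bval_cons, ih]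

theorem bval_lt (l : List Bool) : bval l < 2 ^ l.length := by
  induction l with
  | nil => simp
  | cons b l ih => cases b <;> simp [Nat.bit_val, pow_succ] <;> omega

theorem sz_bits_le (l : List Bool) : sz l ≤ 4 * l.length + 1 := by
  induction l with
  | nil => simp
  | cons b l ih => have := sz_bool b; simp; omega

theorem length_bits_le {n k : ℕ} (h : n < 2 ^ k) : n.bits.length ≤ k := by
  rw [Nat.size_eq_bits_len]
  exact Nat.size_le.2 h

/-- Digits are dropped as long as only zeros have been seen, from the most significant end. -/
theorem foldr_norm (l : List Bool) :
    l.foldr (fun b s => if (b || !s.isEmpty) = true then b :: s else []) [] = (bval l).bits := by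
  induction l with
  | nil => simp
  | cons b l ih =>
    rw [List.foldr_cons, ih, bval_cons]
    by_cases h : bval l = 0
    · cases b <;> simp [h]
    · rw [Nat.bits_append_bit _ _ (fun h' => absurd h' h)]
      have : (bval l).bits ≠ [] := fun h' => h (by rw [← bval_bits (bval l), h']; rfl)
      simp [this]

/-- Removal of the leading zeros. -/
def normBits (l : List Bool) : List Bool := (bval l).bits

@[fun_prop]
theorem polyTime_normBits : PolyTime normBits := by
  have h := PolyTime.foldl_of_add (l := fun l : List Bool => l.reverse) (g := fun _ => [])
    (h := fun _ (s : List Bool) b => if (b || !s.isEmpty) = true then b :: s else [])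
    (by fun_prop) (by fun_prop) (by fun_prop) 4 fun a s b _ => by
      have := sz_bool b
      split_ifs
      · simp; omega
      · simp
  simp only [List.foldl_reverse] at h
  convert h using 2 with l
  exact (foldr_norm l).symm

/-- One step of the addition of numerals; the state consists of the carry, the remaining parts of
the summands, and the reversed result. -/
def addStep (s : Bool × List Bool × List Bool × List Bool) :
    Bool × List Bool × List Bool × List Bool :=
  let a := s.2.1.headD false
  let b := s.2.2.1.headD false
  ((a && b) || (s.1 && (a || b)), s.2.1.tail, s.2.2.1.tail, Bool.xor (Bool.xor a b) s.1 :: s.2.2.2)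

/-- The result plus the sum of what remains, at its place value, is preserved. -/
theorem addStep_invariant (c : Bool) (x y o : List Bool) :
    let s := addStep (c, x, y, o)
    bval s.2.2.2.reverse + 2 ^ s.2.2.2.length * (s.1.toNat + bval s.2.1 + bval s.2.2.1) =
      bval o.reverse + 2 ^ o.length * (c.toNat + bval x + bval y) := by
  have h : ∀ x : List Bool, bval x = (x.headD false).toNat + 2 * bval x.tail := by
    intro x
    rcases x with _ | ⟨b, x⟩
    · simp
    · cases b <;> simp [Nat.bit_val, Nat.add_comm]
  simp only [addStep, List.reverse_cons, bval_append, List.length_reverse, List.length_cons,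
    pow_succ, bval_cons, bval_nil]
  rw [h x, h y]
  generalize bval x.tail = u
  generalize bval y.tail = v
  generalize 2 ^ o.length = w
  cases x.headD false <;> cases y.headD false <;> cases c <;> simp [Nat.bit_val] <;> ring

theorem addStep_iterate_invariant (n : ℕ) (s : Bool × List Bool × List Bool × List Bool) :
    bval (addStep^[n] s).2.2.2.reverse + 2 ^ (addStep^[n] s).2.2.2.length *
      ((addStep^[n] s).1.toNat + bval (addStep^[n] s).2.1 + bval (addStep^[n] s).2.2.1) =
      bval s.2.2.2.reverse + 2 ^ s.2.2.2.length * (s.1.toNat + bval s.2.1 + bval s.2.2.1) := by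
  induction n generalizing s with
  | zero => rfl
  | succ n ih => rw [Function.iterate_succ_apply, ih, addStep_invariant]

theorem addStep_iterate_tail (n : ℕ) (s : Bool × List Bool × List Bool × List Bool) :
    (addStep^[n] s).2.1 = s.2.1.drop n ∧ (addStep^[n] s).2.2.1 = s.2.2.1.drop n := by
  induction n generalizing s with
  | zero => simp
  | succ n ih => simp [ih, addStep]

/-- Addition of numerals, with a result without leading zeros. -/
def addBits (x y : List Bool) : List Bool := (bval x + bval y).bits

/-- One more step than there are digits in both summands leaves neither digits nor a carry. -/
theorem addBits_eq (x y : List Bool) :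
    addBits x y = normBits (addStep^[x.length + y.length + 1] (false, x, y, [])).2.2.2.reverse := by
  unfold addBits normBits
  congr 1
  have h₁ := addStep_iterate_invariant (x.length + y.length + 1) (false, x, y, [])
  have h₂ := addStep_iterate_tail (x.length + y.length) (false, x, y, [])
  obtain ⟨c, x', y', o, h⟩ : ∃ c x' y' o,
      addStep^[x.length + y.length] (false, x, y, []) = (c, x', y', o) := ⟨_, _, _, _, rfl⟩
  rw [Function.iterate_succ_apply', h] at h₁ ⊢
  rw [h] at h₂
  simp only [List.drop_eq_nil_of_le (Nat.le_add_right x.length y.length),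
    List.drop_eq_nil_of_le (Nat.le_add_left y.length x.length)] at h₂
  rw [h₂.1, h₂.2] at h₁ ⊢
  simp [addStep] at h₁ ⊢
  exact h₁.symm

@[fun_prop]
theorem PolyTime.addBits {α : Type} [TreeEnc α] {f g : α → List Bool} (hf : PolyTime f)
    (hg : PolyTime g) : PolyTime fun a => addBits (f a) (g a) := by
  have key : ∀ (l : List Bool) (s : Bool × List Bool × List Bool × List Bool),
      l.foldl (fun s _ => addStep s) s = addStep^[l.length] s := by
    intro l
    induction l with
    | nil => intro s; rfl
    | cons b l ih => intro s; simp [ih]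
  have h := PolyTime.foldl_of_add (l := fun a => true :: (f a ++ g a))
    (g := fun a => (false, f a, g a, ([] : List Bool))) (h := fun _ s _ => addStep s)
    (by fun_prop) (by fun_prop) (by unfold addStep; fun_prop) 10 fun a s b _ => by
      obtain ⟨c, x, y, o⟩ := s
      have h : ∀ m : List Bool, sz m.tail ≤ sz m := by intro m; cases m <;> simp; omega
      have := h x
      have := h y
      have := sz_bool (addStep (c, x, y, o)).1
      have := sz_bool (Bool.xor (Bool.xor (x.headD false) (y.headD false)) c)
      have := one_le_sz c
      simp [addStep] at *
      omega
  simp only [key] at h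
  have h' : PolyTime fun a =>
      normBits (addStep^[(true :: (f a ++ g a)).length] (false, f a, g a, [])).2.2.2.reverse := by
    fun_prop
  convert h' using 2 with a
  rw [addBits_eq]
  simp

/-- Multiplication of numerals, with a result without leading zeros. -/
def mulBits (x y : List Bool) : List Bool := (bval x * bval y).bits

/-- Multiplication by doubling and adding. -/
theorem mulBits_eq (x y : List Bool) : mulBits x y =
    x.foldr (fun b s => addBits (false :: s) (if b = true then y else [])) [] := by
  induction x with
  | nil => simp [mulBits]
  | cons b x ih =>
    rw [List.foldr_cons, ← ih]
    unfold mulBits addBits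
    congr 1
    cases b <;> simp [Nat.bit_val, bval_bits] <;> ring

theorem sz_mulBits (x y : List Bool) : sz (mulBits x y) ≤ 4 * (x.length + y.length) + 1 := by
  refine (sz_bits_le _).trans ?_
  have : (mulBits x y).length ≤ x.length + y.length := by
    refine length_bits_le ?_
    rw [pow_add]
    exact Nat.mul_lt_mul'' (bval_lt x) (bval_lt y)
  omega

@[fun_prop]
theorem PolyTime.mulBits {α : Type} [TreeEnc α] {f g : α → List Bool} (hf : PolyTime f)
    (hg : PolyTime g) : PolyTime fun a => mulBits (f a) (g a) := by
  obtain ⟨p, hp⟩ := hf.sz_le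
  obtain ⟨q, hq⟩ := hg.sz_le
  have h := PolyTime.foldl (l := fun a => (f a).reverse) (g := fun _ => [])
    (h := fun a s b => StackProg.addBits (false :: s) (if b = true then g a else []))
    (by fun_prop) (by fun_prop) (by fun_prop) (4 * (p + q) + 1) fun a l hl => by
      have h₁ := mulBits_eq l.reverse (g a)
      rw [List.foldr_reverse] at h₁
      rw [← h₁]
      refine (sz_mulBits _ _).trans ?_
      have := hl.length_le
      have := length_lt_sz (f a)
      have := length_lt_sz (g a)
      have := hp a
      have := hq a
      simp at *
      omega
  simp only [List.foldl_reverse, ← mulBits_eq] at h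
  exact h

end StackProg

namespace ParamMDP

/-! ### Reachability probabilities and the graph of a Markov chain -/

open Relation ENNReal

/-- `T` is reachable from `s` in the graph `G`. -/
def CanReach {S : Type*} (G : S → S → Prop) (T : Set S) (s : S) : Prop :=
  ∃ t ∈ T, ReflTransGen G s t

/-- Whatever path is taken from `s`, as long as `T` has not been visited it can still be reached. -/
def AlwaysCanReach {S : Type*} (G : S → S → Prop) (T : Set S) (s : S) : Prop :=
  ∀ u, ReflTransGen (fun a b => a ∉ T ∧ G a b) s u → CanReach G T u

theorem CanReach.head {S : Type*} {G : S → S → Prop} {T : Set S} {s s' : S} (h : G s s')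
    (h' : CanReach G T s') : CanReach G T s :=
  let ⟨t, ht, hs⟩ := h'
  ⟨t, ht, hs.head h⟩

/-- The equivalents of the qualitative conditions in the graph of a Markov chain. -/
def QualCond.GraphSat {S : Type*} (G : S → S → Prop) (T : Set S) (s : S) : QualCond → Prop
  | positive => CanReach G T s
  | unsure => ¬ AlwaysCanReach G T s
  | safe => ¬ CanReach G T s
  | almostSure => AlwaysCanReach G T s

namespace MC

variable {S : Type*} [Fintype S] (D : MC S) (T : Set S)

open Classical in
/-- The contribution of the path `s :: l` to the probability of reaching `T` from `s`. -/
noncomputable def weight : S → List S → ℝ≥0∞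
  | s, [] => if s ∈ T then 1 else 0
  | s, t :: l => if s ∈ T then 0 else ENNReal.ofReal (D.P s t) * weight t l

/-- The probability of reaching `T` from `s`. -/
noncomputable def hit (s : S) : ℝ≥0∞ := ∑' l, D.weight T s l

theorem singleton_mem_pathsTo {s : S} : [s] ∈ D.pathsTo s T ↔ s ∈ T := by
  simp [pathsTo]

theorem cons_cons_mem_pathsTo {s t : S} {l : List S} :
    s :: t :: l ∈ D.pathsTo s T ↔ s ∉ T ∧ D.P s t ≠ 0 ∧ t :: l ∈ D.pathsTo t T := by
  simp [pathsTo, List.isChain_cons_cons]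
  tauto

theorem indicator_pathsTo (s : S) (l : List S) :
    (D.pathsTo s T).indicator (fun π => ENNReal.ofReal (D.mass π)) (s :: l) = D.weight T s l := by
  classical
  induction l generalizing s with
  | nil => simp [Set.indicator_apply, singleton_mem_pathsTo, weight, mass]
  | cons t l ih =>
    rw [weight, ← ih t, Set.indicator_apply, Set.indicator_apply, cons_cons_mem_pathsTo, mass,
      ENNReal.ofReal_mul (D.nonneg s t)]
    by_cases hs : s ∈ T <;> by_cases hp : D.P s t = 0 <;> simp [hs, hp]

theorem reachProb_eq_hit : D.reachProb T = D.hit T D.init := by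
  rw [reachProb, hit, tsum_subtype (D.pathsTo D.init T) fun π => ENNReal.ofReal (D.mass π),
    ← (List.cons_injective (a := D.init)).tsum_eq]
  · exact tsum_congr fun l => D.indicator_pathsTo T D.init l
  · intro π hπ
    have : π ∈ D.pathsTo D.init T := by
      by_contra h
      exact hπ (Set.indicator_of_notMem h _)
    obtain ⟨h, -⟩ := this
    cases π with
    | nil => simp at h
    | cons a l => exact ⟨l, by simpa using h.symm⟩

/-- Summation over all lists by the first element. -/
theorem tsum_list (f : List S → ℝ≥0∞) : ∑' l, f l = f [] + ∑ t, ∑' l, f (t :: l) := by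
  classical
  rw [ENNReal.tsum_eq_add_tsum_ite []]
  congr 1
  have hinj : Function.Injective fun x : S × List S => x.1 :: x.2 := by
    rintro ⟨a, l⟩ ⟨b, m⟩ h
    simpa using h
  rw [← hinj.tsum_eq, ENNReal.tsum_prod', tsum_fintype]
  · simp
  · intro l hl
    cases l with
    | nil => simp at hl
    | cons a l => exact ⟨(a, l), rfl⟩

theorem hit_of_mem {s : S} (hs : s ∈ T) : D.hit T s = 1 := by
  rw [hit, tsum_list]
  simp [weight, hs]

theorem hit_of_notMem {s : S} (hs : s ∉ T) :
    D.hit T s = ∑ t, ENNReal.ofReal (D.P s t) * D.hit T t := by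
  rw [hit, tsum_list]
  simp [weight, hs, ENNReal.tsum_mul_left, hit]

theorem hit_le_one (s : S) : D.hit T s ≤ 1 := by
  classical
  -- The partial sums over the paths of bounded length are at most `1`, by induction on the bound.
  have h : ∀ N s, ∑' l : List S, (if l.length < N then D.weight T s l else 0) ≤ 1 := by
    intro N
    induction N with
    | zero => simp
    | succ N ih =>
      intro s
      rw [tsum_list]
      by_cases hs : s ∈ T
      · simp [weight, hs]
      · have h₁ : ∀ t, ∑' l : List S,
            (if (t :: l).length < N + 1 then D.weight T s (t :: l) else 0) =
            ENNReal.ofReal (D.P s t) *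
              ∑' l : List S, (if l.length < N then D.weight T t l else 0) := by
          intro t
          rw [← ENNReal.tsum_mul_left]
          refine tsum_congr fun l => ?_
          simp [weight, hs]
        calc _ ≤ ∑ t, ENNReal.ofReal (D.P s t) := by
              simp only [h₁]
              simp only [weight, hs, if_false, ite_self, zero_add]
              exact Finset.sum_le_sum fun t _ => mul_le_of_le_one_right' (ih t)
          _ = 1 := by
              rw [← ENNReal.ofReal_sum_of_nonneg fun t _ => D.nonneg s t, D.sum_one]
              simp
  rw [hit, ENNReal.tsum_eq_iSup_sum]
  refine iSup_le fun F => ?_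
  refine le_trans ?_ (h (F.sup List.length + 1) s)
  refine le_trans (Finset.sum_le_sum fun l hl => ?_) (ENNReal.sum_le_tsum F)
  rw [if_pos (Nat.lt_succ_of_le (Finset.le_sup (f := List.length) hl))]

theorem hit_pos_iff (s : S) : 0 < D.hit T s ↔ CanReach (fun a b => D.P a b ≠ 0) T s := by
  constructor
  · intro h
    have : ∃ l, D.weight T s l ≠ 0 := by
      by_contra! h'
      simp [hit, h'] at h
    obtain ⟨l, hl⟩ := this
    clear h
    induction l generalizing s with
    | nil =>
      have : s ∈ T := by by_contra h; simp [weight, h] at hl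
      exact ⟨s, this, .refl⟩
    | cons t l ih =>
      by_cases hs : s ∈ T
      · exact ⟨s, hs, .refl⟩
      · simp only [weight, hs, if_false] at hl
        refine CanReach.head (fun h => hl ?_) (ih t fun h => hl ?_)
        · simp [h]
        · simp [h]
  · rintro ⟨t, ht, h⟩
    induction h using ReflTransGen.head_induction_on with
    | refl => simp [hit_of_mem D T ht]
    | @head a b hab _ ih =>
      by_cases ha : a ∈ T
      · simp [hit_of_mem D T ha]
      · rw [hit_of_notMem D T ha]
        have hp : 0 < ENNReal.ofReal (D.P a b) :=
          ENNReal.ofReal_pos.2 (lt_of_le_of_ne (D.nonneg a b) (Ne.symm hab))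
        exact (ENNReal.mul_pos hp.ne' ih.ne').trans_le
          (Finset.single_le_sum (f := fun t => ENNReal.ofReal (D.P a t) * D.hit T t)
            (fun _ _ => zero_le) (Finset.mem_univ b))

/-- An average that equals the minimum of the averaged values has only equal values. -/
theorem eq_of_average_eq {a : S} {h : S → ℝ} {m : ℝ} (hm : ∑ t, D.P a t * h t = m)
    (hle : ∀ t, D.P a t ≠ 0 → m ≤ h t) {b : S} (hb : D.P a b ≠ 0) : h b = m := by
  have h₀ : ∑ t, D.P a t * (h t - m) = 0 := by
    simp only [mul_sub, Finset.sum_sub_distrib, hm, ← Finset.sum_mul, D.sum_one, one_mul, sub_self]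
  have h₁ := (Finset.sum_eq_zero_iff_of_nonneg fun t _ => ?_).1 h₀ b (Finset.mem_univ b)
  · rcases mul_eq_zero.1 h₁ with h | h
    · exact absurd h hb
    · linarith
  · by_cases ht : D.P a t = 0
    · simp [ht]
    · exact mul_nonneg (D.nonneg a t) (sub_nonneg.2 (hle t ht))

theorem toReal_hit_of_notMem {s : S} (hs : s ∉ T) :
    ∑ t, D.P s t * (D.hit T t).toReal = (D.hit T s).toReal := by
  rw [hit_of_notMem D T hs, ENNReal.toReal_sum]
  · simp [ENNReal.toReal_mul, ENNReal.toReal_ofReal (D.nonneg s _)]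
  · intro t _
    exact ENNReal.mul_ne_top ENNReal.ofReal_ne_top ((D.hit_le_one T t).trans_lt one_lt_top).ne

theorem one_le_hit_iff (s : S) :
    1 ≤ D.hit T s ↔ AlwaysCanReach (fun a b => D.P a b ≠ 0) T s := by
  have hone : ∀ u, 1 ≤ D.hit T u ↔ (D.hit T u).toReal = 1 := by
    intro u
    rw [ENNReal.toReal_eq_one_iff]
    exact ⟨fun h => le_antisymm (D.hit_le_one T u) h, fun h => h.ge⟩
  have hle : ∀ u, (D.hit T u).toReal ≤ 1 := fun u =>
    ENNReal.toReal_le_of_le_ofReal zero_le_one (by simpa using D.hit_le_one T u)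
  constructor
  · intro h u hu
    have key : 1 ≤ D.hit T u := by
      induction hu with
      | refl => exact h
      | @tail a b _ hab ih =>
        obtain ⟨ha, hab⟩ := hab
        rw [hone] at ih ⊢
        have h₁ := D.toReal_hit_of_notMem T ha
        have h₂ : ∑ t, D.P a t * (-(D.hit T t).toReal) = -1 := by
          simp [h₁, ih]
        have := D.eq_of_average_eq h₂ (fun t _ => neg_le_neg (hle t)) hab
        linarith
    exact (D.hit_pos_iff T u).1 (zero_lt_one.trans_le key)
  · intro h
    -- Among the states that can be visited before `T`, consider one from which the probability of
    -- reaching `T` is least: that probability is the same in all its successors.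
    obtain ⟨u, hu, hmin⟩ := Set.exists_min_image
      {u | ReflTransGen (fun a b => a ∉ T ∧ D.P a b ≠ 0) s u} (fun u => (D.hit T u).toReal)
      (Set.toFinite _) ⟨s, ReflTransGen.refl⟩
    have key : ∀ v, ReflTransGen (fun a b => D.P a b ≠ 0) u v → v ∈ T →
        (D.hit T u).toReal = 1 := by
      intro v huv hv
      have : ∀ w, ReflTransGen (fun a b => D.P a b ≠ 0) w v →
          ReflTransGen (fun a b => a ∉ T ∧ D.P a b ≠ 0) s w →
          (D.hit T w).toReal = (D.hit T u).toReal → (D.hit T u).toReal = 1 := by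
        intro w hw
        induction hw using ReflTransGen.head_induction_on with
        | refl => intro _ h; rw [← h, hit_of_mem D T hv]; simp
        | @head a b hab _ ih =>
          intro ha hm
          by_cases haT : a ∈ T
          · rw [← hm, hit_of_mem D T haT]; simp
          · refine ih (ha.tail ⟨haT, hab⟩) (D.eq_of_average_eq
              ((D.toReal_hit_of_notMem T haT).trans hm) (fun t ht => ?_) hab)
            exact hmin t (ha.tail ⟨haT, ht⟩)
      exact this u huv hu rfl
    obtain ⟨v, hv, huv⟩ := h u hu
    rw [hone]
    exact le_antisymm (hle s) (key v huv hv ▸ hmin s ReflTransGen.refl)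

/-- The qualitative conditions depend on the graph of a Markov chain only. -/
theorem sat_iff (c : QualCond) :
    c.Sat (D.reachProb T) ↔ c.GraphSat (fun a b => D.P a b ≠ 0) T D.init := by
  rw [reachProb_eq_hit]
  cases c with
  | positive => exact D.hit_pos_iff T _
  | unsure => exact not_le.symm.trans (not_congr (D.one_le_hit_iff T _))
  | safe => exact not_lt.symm.trans (not_congr (D.hit_pos_iff T _))
  | almostSure => exact D.one_le_hit_iff T _

end MC

end ParamMDP

namespace ParamMDP

/-! ### Rankings as certificates for all strategies -/

open Relation

section Ranking

variable {S A : Type*} (E : S → A → S → Prop) (Av : S → A → Prop) (T : Set S)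

/-- The local condition on a ranking `r` at a state `s`, where `E s a t` says that `t` is a
successor of `s` under the action `a`, `Av s a` that `a` is available in `s`, and states with
`r s ≥ n` count as unranked.

The ranked states are meant to satisfy the qualitative condition for every choice of actions. For
`positive`, ranks decrease along some path to `T`; for `almostSure`, moreover, ranked states are not
left; for `safe` only the set of ranked states matters. For `unsure`, a path along which the ranks
decrease as long as possible ends in a set of states of equal rank that is never left and does not
meet `T`. -/
def QualCond.RankOK (r : S → ℕ) (n : ℕ) (s : S) : QualCond → Prop
  | positive => s ∈ T ∨ ∀ a, Av s a → ∃ t, E s a t ∧ r t < r s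
  | unsure => s ∉ T ∧ ∀ a, Av s a → (∃ t, E s a t ∧ r t < r s) ∨ ∀ t, E s a t → r t = r s
  | safe => s ∉ T ∧ ∀ a, Av s a → ∀ t, E s a t → r t < n
  | almostSure => s ∈ T ∨
      ∀ a, Av s a → (∀ t, E s a t → r t < n) ∧ ∃ t, E s a t ∧ r t < r s

/-- The ranking `r` satisfies the local condition at all ranked states. -/
def QualCond.ValidRanking (c : QualCond) (r : S → ℕ) (n : ℕ) : Prop :=
  ∀ s, r s < n → c.RankOK E Av T r n s

variable {E Av T}

/-- At ranked states, the qualitative condition holds for all choices of actions. -/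
theorem QualCond.ValidRanking.graphSat {c : QualCond} {r : S → ℕ} {n : ℕ}
    (h : c.ValidRanking E Av T r n) {s : S} (hs : r s < n) {σ : S → A} (hσ : ∀ s, Av s (σ s)) :
    c.GraphSat (fun a b => E a (σ a) b) T s := by
  cases c with
  | positive =>
    have : ∀ m s, r s = m → r s < n → CanReach (fun a b => E a (σ a) b) T s := by
      intro m
      induction m using Nat.strong_induction_on with
      | _ m ih =>
        intro s hm hs
        rcases h s hs with hT | h'
        · exact ⟨s, hT, .refl⟩
        · obtain ⟨t, ht, hlt⟩ := h' _ (hσ s)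
          exact (ih (r t) (hm ▸ hlt) t rfl (hlt.trans hs)).head ht
    exact this _ s rfl hs
  | safe =>
    rintro ⟨t, ht, hst⟩
    have : r t < n := by
      clear ht
      induction hst with
      | refl => exact hs
      | tail _ hab ih => exact (h _ ih).2 _ (hσ _) _ hab
    exact (h t this).1 ht
  | almostSure =>
    intro u hu
    have hun : r u < n := by
      induction hu with
      | refl => exact hs
      | tail _ hab ih => exact (((h _ ih).resolve_left hab.1) _ (hσ _)).1 _ hab.2
    have : ∀ m s, r s = m → r s < n → CanReach (fun a b => E a (σ a) b) T s := by
      intro m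
      induction m using Nat.strong_induction_on with
      | _ m ih =>
        intro s hm hs
        rcases h s hs with hT | h'
        · exact ⟨s, hT, .refl⟩
        · obtain ⟨t, ht, hlt⟩ := (h' _ (hσ s)).2
          exact (ih (r t) (hm ▸ hlt) t rfl (hlt.trans hs)).head ht
    exact this _ u rfl hun
  | unsure =>
    intro has
    -- From a reachable ranked state of least rank only states of the same rank are reachable.
    have hex : ∃ m u, r u = m ∧ r u < n ∧
        ReflTransGen (fun a b => a ∉ T ∧ E a (σ a) b) s u := ⟨_, s, rfl, hs, .refl⟩
    classical
    obtain ⟨u, hu, hun, hsu⟩ := Nat.find_spec hex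
    have hmin : ∀ v, r v < n → ReflTransGen (fun a b => a ∉ T ∧ E a (σ a) b) s v →
        ¬ r v < Nat.find hex := fun v hv hsv hlt => Nat.find_min hex hlt ⟨v, rfl, hv, hsv⟩
    obtain ⟨t, htT, hut⟩ := has u hsu
    have : r t < n := by
      have : ∀ v, ReflTransGen (fun a b => E a (σ a) b) u v →
          r v = r u ∧ ReflTransGen (fun a b => a ∉ T ∧ E a (σ a) b) s v := by
        intro v hv
        induction hv with
        | refl => exact ⟨rfl, hsu⟩
        | @tail a b _ hab ih =>
          obtain ⟨hra, hsa⟩ := ih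
          have hok := h a (hra ▸ hun)
          have hsb := hsa.tail ⟨hok.1, hab⟩
          rcases hok.2 _ (hσ a) with ⟨w, hw, hlt⟩ | heq
          · exact absurd (hu ▸ hra ▸ hlt) (hmin w (by omega) (hsa.tail ⟨hok.1, hw⟩))
          · exact ⟨(heq b hab).trans hra, hsb⟩
      rw [(this t hut).1]
      exact hun
    exact (h t this).1 htT

/-- A memoryless strategy that reaches `Z` from all states where this is possible with the moves
`H`; elsewhere, and on `Z`, the strategy `σ₀` is followed. -/
theorem exists_reaching_strategy (H : S → A → S → Prop) (Z : Set S) (σ₀ : S → A) :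
    ∃ σ : S → A, (∀ s ∈ Z, σ s = σ₀ s) ∧ (∀ s, σ s = σ₀ s ∨ ∃ t, H s (σ s) t) ∧
      ∀ s, CanReach (fun a b => ∃ x, H a x b) Z s →
        (s ∈ Z ∨ ∃ t, H s (σ s) t) ∧ CanReach (fun a b => H a (σ a) b) Z s := by
  classical
  -- The states from which `Z` can be reached in exactly `i` moves.
  let D : ℕ → Set S := fun i =>
    Nat.rec (motive := fun _ => Set S) Z (fun _ W => {s | ∃ x t, H s x t ∧ t ∈ W}) i
  have hD : ∀ s, CanReach (fun a b => ∃ x, H a x b) Z s → ∃ n, s ∈ D n := by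
    rintro s ⟨z, hz, h⟩
    induction h using ReflTransGen.head_induction_on with
    | refl => exact ⟨0, hz⟩
    | head hab _ ih =>
      obtain ⟨x, hx⟩ := hab
      obtain ⟨n, hn⟩ := ih
      exact ⟨n + 1, x, _, hx, hn⟩
  have hstep : ∀ s : S, ∃ x : A, (s ∈ Z → x = σ₀ s) ∧ (x = σ₀ s ∨ ∃ t, H s x t) ∧
      ∀ h : (∃ n, s ∈ D n), s ∉ Z → ∃ t, H s x t ∧ ∃ n, n < Nat.find h ∧ t ∈ D n := by
    intro s
    by_cases h : s ∉ Z ∧ ∃ n, s ∈ D n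
    · obtain ⟨hZ, h⟩ := h
      obtain ⟨m, hm⟩ : ∃ m, Nat.find h = m + 1 := by
        refine Nat.exists_eq_succ_of_ne_zero fun h₀ => hZ ?_
        have := Nat.find_spec h
        rwa [h₀] at this
      have := Nat.find_spec h
      rw [hm] at this
      obtain ⟨x, t, hx, ht⟩ := this
      exact ⟨x, fun h => absurd h hZ, .inr ⟨t, hx⟩, fun _ _ => ⟨t, hx, m, by omega, ht⟩⟩
    · exact ⟨σ₀ s, fun _ => rfl, .inl rfl, fun h' hZ => absurd ⟨hZ, h'⟩ h⟩
  choose σ hσ₁ hσ₂ hσ₃ using hstep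
  refine ⟨σ, hσ₁, hσ₂, fun s hs => ?_⟩
  have hs := hD s hs
  refine ⟨?_, ?_⟩
  · by_cases hZ : s ∈ Z
    · exact .inl hZ
    · obtain ⟨t, ht, -⟩ := hσ₃ s hs hZ
      exact .inr ⟨t, ht⟩
  · have : ∀ n s, s ∈ D n → CanReach (fun a b => H a (σ a) b) Z s := by
      intro n
      induction n using Nat.strong_induction_on with
      | _ n ih =>
        intro s hs
        by_cases hZ : s ∈ Z
        · exact ⟨s, hZ, .refl⟩
        · obtain ⟨t, ht, m, hm, htm⟩ := hσ₃ s ⟨n, hs⟩ hZ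
          exact (ih m (hm.trans_le (Nat.find_min' _ hs)) t htm).head ht
    obtain ⟨n, hn⟩ := hs
    exact this n s hn

open Classical in
/-- The ranking `r` with the set `C` added as a new highest rank. -/
noncomputable def extendRank (r : S → ℕ) (n : ℕ) (C : Set S) (s : S) : ℕ :=
  if r s < n then r s else if s ∈ C then n else n + 1

/-- A valid ranking that cannot be extended. -/
theorem exists_maximal_ranking [Finite S] (c : QualCond) (hc : c = .positive ∨ c = .unsure) :
    ∃ r n, c.ValidRanking E Av T r n ∧ ∀ C : Set S, C.Nonempty → (∀ s ∈ C, n ≤ r s) →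
      ∃ s ∈ C, ¬ c.RankOK E Av T (extendRank r n C) (n + 1) s := by
  classical
  let 𝒲 : Set (Set S) := {W | ∃ r n, c.ValidRanking E Av T r n ∧ W = {s | r s < n}}
  obtain ⟨W, ⟨r, n, hv, rfl⟩, hmax⟩ := Set.Finite.exists_maximal (Set.toFinite 𝒲)
    ⟨_, fun _ => 0, 0, fun s hs => absurd hs (Nat.not_lt_zero _), rfl⟩
  refine ⟨r, n, hv, fun C ⟨s, hs⟩ hC => ?_⟩
  by_contra! hok
  have hlow : ∀ s, r s < n → extendRank r n C s = r s := fun s hs => if_pos hs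
  have hnew : ∀ s ∈ C, extendRank r n C s = n := fun s hs => by
    simp [extendRank, hs, (hC s hs).not_gt]
  have hv' : c.ValidRanking E Av T (extendRank r n C) (n + 1) := by
    intro u hu
    by_cases huC : u ∈ C
    · exact hok u huC
    · have hun : r u < n := by
        by_contra h
        simp [extendRank, h, huC] at hu
      have hlt : ∀ t, r t < r u → extendRank r n C t < extendRank r n C u := fun t ht => by
        rwa [hlow u hun, hlow t (ht.trans hun)]
      have heq : ∀ t, r t = r u → extendRank r n C t = extendRank r n C u := fun t ht => by
        rw [hlow u hun, hlow t (ht ▸ hun), ht]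
      have := hv u hun
      rcases hc with rfl | rfl
      · exact this.imp_right fun h a ha => (h a ha).imp fun t ht => ⟨ht.1, hlt t ht.2⟩
      · exact ⟨this.1, fun a ha => (this.2 a ha).imp
          (fun ⟨t, ht⟩ => ⟨t, ht.1, hlt t ht.2⟩) fun h t ht => heq t (h t ht)⟩
  have := hmax ⟨_, _, hv', rfl⟩ (fun u hu => (hlow u hu).trans_lt (Nat.lt_succ_of_lt hu))
    (show extendRank r n C s < n + 1 by rw [hnew s hs]; exact Nat.lt_succ_self n)
  exact absurd this (hC s hs).not_gt

/-- If all strategies reach `T` with positive probability from the states satisfying some property,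
then there is a ranking of these states; outside the ranked states, some strategy avoids both them
and `T`. -/
theorem exists_trapping_ranking [Finite S] (hAv : ∀ s, ∃ a, Av s a) :
    ∃ (r : S → ℕ) (n : ℕ) (σ : S → A), QualCond.positive.ValidRanking E Av T r n ∧
      (∀ s, Av s (σ s)) ∧ ∀ s, n ≤ r s → s ∉ T ∧ ∀ t, E s (σ s) t → n ≤ r t := by
  classical
  obtain ⟨r, n, hv, hmax⟩ :=
    exists_maximal_ranking (E := E) (Av := Av) (T := T) .positive (.inl rfl)
  have : ∀ s, ∃ a, Av s a ∧ (n ≤ r s → s ∉ T ∧ ∀ t, E s a t → n ≤ r t) := by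
    intro s
    by_cases hs : n ≤ r s
    · obtain ⟨u, rfl, hu⟩ := hmax {s} ⟨s, rfl⟩ (by rintro u rfl; exact hs)
      simp only [QualCond.RankOK, not_or, not_forall] at hu
      obtain ⟨hT, a, ha, h⟩ := hu
      refine ⟨a, ha, fun _ => ⟨hT, fun t ht => ?_⟩⟩
      by_contra! hlt
      refine h ⟨t, ht, ?_⟩
      simp [extendRank, hlt, hs.not_gt]
    · obtain ⟨a, ha⟩ := hAv s
      exact ⟨a, ha, fun h => absurd h hs⟩
  choose σ hσ₁ hσ₂ using this
  exact ⟨r, n, σ, hv, hσ₁, hσ₂⟩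

/-- If the qualitative condition holds at `s₀` for all memoryless strategies, then there is a valid
ranking that ranks `s₀`. -/
theorem exists_validRanking [Finite S] (hAv : ∀ s, ∃ a, Av s a) {c : QualCond} {s₀ : S}
    (h : ∀ σ : S → A, (∀ s, Av s (σ s)) → c.GraphSat (fun a b => E a (σ a) b) T s₀) :
    ∃ r n, c.ValidRanking E Av T r n ∧ r s₀ < n := by
  classical
  cases c with
  | positive =>
    obtain ⟨r, n, σ, hv, hσ, htrap⟩ := exists_trapping_ranking (E := E) (T := T) hAv
    refine ⟨r, n, hv, ?_⟩
    by_contra! h₀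
    obtain ⟨t, ht, hst⟩ := h σ hσ
    have : n ≤ r t := by
      clear ht
      induction hst with
      | refl => exact h₀
      | tail _ hab ih => exact (htrap _ ih).2 _ hab
    exact (htrap t this).1 ht
  | safe =>
    choose σ₀ hσ₀ using hAv
    -- The ranked states are those that some strategy reaches.
    let R : S → Prop := ReflTransGen (fun a b => ∃ x, Av a x ∧ E a x b) s₀
    have hR : ∀ s, (if R s then 0 else 1) < 1 ↔ R s := fun s => by by_cases hs : R s <;> simp [hs]
    refine ⟨fun s => if R s then 0 else 1, 1, fun s hs => ?_, (hR s₀).2 .refl⟩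
    rw [hR] at hs
    refine ⟨fun hT => ?_, fun a ha t ht => (hR t).2 (hs.tail ⟨a, ha, ht⟩)⟩
    obtain ⟨σ, -, hσ₁, hσ₂⟩ :=
      exists_reaching_strategy (fun s a t => Av s a ∧ E s a t) T σ₀
    refine h σ (fun s => ?_) ?_
    · rcases hσ₁ s with h | ⟨t, h, -⟩
      · rw [h]; exact hσ₀ s
      · exact h
    · obtain ⟨t, ht, hst⟩ := (hσ₂ s₀ ⟨s, hT, hs⟩).2
      exact ⟨t, ht, hst.lift _root_.id fun _ _ h => h.2⟩
  | almostSure =>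
    obtain ⟨r, n, σ₀, hv, hσ₀, htrap⟩ := exists_trapping_ranking (E := E) (T := T) hAv
    -- The states that can be visited before `T` are ranked, since a strategy could otherwise move
    -- to an unranked state and avoid `T` from there on.
    let R : S → Prop := ReflTransGen (fun a b => ∃ x, a ∉ T ∧ Av a x ∧ E a x b) s₀
    have hRn : ∀ s, R s → r s < n := by
      intro s hs
      by_contra! hns
      obtain ⟨σ, hσZ, hσ₁, hσ₂⟩ := exists_reaching_strategy
        (fun s a t => s ∉ T ∧ Av s a ∧ E s a t) {s | n ≤ r s} σ₀
      have hσ : ∀ s, Av s (σ s) := fun s => by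
        rcases hσ₁ s with h | ⟨t, -, h, -⟩
        · rw [h]; exact hσ₀ s
        · exact h
      obtain ⟨z, hz, hsz⟩ := (hσ₂ s₀ ⟨s, hns, hs⟩).2
      obtain ⟨t, ht, hzt⟩ := h σ hσ z (hsz.lift _root_.id fun _ _ h => ⟨h.1, h.2.2⟩)
      have : n ≤ r t := by
        clear ht
        induction hzt with
        | refl => exact hz
        | @tail a b _ hab ih =>
          rw [hσZ a ih] at hab
          exact (htrap a ih).2 b hab
      exact (htrap t this).1 ht
    have hlow : ∀ s, R s → (if R s then r s else n) = r s := fun s hs => if_pos hs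
    have hR : ∀ s, (if R s then r s else n) < n ↔ R s := fun s => by
      by_cases hs : R s
      · simp [hs, hRn s hs]
      · simp [hs]
    refine ⟨fun s => if R s then r s else n, n, fun s hs => ?_, (hR s₀).2 .refl⟩
    rw [hR] at hs
    by_cases hT : s ∈ T
    · exact .inl hT
    · refine .inr fun a ha => ?_
      have hsucc : ∀ t, E s a t → R t := fun t ht => hs.tail ⟨a, hT, ha, ht⟩
      refine ⟨fun t ht => (hR t).2 (hsucc t ht), ?_⟩
      obtain ⟨t, ht, hlt⟩ := ((hv s (hRn s hs)).resolve_left hT) a ha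
      exact ⟨t, ht, by simpa only [hlow s hs, hlow t (hsucc t ht)] using hlt⟩
  | unsure =>
    choose σ₀ hσ₀ using hAv
    obtain ⟨r, n, hv, hmax⟩ :=
      exists_maximal_ranking (E := E) (Av := Av) (T := T) .unsure (.inr rfl)
    refine ⟨r, n, hv, ?_⟩
    by_contra! h₀
    have hTn : ∀ s ∈ T, n ≤ r s := fun s hs => by
      by_contra! hlt
      exact (hv s hlt).1 hs
    -- The moves that keep the unranked states.
    let H : S → A → S → Prop := fun s a t =>
      n ≤ r s ∧ (Av s a ∧ ∀ t, E s a t → n ≤ r t) ∧ E s a t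
    -- These moves lead to `T` from all unranked states: the states from which they do not could
    -- be added as a new rank.
    have hall : ∀ s, n ≤ r s → CanReach (fun a b => ∃ x, H a x b) T s := by
      by_contra! hex
      obtain ⟨s₁, hs₁, hs₁'⟩ := hex
      obtain ⟨s, ⟨hs, hsT⟩, hok⟩ := hmax
        {s | n ≤ r s ∧ ¬ CanReach (fun a b => ∃ x, H a x b) T s} ⟨s₁, hs₁, hs₁'⟩ fun s hs => hs.1
      have hnew :
          extendRank r n {s | n ≤ r s ∧ ¬ CanReach (fun a b => ∃ x, H a x b) T s} s = n := by
        simp [extendRank, hs.not_gt, hs, hsT]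
      refine hok ⟨fun hT => hsT ⟨s, hT, .refl⟩, fun a ha => ?_⟩
      rw [hnew]
      by_contra! hcon
      obtain ⟨hge, t, ht, hne⟩ := hcon
      have hin : ∀ t, E s a t → n ≤ r t := fun t ht => by
        by_contra! hlt
        have := hge t ht
        simp [extendRank, hlt, hlt.not_ge] at this
      refine hsT (CanReach.head ⟨a, hs, ⟨ha, hin⟩, ht⟩ ?_)
      by_contra htT
      exact hne (by simp [extendRank, (hin t ht).not_gt, hin t ht, htT])
    obtain ⟨σ, -, hσ₁, hσ₂⟩ := exists_reaching_strategy H T σ₀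
    refine h σ (fun s => ?_) fun u hu => ?_
    · rcases hσ₁ s with h | ⟨t, -, ⟨h, -⟩, -⟩
      · rw [h]; exact hσ₀ s
      · exact h
    · have hun : n ≤ r u := by
        induction hu with
        | refl => exact h₀
        | @tail a b _ hab ih =>
          rcases (hσ₂ a (hall a ih)).1 with haT | ⟨t, -, ⟨-, hin⟩, -⟩
          · exact absurd haT hab.1
          · exact hin b hab.2
      obtain ⟨t, ht, hut⟩ := (hσ₂ u (hall u hun)).2
      exact ⟨t, ht, hut.lift _root_.id fun _ _ h => h.2.2⟩

/-- Ranks can be bounded by the number of states. -/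
theorem QualCond.ValidRanking.exists_le_card [Fintype S] {c : QualCond} {r : S → ℕ} {n : ℕ}
    (h : c.ValidRanking E Av T r n) {s₀ : S} (h₀ : r s₀ < n) :
    ∃ r' : S → ℕ, c.ValidRanking E Av T r' (Fintype.card S) ∧ r' s₀ < Fintype.card S ∧
      ∀ s, r' s ≤ Fintype.card S := by
  classical
  -- A rank is replaced by the number of states of lower rank.
  let r' : S → ℕ := fun s =>
    if r s < n then (Finset.univ.filter fun t => r t < r s).card else Fintype.card S
  have hle : ∀ s, (Finset.univ.filter fun t => r t < r s).card < Fintype.card S := fun s =>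
    Finset.card_lt_card (Finset.ssubset_univ_iff.2 fun he => by
      have := he ▸ Finset.mem_univ s
      simp at this)
  have hlt_card : ∀ s, r' s < Fintype.card S ↔ r s < n := by
    intro s
    by_cases hs : r s < n <;> simp [r', hs, hle]
  have hlt : ∀ s, r s < n → ∀ t, r t < r s → r' t < r' s := by
    intro s hs t ht
    simp only [r', hs, ht.trans hs, if_true]
    refine Finset.card_lt_card (Finset.ssubset_iff_of_subset ?_ |>.2 ⟨t, ?_, ?_⟩)
    · intro u hu
      simp only [Finset.mem_filter, Finset.mem_univ, true_and] at hu ⊢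
      omega
    · simpa using ht
    · simp
  have heq : ∀ s t, r t = r s → r' t = r' s := fun s t ht => by simp only [r', ht]
  refine ⟨r', fun s hs => ?_, (hlt_card s₀).2 h₀, fun s => ?_⟩
  · rw [hlt_card] at hs
    have := h s hs
    cases c with
    | positive => exact this.imp_right fun h a ha =>
        (h a ha).imp fun t ht => ⟨ht.1, hlt s hs t ht.2⟩
    | unsure => exact ⟨this.1, fun a ha => (this.2 a ha).imp
        (fun ⟨t, ht⟩ => ⟨t, ht.1, hlt s hs t ht.2⟩) fun h t ht => heq s t (h t ht)⟩
    | safe => exact ⟨this.1, fun a ha t ht => (hlt_card t).2 (this.2 a ha t ht)⟩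
    | almostSure => exact this.imp_right fun h a ha =>
        ⟨fun t ht => (hlt_card t).2 ((h a ha).1 t ht),
          (h a ha).2.imp fun t ht => ⟨ht.1, hlt s hs t ht.2⟩⟩
  · by_cases hs : r s < n
    · simp only [r', hs, if_true]
      exact (hle s).le
    · simp [r', hs]

end Ranking

end ParamMDP

namespace ParamMDP

/-! ### Rankings of Markov decision processes and of parametric ones -/

/-- The actions against which a ranking has to be valid: those of a fixed strategy `σ`, or all
available ones. -/
def Quant.Plays {S A : Type*} (Av : S → A → Prop) (σ : S → A) : Quant → S → A → Prop
  | ex => fun s a => a = σ s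
  | all => Av

namespace MDP

variable {S Act : Type*} [Fintype S] (M : MDP S Act)

/-- The graph of a Markov decision process. -/
def Edge (s : S) (a : Act) (t : S) : Prop := ∃ p, M.P s a = some p ∧ p t ≠ 0

theorem induced_sat_iff (T : Set S) (c : QualCond) (σ : M.DMStrategy) :
    c.Sat ((M.induced σ).reachProb T) ↔ c.GraphSat (fun a b => M.Edge a (σ.1 a) b) T M.init := by
  rw [MC.sat_iff]
  have : (fun a b => (M.induced σ).P a b ≠ 0) = fun a b => M.Edge a (σ.1 a) b := by
    funext a b
    obtain ⟨p, hp⟩ := Option.isSome_iff_exists.1 (σ.2 a)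
    have hget : (M.P a (σ.1 a)).get (σ.2 a) = p := by simp only [hp, Option.get_some]
    simp only [Edge, induced, hget, hp, Option.some.injEq, exists_eq_left']
  rw [this]
  rfl

/-- A qualitative reachability condition is witnessed by a ranking; for the existential quantifier,
the ranking refers to the chosen strategy. -/
theorem satisfies_iff (T : Set S) (c : QualCond) (Q : Quant) :
    M.Satisfies T c Q ↔ ∃ σ : S → Act, (∀ s, (M.P s (σ s)).isSome) ∧ ∃ r : S → ℕ,
      c.ValidRanking M.Edge (Q.Plays (fun s a => (M.P s a).isSome) σ) T r (Fintype.card S) ∧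
      r M.init < Fintype.card S ∧ ∀ s, r s ≤ Fintype.card S := by
  cases Q with
  | ex =>
    constructor
    · rintro ⟨σ, hσ⟩
      rw [induced_sat_iff] at hσ
      obtain ⟨r, n, hv, hn⟩ := exists_validRanking (E := M.Edge) (Av := fun s a => a = σ.1 s)
        (T := T) (fun s => ⟨_, rfl⟩) (c := c) (s₀ := M.init) fun τ hτ => by
          have : τ = σ.1 := funext hτ
          rwa [this]
      exact ⟨σ.1, σ.2, hv.exists_le_card hn⟩
    · rintro ⟨σ, hσ, r, hv, hn, -⟩
      exact ⟨⟨σ, hσ⟩, (M.induced_sat_iff T c ⟨σ, hσ⟩).2 (hv.graphSat hn fun s => rfl)⟩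
  | all =>
    constructor
    · intro h
      choose σ hσ using M.exists_available
      obtain ⟨r, n, hv, hn⟩ := exists_validRanking (E := M.Edge)
        (Av := fun s a => (M.P s a).isSome = true) (T := T)
        M.exists_available (c := c) (s₀ := M.init) fun τ hτ =>
          (M.induced_sat_iff T c ⟨τ, hτ⟩).1 (h ⟨τ, hτ⟩)
      exact ⟨σ, hσ, hv.exists_le_card hn⟩
    · rintro ⟨σ, hσ, r, hv, hn, -⟩ τ
      exact (M.induced_sat_iff T c τ).2 (hv.graphSat hn τ.2)

end MDP

/-- Parameters that take a value other than `0` and `1` all behave alike; the values that a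
certificate may assign to the parameters are `0`, `1`, and `2` for any such value. -/
def ValuationClass.AbstractMem {X : Type*} (v : X → ℕ) : ValuationClass → Prop
  | wellDefined => True
  | graphPreserving => ∀ x, v x = 2
  | boolean => ∀ x, v x < 2

namespace Label

variable {k : ℕ}

/-- The label does not vanish under an abstract valuation. -/
def Pos (v : Fin k → ℕ) : Label k → Prop
  | param x => v x ≠ 0
  | compl x => v x ≠ 1
  | const num _ => num ≠ 0

theorem aeval_ne_zero_iff {v : Fin k → ℕ} {u : Fin k → ℝ} (h₀ : ∀ x, u x = 0 ↔ v x = 0)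
    (h₁ : ∀ x, u x = 1 ↔ v x = 1) {ℓ : Label k} (hℓ : ℓ.Valid) :
    MvPolynomial.aeval u ℓ.toPoly ≠ 0 ↔ ℓ.Pos v := by
  cases ℓ with
  | param x => simp [toPoly, Pos, h₀]
  | compl x =>
    simp only [toPoly, Pos, map_sub, map_one, MvPolynomial.aeval_X, ne_eq, sub_eq_zero]
    rw [eq_comm, h₁]
  | const num den =>
    have : (den : ℝ) ≠ 0 := Nat.cast_ne_zero.2 hℓ
    simp [toPoly, Pos, this]

theorem toPoly_const_nonneg (num den : ℕ) : (0 : ℚ) ≤ (num : ℚ) / den := by positivity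

end Label

section table

variable {n m k : ℕ} {M : PMDP (Fin n) (Fin m) (Fin k)}
  {table : Fin n → Fin m → Option (Fin n → Label k)}

theorem isSimple_iff (hP : ∀ s a, M.P s a = (table s a).map fun f s' => (f s').toPoly) :
    M.IsSimple ↔ ∀ s a f, table s a = some f → ∑ s', (f s').toPoly = 1 := by
  constructor
  · intro h s a f hf
    exact (h s a (fun s' => (f s').toPoly) (by rw [hP, hf]; rfl)).2
  · intro h s a p hp
    rw [hP] at hp
    obtain ⟨f, hf, rfl⟩ := Option.map_eq_some_iff.1 hp
    refine ⟨fun s' => ?_, h s a f hf⟩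
    cases hs : f s' with
    | param x => exact .inl ⟨x, .inl (by simp [hs, Label.toPoly])⟩
    | compl x => exact .inl ⟨x, .inr (by simp [hs, Label.toPoly])⟩
    | const num den => exact .inr ⟨_, Label.toPoly_const_nonneg num den, by simp [hs, Label.toPoly]⟩

theorem edge_instantiate (hP : ∀ s a, M.P s a = (table s a).map fun f s' => (f s').toPoly)
    (u : Fin k → ℝ) (hu : M.WellDefined u) (s : Fin n) (a : Fin m) (t : Fin n) :
    (M.instantiate u hu).Edge s a t ↔
      ∃ f, table s a = some f ∧ MvPolynomial.aeval u (f t).toPoly ≠ 0 := by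
  simp only [MDP.Edge, PMDP.instantiate, hP, Option.map_map, Option.map_eq_some_iff]
  constructor
  · rintro ⟨p, ⟨f, hf, rfl⟩, h⟩
    exact ⟨f, hf, h⟩
  · rintro ⟨f, hf, h⟩
    exact ⟨_, ⟨f, hf, rfl⟩, h⟩

/-- Yes-instances are witnessed by an abstract valuation, a strategy and a ranking. -/
theorem yesInstance_iff (hP : ∀ s a, M.P s a = (table s a).map fun f s' => (f s').toPoly)
    (hvalid : ∀ s a f, table s a = some f → ∀ s', (f s').Valid) (hM : M.IsSimple)
    (R : ValuationClass) (Q : Quant) (c : QualCond) (T : Finset (Fin n)) :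
    M.YesInstance R Q c (T : Set (Fin n)) ↔
      ∃ v : Fin k → ℕ, R.AbstractMem v ∧ (∀ x, v x ≤ 2) ∧
      ∃ σ : Fin n → Fin m, (∀ s, (table s (σ s)).isSome) ∧ ∃ r : Fin n → ℕ,
        c.ValidRanking (fun s a t => ∃ f, table s a = some f ∧ (f t).Pos v)
          (Q.Plays (fun s a => (table s a).isSome) σ) (T : Set (Fin n)) r n ∧
        r M.init < n ∧ ∀ s, r s ≤ n := by
  have hav : ∀ (u : Fin k → ℝ) (hu : M.WellDefined u) s a,
      ((M.instantiate u hu).P s a).isSome = (table s a).isSome := fun u hu s a => by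
    simp [PMDP.instantiate, hP]
  constructor
  · rintro ⟨u, hu, hR, hsat⟩
    obtain ⟨v, hv, hv2, hpos⟩ : ∃ v : Fin k → ℕ, R.AbstractMem v ∧ (∀ x, v x ≤ 2) ∧
        ∀ s a f t, table s a = some f →
          (MvPolynomial.aeval u (f t).toPoly ≠ 0 ↔ (f t).Pos v) := by
      classical
      by_cases hRg : R = .graphPreserving
      · subst hRg
        have hG : ∀ s a s', ¬ M.Vanishes u s a s' := hR
        -- A parameter that does not occur may have the value `0` or `1`, so that `u` does not
        -- determine the abstract valuation here.
        refine ⟨fun _ => 2, fun _ => rfl, fun _ => le_rfl, fun s a f t hf => ?_⟩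
        have hrow : M.P s a = some fun s' => (f s').toPoly := by rw [hP, hf, Option.map_some]
        have hne : (f t).toPoly ≠ 0 → MvPolynomial.aeval u (f t).toPoly ≠ 0 := fun h₀ h =>
          hG s a t ⟨_, hrow, h₀, h⟩
        have hval := hvalid s a f hf t
        cases ht : f t with
        | param x =>
          rw [ht] at hne
          exact iff_of_true (hne (MvPolynomial.X_ne_zero x)) (by simp [Label.Pos])
        | compl x =>
          rw [ht] at hne
          refine iff_of_true (hne fun h => ?_) (by simp [Label.Pos])
          have := congrArg (MvPolynomial.aeval (fun _ => (0 : ℚ))) h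
          simp [Label.toPoly] at this
        | const num den =>
          rw [ht] at hval
          have : (den : ℝ) ≠ 0 := Nat.cast_ne_zero.2 hval
          simp [Label.toPoly, Label.Pos, this]
      · refine ⟨fun x => if u x = 0 then 0 else if u x = 1 then 1 else 2, ?_, fun x => ?_,
          fun s a f t hf => Label.aeval_ne_zero_iff (fun x => ?_) (fun x => ?_)
            (hvalid s a f hf t)⟩
        · cases R with
          | wellDefined => trivial
          | graphPreserving => exact absurd rfl hRg
          | boolean => intro x; rcases hR x with h | h <;> simp [h]
        · dsimp only; split_ifs <;> omega
        · by_cases h : u x = 0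
          · simp [h]
          · by_cases h' : u x = 1 <;> simp [h, h']
        · by_cases h : u x = 0
          · simp [h]
          · by_cases h' : u x = 1 <;> simp [h, h']
    rw [MDP.satisfies_iff] at hsat
    obtain ⟨σ, hσ, r, hr, h₀, hle⟩ := hsat
    have hE : (M.instantiate u hu).Edge = fun s a t => ∃ f, table s a = some f ∧ (f t).Pos v := by
      funext s a t
      rw [edge_instantiate hP, eq_iff_iff]
      exact exists_congr fun f => and_congr_right fun hf => hpos s a f t hf
    simp only [hav, Fintype.card_fin, hE] at hσ hr h₀ hle
    exact ⟨v, hv, hv2, σ, hσ, r, hr, h₀, hle⟩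
  · rintro ⟨v, hv, hv2, σ, hσ, r, hr, h₀, hle⟩
    -- Any value between `0` and `1` may stand for the abstract value `2`.
    let u : Fin k → ℝ := fun x => if v x = 0 then 0 else if v x = 1 then 1 else 1 / 2
    have h0 : ∀ x, u x = 0 ↔ v x = 0 := fun x => by
      by_cases h : v x = 0
      · simp [u, h]
      · by_cases h' : v x = 1 <;> simp [u, h, h']
    have h1 : ∀ x, u x = 1 ↔ v x = 1 := fun x => by
      by_cases h : v x = 0
      · simp [u, h]
      · by_cases h' : v x = 1 <;> simp [u, h, h']
    have h01 : ∀ x, 0 ≤ u x ∧ u x ≤ 1 := fun x => by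
      simp only [u]
      split_ifs <;> norm_num
    have hu : M.WellDefined u := by
      intro s a p hp
      obtain ⟨hlab, hsum⟩ := hM s a p hp
      refine ⟨fun s' => ?_, ?_⟩
      · rcases hlab s' with ⟨x, h | h⟩ | ⟨q, hq, h⟩ <;> rw [h]
        · simpa using (h01 x).1
        · simpa using (h01 x).2
        · simpa using hq
      · rw [← map_sum, hsum, map_one]
    have hpos : ∀ s a f t, table s a = some f →
        (MvPolynomial.aeval u (f t).toPoly ≠ 0 ↔ (f t).Pos v) := fun s a f t hf =>
      Label.aeval_ne_zero_iff h0 h1 (hvalid s a f hf t)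
    refine ⟨u, hu, ?_, ?_⟩
    · cases R with
      | wellDefined => trivial
      | graphPreserving =>
        rintro s a t ⟨p, hp, hne, hz⟩
        rw [hP] at hp
        obtain ⟨f, hf, rfl⟩ := Option.map_eq_some_iff.1 hp
        refine (hpos s a f t hf).2 ?_ hz
        have hval := hvalid s a f hf t
        cases ht : f t with
        | param x => simp [Label.Pos, hv x]
        | compl x => simp [Label.Pos, hv x]
        | const num den =>
          rintro rfl
          exact hne (by simp [ht, Label.toPoly])
      | boolean =>
        intro x
        have := hv x
        rw [h0, h1]
        omega
    · rw [MDP.satisfies_iff]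
      have hE : (M.instantiate u hu).Edge =
          fun s a t => ∃ f, table s a = some f ∧ (f t).Pos v := by
        funext s a t
        rw [edge_instantiate hP, eq_iff_iff]
        exact exists_congr fun f => and_congr_right fun hf => hpos s a f t hf
      refine ⟨σ, fun s => by rw [hav]; exact hσ s, r, ?_⟩
      simp only [hav, Fintype.card_fin, hE]
      exact ⟨hr, h₀, hle⟩

end table

/-! ### Rows of labels that sum up to one -/

/-- A sum of terms `x`, `1 - x` and a nonnegative constant is identically one only if there are no
other terms than the constant or if it is `x + (1 - x)`. -/
theorem sum_eq_one_iff {k : ℕ} (P N : List (Fin k)) {q : ℚ} (hq : 0 ≤ q) :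
    (P.map MvPolynomial.X).sum + (N.map fun x => 1 - MvPolynomial.X x).sum +
        (MvPolynomial.C q : MvPolynomial (Fin k) ℚ) = 1 ↔
      P = N ∧ (P = [] ∧ q = 1 ∨ P.length = 1 ∧ q = 0) := by
  constructor
  · intro h
    have hev : ∀ v : Fin k → ℚ, (P.map v).sum + (N.map fun x => 1 - v x).sum + q = 1 := by
      intro v
      have := congrArg (MvPolynomial.aeval v) h
      simpa [map_list_sum, List.map_map, Function.comp_def] using this
    -- The valuations that are constantly `0` and constantly `1` determine the numbers of terms.
    have h₀ : (N.length : ℚ) + q = 1 := by simpa using hev fun _ => 0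
    have h₁ : (P.length : ℚ) + q = 1 := by simpa using hev fun _ => 1
    have hPN : P.length = N.length := by
      have : (P.length : ℚ) = N.length := by linarith
      exact_mod_cast this
    have hP : P.length ≤ 1 := by
      have : (P.length : ℚ) ≤ 1 := by linarith
      exact_mod_cast this
    rcases Nat.le_one_iff_eq_zero_or_eq_one.1 hP with hP | hP
    · have hP' := List.eq_nil_of_length_eq_zero hP
      have hN' := List.eq_nil_of_length_eq_zero (hPN ▸ hP)
      subst hP' hN'
      exact ⟨rfl, .inl ⟨rfl, by simpa using h₁⟩⟩
    · obtain ⟨x, rfl⟩ := List.length_eq_one_iff.1 hP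
      obtain ⟨y, rfl⟩ := List.length_eq_one_iff.1 (hPN ▸ hP)
      have hq0 : q = 0 := by simpa using h₁
      have := hev (Pi.single x 1)
      have hxy : y = x := by
        by_contra hne
        simp [hq0, Pi.single_eq_of_ne hne] at this
      exact ⟨by rw [hxy], .inr ⟨rfl, hq0⟩⟩
  · rintro ⟨rfl, ⟨rfl, rfl⟩ | ⟨hP, rfl⟩⟩
    · simp
    · obtain ⟨x, rfl⟩ := List.length_eq_one_iff.1 hP
      simp

end ParamMDP

/-! ### Certificates -/

namespace ParamMDP

open StackProg

/-- A number that identifies a symbol. -/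
def Sym.code : Sym → ℕ
  | bit false => 0
  | bit true => 1
  | sep => 2
  | unavailable => 3
  | param => 4
  | compl => 5
  | const => 6

instance : TreeEnc Sym := ⟨fun a => TreeEnc.enc a.code⟩

/-- A transition label as it occurs in a certificate: a constant fraction `num / den` with binary
numerator and denominator, or the parameter with index `idx`, or its complement. -/
structure RawLabel where
  /-- whether the label is a constant -/
  isConst : Bool
  /-- whether the label is of the form `1 - x` -/
  isCompl : Bool
  /-- the index of the parameter -/
  idx : ℕ
  /-- the digits of the numerator -/
  num : List Bool
  /-- the digits of the denominator -/
  den : List Bool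

/-- The labels of an action in a state, in a certificate. -/
structure RawRow where
  /-- whether the action is available -/
  isAvailable : Bool
  /-- the labels of the transitions to all states -/
  labels : List RawLabel

/-- A certificate for a yes-instance: the instance itself, an abstract valuation, a strategy and a
ranking. Lists stand for functions on initial segments of `ℕ`, read with a default value. -/
structure Certificate where
  /-- the number of states -/
  states : ℕ
  /-- the number of actions -/
  actions : ℕ
  /-- the number of parameters -/
  params : ℕ
  /-- the initial state -/
  init : ℕ
  /-- the indicator vector of the set of targets -/
  targets : List Bool
  /-- the table of transitions -/
  table : List (List RawRow)
  /-- the abstract values of the parameters -/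
  val : List ℕ
  /-- the actions that the strategy chooses -/
  strat : List ℕ
  /-- the ranks of the states -/
  rank : List ℕ

/-- Raw labels as tuples. -/
def RawLabel.equiv : Bool × Bool × ℕ × List Bool × List Bool ≃ RawLabel where
  toFun x := ⟨x.1, x.2.1, x.2.2.1, x.2.2.2.1, x.2.2.2.2⟩
  invFun l := (l.isConst, l.isCompl, l.idx, l.num, l.den)
  left_inv _ := rfl
  right_inv _ := rfl

/-- Raw rows as pairs. -/
def RawRow.equiv : Bool × List RawLabel ≃ RawRow where
  toFun x := ⟨x.1, x.2⟩
  invFun r := (r.isAvailable, r.labels)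
  left_inv _ := rfl
  right_inv _ := rfl

/-- Certificates as tuples. -/
def Certificate.equiv : ℕ × ℕ × ℕ × ℕ × List Bool × List (List RawRow) × List ℕ × List ℕ × List ℕ ≃
    Certificate where
  toFun x := ⟨x.1, x.2.1, x.2.2.1, x.2.2.2.1, x.2.2.2.2.1, x.2.2.2.2.2.1, x.2.2.2.2.2.2.1,
    x.2.2.2.2.2.2.2.1, x.2.2.2.2.2.2.2.2⟩
  invFun c := (c.states, c.actions, c.params, c.init, c.targets, c.table, c.val, c.strat, c.rank)
  left_inv _ := rfl
  right_inv _ := rfl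

instance : TreeEnc RawLabel := ⟨fun l => TreeEnc.enc (RawLabel.equiv.symm l)⟩
instance : TreeEnc RawRow := ⟨fun r => TreeEnc.enc (RawRow.equiv.symm r)⟩
instance : TreeEnc Certificate := ⟨fun c => TreeEnc.enc (Certificate.equiv.symm c)⟩

instance : TreeDec RawLabel := .ofEquiv RawLabel.equiv fun _ => rfl
instance : TreeDec RawRow := .ofEquiv RawRow.equiv fun _ => rfl
instance : TreeDec Certificate := .ofEquiv Certificate.equiv fun _ => rfl

section PolyTime

@[fun_prop]
theorem RawLabel.polyTime_isConst : PolyTime RawLabel.isConst :=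
  .of_equiv RawLabel.equiv (fun _ => rfl) (f := fun x => x.1) (by fun_prop)
@[fun_prop]
theorem RawLabel.polyTime_isCompl : PolyTime RawLabel.isCompl :=
  .of_equiv RawLabel.equiv (fun _ => rfl) (f := fun x => x.2.1) (by fun_prop)
@[fun_prop]
theorem RawLabel.polyTime_idx : PolyTime RawLabel.idx :=
  .of_equiv RawLabel.equiv (fun _ => rfl) (f := fun x => x.2.2.1) (by fun_prop)
@[fun_prop]
theorem RawLabel.polyTime_num : PolyTime RawLabel.num :=
  .of_equiv RawLabel.equiv (fun _ => rfl) (f := fun x => x.2.2.2.1) (by fun_prop)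
@[fun_prop]
theorem RawLabel.polyTime_den : PolyTime RawLabel.den :=
  .of_equiv RawLabel.equiv (fun _ => rfl) (f := fun x => x.2.2.2.2) (by fun_prop)
@[fun_prop]
theorem RawRow.polyTime_isAvailable : PolyTime RawRow.isAvailable :=
  .of_equiv RawRow.equiv (fun _ => rfl) (f := fun x => x.1) (by fun_prop)
@[fun_prop]
theorem RawRow.polyTime_labels : PolyTime RawRow.labels :=
  .of_equiv RawRow.equiv (fun _ => rfl) (f := fun x => x.2) (by fun_prop)

namespace Certificate

@[fun_prop]
theorem polyTime_states : PolyTime states :=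
  .of_equiv equiv (fun _ => rfl) (f := fun x => x.1) (by fun_prop)
@[fun_prop]
theorem polyTime_actions : PolyTime actions :=
  .of_equiv equiv (fun _ => rfl) (f := fun x => x.2.1) (by fun_prop)
@[fun_prop]
theorem polyTime_params : PolyTime params :=
  .of_equiv equiv (fun _ => rfl) (f := fun x => x.2.2.1) (by fun_prop)
@[fun_prop]
theorem polyTime_init : PolyTime init :=
  .of_equiv equiv (fun _ => rfl) (f := fun x => x.2.2.2.1) (by fun_prop)
@[fun_prop]
theorem polyTime_targets : PolyTime targets :=
  .of_equiv equiv (fun _ => rfl) (f := fun x => x.2.2.2.2.1) (by fun_prop)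
@[fun_prop]
theorem polyTime_table : PolyTime table :=
  .of_equiv equiv (fun _ => rfl) (f := fun x => x.2.2.2.2.2.1) (by fun_prop)
@[fun_prop]
theorem polyTime_val : PolyTime val :=
  .of_equiv equiv (fun _ => rfl) (f := fun x => x.2.2.2.2.2.2.1) (by fun_prop)
@[fun_prop]
theorem polyTime_strat : PolyTime strat :=
  .of_equiv equiv (fun _ => rfl) (f := fun x => x.2.2.2.2.2.2.2.1) (by fun_prop)
@[fun_prop]
theorem polyTime_rank : PolyTime rank :=
  .of_equiv equiv (fun _ => rfl) (f := fun x => x.2.2.2.2.2.2.2.2) (by fun_prop)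

end Certificate

theorem Sym.enc_injective : Function.Injective (TreeEnc.enc : Sym → Tree) := by
  intro a b h
  have : a.code = b.code := StackProg.enc_injective (α := ℕ) h
  revert this
  revert a b
  decide

@[fun_prop]
theorem Sym.polyTime_bit : PolyTime Sym.bit :=
  .of_finite StackProg.enc_injective _

theorem Sym.polyTime_decide_eq : PolyTime fun x : Sym × Sym => decide (x.1 = x.2) :=
  .of_finite (fun a b h => by
    simp only [enc_prod, Tree.node.injEq] at h
    exact Prod.ext (Sym.enc_injective h.1) (Sym.enc_injective h.2)) _

@[fun_prop]
theorem polyTime_encodeUnary : PolyTime encodeUnary := by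
  unfold encodeUnary
  fun_prop

end PolyTime

/-! ### Verification of labels and rows -/

/-- The word of a fraction is made from normalised binary numbers, since these are what an instance
consists of. -/
def RawLabel.encode (l : RawLabel) : List Sym :=
  if l.isConst = true then
    Sym.const :: ((normBits l.num).map Sym.bit ++ [Sym.sep] ++
      ((normBits l.den).map Sym.bit ++ [Sym.sep]))
  else (if l.isCompl = true then Sym.compl else Sym.param) :: encodeUnary l.idx

/-- The index of a parameter is less than `k` and a denominator is nonzero. -/
def RawLabel.wf (k : ℕ) (l : RawLabel) : Bool :=
  if l.isConst = true then !(normBits l.den).isEmpty else decide (l.idx < k)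

/-- The label does not vanish under an abstract valuation. -/
def RawLabel.pos (val : List ℕ) (l : RawLabel) : Bool :=
  if l.isConst = true then !(normBits l.num).isEmpty
  else !decide (val.getD l.idx 0 = if l.isCompl = true then 1 else 0)

/-- The label that a raw label stands for, provided that it is well-formed. -/
def RawLabel.toLabel (k : ℕ) (l : RawLabel) : Label k :=
  if l.isConst = true then .const (bval l.num) (bval l.den)
  else if h : l.idx < k then
    if l.isCompl = true then .compl ⟨l.idx, h⟩ else .param ⟨l.idx, h⟩
  else .const 0 1

theorem normBits_eq_nil (l : List Bool) : normBits l = [] ↔ bval l = 0 := by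
  constructor
  · intro h
    rw [← bval_bits (bval l)]
    exact congrArg bval h
  · intro h
    simp [normBits, h]

namespace RawLabel

variable {k : ℕ} {l : RawLabel}

theorem valid_toLabel (hl : l.wf k = true) : (l.toLabel k).Valid := by
  by_cases hc : l.isConst = true
  · simpa [wf, toLabel, hc, normBits_eq_nil, Label.Valid] using hl
  · have : l.idx < k := by simpa [wf, hc] using hl
    by_cases hx : l.isCompl = true <;> simp [toLabel, hc, this, hx, Label.Valid]

theorem encode_toLabel (hl : l.wf k = true) : (l.toLabel k).encode = l.encode := by
  by_cases hc : l.isConst = true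
  · simp [toLabel, hc, Label.encode, encode, encodeBinary, normBits]
  · have : l.idx < k := by simpa [wf, hc] using hl
    by_cases hx : l.isCompl = true <;> simp [toLabel, hc, this, hx, Label.encode, encode]

theorem pos_toLabel (hl : l.wf k = true) (val : List ℕ) :
    (l.toLabel k).Pos (fun x => val.getD x 0) ↔ l.pos val = true := by
  by_cases hc : l.isConst = true
  · simp [toLabel, hc, Label.Pos, pos, normBits_eq_nil]
  · have : l.idx < k := by simpa [wf, hc] using hl
    by_cases hx : l.isCompl = true <;> simp [toLabel, hc, this, hx, Label.Pos, pos]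

end RawLabel

@[fun_prop]
theorem RawLabel.polyTime_encode : PolyTime RawLabel.encode := by
  unfold RawLabel.encode
  fun_prop

@[fun_prop]
theorem RawLabel.polyTime_wf {α : Type} [TreeEnc α] {f : α → ℕ} {g : α → RawLabel}
    (hf : PolyTime f) (hg : PolyTime g) : PolyTime fun a => (g a).wf (f a) := by
  unfold RawLabel.wf
  fun_prop

@[fun_prop]
theorem RawLabel.polyTime_pos {α : Type} [TreeEnc α] {f : α → List ℕ} {g : α → RawLabel}
    (hf : PolyTime f) (hg : PolyTime g) : PolyTime fun a => (g a).pos (f a) := by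
  unfold RawLabel.pos
  fun_prop

end ParamMDP

namespace ParamMDP

open StackProg

namespace Label

variable {k : ℕ}

/-- The parameter of a label of the form `x`. -/
def plains : Label k → List (Fin k)
  | param x => [x]
  | _ => []

/-- The parameter of a label of the form `1 - x`. -/
def compls : Label k → List (Fin k)
  | compl x => [x]
  | _ => []

/-- The value of a constant label. -/
def fraction : Label k → ℚ
  | const num den => num / den
  | _ => 0

theorem sum_toPoly (L : List (Label k)) : (L.map toPoly).sum =
    ((L.flatMap plains).map MvPolynomial.X).sum +
      ((L.flatMap compls).map fun x => 1 - MvPolynomial.X x).sum +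
      MvPolynomial.C (L.map fraction).sum := by
  induction L with
  | nil => simp
  | cons ℓ L ih =>
    rw [List.map_cons, List.sum_cons, ih]
    cases ℓ <;> simp [toPoly, plains, compls, fraction] <;> ring

theorem fraction_nonneg (ℓ : Label k) : 0 ≤ ℓ.fraction := by
  cases ℓ <;> simp only [fraction] <;> positivity

end Label

namespace RawLabel

/-- Addition of a constant label to a fraction. -/
def addTo (s : List Bool × List Bool) (l : RawLabel) : List Bool × List Bool :=
  if l.isConst = true then (addBits (mulBits s.1 l.den) (mulBits l.num s.2), mulBits s.2 l.den)
  else s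

/-- Numerator and denominator of the sum of the constants in a row. -/
def constSum (ls : List RawLabel) : List Bool × List Bool := ls.foldl addTo ([], [true])

/-- The parameters `x` such that a label `x` occurs in a row. -/
def plains (ls : List RawLabel) : List ℕ :=
  ls.flatMap fun l => if (l.isConst || l.isCompl) = true then [] else [l.idx]

/-- The parameters `x` such that a label `1 - x` occurs in a row. -/
def compls (ls : List RawLabel) : List ℕ :=
  ls.flatMap fun l => if (!l.isConst && l.isCompl) = true then [l.idx] else []

/-- The labels of a row sum up to `1`. -/
def sumsToOne (ls : List RawLabel) : Bool :=
  decide (plains ls = compls ls) &&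
    if (plains ls).isEmpty = true then
      decide (normBits (constSum ls).1 = normBits (constSum ls).2)
    else decide ((plains ls).length = 1) && (normBits (constSum ls).1).isEmpty

theorem bval_addBits (x y : List Bool) : bval (addBits x y) = bval x + bval y := bval_bits _

theorem bval_mulBits (x y : List Bool) : bval (mulBits x y) = bval x * bval y := bval_bits _

variable {k : ℕ}

/-- The accumulated fraction has a nonzero denominator and the expected value. -/
theorem foldl_addTo {ls : List RawLabel} (hls : ∀ l ∈ ls, l.wf k = true)
    (s : List Bool × List Bool) (hs : bval s.2 ≠ 0) : bval (ls.foldl addTo s).2 ≠ 0 ∧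
      (bval (ls.foldl addTo s).1 / bval (ls.foldl addTo s).2 : ℚ) =
        bval s.1 / bval s.2 + (ls.map fun l => (l.toLabel k).fraction).sum := by
  induction ls generalizing s with
  | nil => simpa using hs
  | cons l ls ih =>
    have hl := hls l (by simp)
    by_cases hc : l.isConst = true
    · have hd : bval l.den ≠ 0 := by simpa [wf, hc, normBits_eq_nil] using hl
      have hstep : addTo s l =
          (addBits (mulBits s.1 l.den) (mulBits l.num s.2), mulBits s.2 l.den) := by
        simp [addTo, hc]
      obtain ⟨h₁, h₂⟩ := ih (fun l hl => hls l (by simp [hl])) (addTo s l)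
        (by rw [hstep, bval_mulBits]; exact mul_ne_zero hs hd)
      refine ⟨h₁, ?_⟩
      have hs' : (bval s.2 : ℚ) ≠ 0 := Nat.cast_ne_zero.2 hs
      have hd' : (bval l.den : ℚ) ≠ 0 := Nat.cast_ne_zero.2 hd
      rw [List.foldl_cons, h₂, hstep]
      simp only [bval_addBits, bval_mulBits, List.map_cons, List.sum_cons, toLabel, hc, if_true,
        Label.fraction]
      push_cast
      field_simp
      ring
    · have hx : (l.toLabel k).fraction = 0 := by
        have : l.idx < k := by simpa [wf, hc] using hl
        by_cases hx : l.isCompl = true <;> simp [toLabel, hc, this, hx, Label.fraction]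
      have hstep : addTo s l = s := by simp [addTo, hc]
      rw [List.foldl_cons, hstep, List.map_cons, List.sum_cons, hx, zero_add]
      exact ih (fun l hl => hls l (by simp [hl])) s hs

theorem plains_eq {ls : List RawLabel} (hls : ∀ l ∈ ls, l.wf k = true) :
    plains ls = ((ls.map (toLabel k)).flatMap Label.plains).map Fin.val := by
  induction ls with
  | nil => rfl
  | cons l ls ih =>
    have hl := hls l (by simp)
    have := ih fun l hl => hls l (by simp [hl])
    simp only [plains, List.flatMap_cons, List.map_cons, List.map_append] at this ⊢
    rw [this]
    congr 1
    by_cases hc : l.isConst = true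
    · simp [toLabel, hc, Label.plains]
    · have : l.idx < k := by simpa [wf, hc] using hl
      by_cases hx : l.isCompl = true <;> simp [toLabel, hc, this, hx, Label.plains]

theorem compls_eq {ls : List RawLabel} (hls : ∀ l ∈ ls, l.wf k = true) :
    compls ls = ((ls.map (toLabel k)).flatMap Label.compls).map Fin.val := by
  induction ls with
  | nil => rfl
  | cons l ls ih =>
    have hl := hls l (by simp)
    have := ih fun l hl => hls l (by simp [hl])
    simp only [compls, List.flatMap_cons, List.map_cons, List.map_append] at this ⊢
    rw [this]
    congr 1
    by_cases hc : l.isConst = true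
    · simp [toLabel, hc, Label.compls]
    · have : l.idx < k := by simpa [wf, hc] using hl
      by_cases hx : l.isCompl = true <;> simp [toLabel, hc, this, hx, Label.compls]

theorem normBits_eq_normBits {x y : List Bool} : normBits x = normBits y ↔ bval x = bval y := by
  constructor
  · intro h
    rw [← bval_bits (bval x), ← bval_bits (bval y)]
    exact congrArg bval h
  · intro h
    simp [normBits, h]

/-- The check of a row is correct. -/
theorem sumsToOne_iff {ls : List RawLabel} (hls : ∀ l ∈ ls, l.wf k = true) :
    sumsToOne ls = true ↔ ((ls.map (toLabel k)).map Label.toPoly).sum = 1 := by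
  have hq : 0 ≤ ((ls.map (toLabel k)).map Label.fraction).sum :=
    List.sum_nonneg fun q hq => by
      obtain ⟨ℓ, -, rfl⟩ := List.mem_map.1 hq
      exact ℓ.fraction_nonneg
  rw [Label.sum_toPoly, sum_eq_one_iff _ _ hq]
  obtain ⟨hB, hAB⟩ := foldl_addTo hls ([], [true]) (by simp)
  have hB' : (bval (constSum ls).2 : ℚ) ≠ 0 := Nat.cast_ne_zero.2 hB
  have hfrac : ((ls.map (toLabel k)).map Label.fraction).sum =
      bval (constSum ls).1 / bval (constSum ls).2 := by
    rw [constSum, hAB]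
    simp [Function.comp_def]
  have h0 : ((ls.map (toLabel k)).map Label.fraction).sum = 0 ↔ bval (constSum ls).1 = 0 := by
    rw [hfrac]
    simp only [div_eq_zero_iff, hB', or_false, Nat.cast_eq_zero]
  have h1 : ((ls.map (toLabel k)).map Label.fraction).sum = 1 ↔
      bval (constSum ls).1 = bval (constSum ls).2 := by
    rw [hfrac, div_eq_one_iff_eq hB', Nat.cast_inj]
  rw [h0, h1, sumsToOne, plains_eq hls, compls_eq hls]
  generalize (ls.map (toLabel k)).flatMap Label.plains = P
  generalize (ls.map (toLabel k)).flatMap Label.compls = N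
  have hinj : P.map Fin.val = N.map Fin.val ↔ P = N :=
    (List.map_injective_iff.2 Fin.val_injective).eq_iff
  rw [Bool.and_eq_true, decide_eq_true_iff, hinj]
  refine and_congr_right fun _ => ?_
  by_cases hP : P = []
  · simp [hP, normBits_eq_normBits]
  · simp [hP, normBits_eq_nil]

/-- A label contributes at most `|num| + |den| + 1` digits to numerator and denominator. -/
theorem bval_addTo_lt {s : List Bool × List Bool} {l : RawLabel} {b : ℕ}
    (h₁ : bval s.1 < 2 ^ b) (h₂ : bval s.2 < 2 ^ b) :
    bval (addTo s l).1 < 2 ^ (b + (l.num.length + l.den.length + 1)) ∧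
      bval (addTo s l).2 < 2 ^ (b + (l.num.length + l.den.length + 1)) := by
  have hle : ∀ x, x < 2 ^ b → x < 2 ^ (b + (l.num.length + l.den.length + 1)) := fun x hx =>
    hx.trans_le (Nat.pow_le_pow_right two_pos (by omega))
  by_cases hc : l.isConst = true
  · have hn := bval_lt l.num
    have hd := bval_lt l.den
    have e₁ : bval s.1 * bval l.den < 2 ^ (b + (l.num.length + l.den.length)) :=
      (Nat.mul_lt_mul'' h₁ hd).trans_le
        (by rw [← pow_add]; exact Nat.pow_le_pow_right two_pos (by omega))
    have e₂ : bval l.num * bval s.2 < 2 ^ (b + (l.num.length + l.den.length)) :=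
      (Nat.mul_lt_mul'' hn h₂).trans_le
        (by rw [← pow_add]; exact Nat.pow_le_pow_right two_pos (by omega))
    have e₃ : bval s.2 * bval l.den < 2 ^ (b + (l.num.length + l.den.length)) :=
      (Nat.mul_lt_mul'' h₂ hd).trans_le
        (by rw [← pow_add]; exact Nat.pow_le_pow_right two_pos (by omega))
    simp only [addTo, hc, if_true, bval_addBits, bval_mulBits, ← add_assoc, pow_succ] at *
    constructor <;> omega
  · simpa [addTo, hc] using ⟨hle _ h₁, hle _ h₂⟩

theorem sz_le_of_bval_lt {x : List Bool} (hx : x = normBits x) {b : ℕ} (h : bval x < 2 ^ b) :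
    sz x ≤ 4 * b + 1 := by
  have h₁ := sz_bits_le x
  have h₂ : x.length ≤ b := by
    rw [hx]
    exact length_bits_le h
  omega

/-- The numerator and the denominator of a sum of fractions are of polynomial size. -/
theorem sz_foldl_addTo (ls : List RawLabel) {s : List Bool × List Bool} {b : ℕ}
    (h₁ : bval s.1 < 2 ^ b) (h₂ : bval s.2 < 2 ^ b) (hs₁ : s.1 = normBits s.1)
    (hs₂ : s.2 = normBits s.2) : sz (ls.foldl addTo s) ≤ 8 * (b + sz ls) + 3 := by
  induction ls generalizing s b with
  | nil =>
    have := sz_le_of_bval_lt hs₁ h₁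
    have := sz_le_of_bval_lt hs₂ h₂
    simp
    omega
  | cons l ls ih =>
    obtain ⟨h₁', h₂'⟩ := bval_addTo_lt (l := l) h₁ h₂
    have hnorm : (addTo s l).1 = normBits (addTo s l).1 ∧
        (addTo s l).2 = normBits (addTo s l).2 := by
      by_cases hc : l.isConst = true
      · simp [addTo, hc, addBits, mulBits, normBits, bval_bits]
      · simpa [addTo, hc] using ⟨hs₁, hs₂⟩
    have h := ih h₁' h₂' hnorm.1 hnorm.2
    have hl : l.num.length + l.den.length + 1 ≤ sz l := by
      have := length_lt_sz l.num
      have := length_lt_sz l.den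
      have : sz l = sz (RawLabel.equiv.symm l) := rfl
      simp [equiv] at this
      omega
    rw [List.foldl_cons, sz_cons]
    omega

@[fun_prop]
theorem polyTime_constSum : PolyTime constSum := by
  unfold constSum
  refine PolyTime.foldl (h := fun _ => addTo) .id (.const _) (by unfold addTo; fun_prop)
    (8 * (1 + Polynomial.X) + 3) fun ls l hl => ?_
  have h := sz_foldl_addTo l (s := ([], [true])) (b := 1) (by simp) (by simp) (by simp [normBits])
    (by simp [normBits])
  have : sz l ≤ sz ls := by
    obtain ⟨m, rfl⟩ := hl
    have := PolyTime.sz_append l m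
    have := one_le_sz m
    omega
  refine h.trans ?_
  simp
  omega

@[fun_prop]
theorem polyTime_plains : PolyTime plains := by
  unfold plains
  fun_prop

@[fun_prop]
theorem polyTime_compls : PolyTime compls := by
  unfold compls
  fun_prop

@[fun_prop]
theorem polyTime_sumsToOne : PolyTime sumsToOne := by
  have h₁ : PolyTime fun ls => decide (plains ls = compls ls) :=
    .decide_eq_list (by fun_prop) (by fun_prop) (by fun_prop)
  have h₂ : PolyTime fun ls => decide (normBits (constSum ls).1 = normBits (constSum ls).2) :=
    .decide_eq_list (.of_finite enc_injective _) (by fun_prop) (by fun_prop)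
  unfold sumsToOne
  fun_prop

end RawLabel

end ParamMDP

/-! ### Verification of certificates -/

namespace ParamMDP

open StackProg

instance : Inhabited RawLabel := ⟨⟨true, false, 0, [], [true]⟩⟩

instance : Inhabited RawRow := ⟨⟨false, []⟩⟩

namespace Certificate

/-- The row of an action in a state. -/
def row (c : Certificate) (s a : ℕ) : RawRow := (c.table.getD s []).getD a default

/-- The label of a transition. -/
def label (c : Certificate) (s a t : ℕ) : RawLabel := (c.row s a).labels.getD t default

/-- The word of the instance that a certificate contains. -/
def word (c : Certificate) : List Sym :=
  encodeUnary c.states ++ encodeUnary c.actions ++ encodeUnary c.params ++ encodeUnary c.init ++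
    ((List.range c.states).map fun s => Sym.bit (c.targets.getD s false)) ++
    (List.range c.states).flatMap fun s => (List.range c.actions).flatMap fun a =>
      if (c.row s a).isAvailable = true then
        (List.range c.states).flatMap fun t => (c.label s a t).encode
      else [Sym.unavailable]

/-- All labels are well-formed. -/
def labelsOK (c : Certificate) : Bool :=
  (List.range c.states).all fun s => (List.range c.actions).all fun a =>
    (List.range c.states).all fun t => (c.label s a t).wf c.params

/-- All rows sum up to `1`. -/
def rowsOK (c : Certificate) : Bool :=
  (List.range c.states).all fun s => (List.range c.actions).all fun a =>
    !(c.row s a).isAvailable ||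
      RawLabel.sumsToOne ((List.range c.states).map fun t => c.label s a t)

/-- The abstract valuation belongs to the class `R`. -/
def valOK (c : Certificate) (R : ValuationClass) : Bool :=
  (List.range c.params).all fun x => decide (c.val.getD x 0 < 3) &&
    match R with
    | .wellDefined => true
    | .graphPreserving => decide (c.val.getD x 0 = 2)
    | .boolean => decide (c.val.getD x 0 < 2)

/-- The strategy chooses available actions. -/
def stratOK (c : Certificate) : Bool :=
  (List.range c.states).all fun s =>
    decide (c.strat.getD s 0 < c.actions) && (c.row s (c.strat.getD s 0)).isAvailable

/-- Counterpart of `Quant.Plays`. -/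
def plays (c : Certificate) (Q : Quant) (s a : ℕ) : Bool :=
  match Q with
  | .ex => decide (a = c.strat.getD s 0)
  | .all => (c.row s a).isAvailable

/-- The edges of the graph of the instance under the abstract valuation. -/
def edge (c : Certificate) (s a t : ℕ) : Bool :=
  (c.row s a).isAvailable && (c.label s a t).pos c.val

/-- There is a successor of lower rank. -/
def descends (c : Certificate) (s a : ℕ) : Bool :=
  (List.range c.states).any fun t => c.edge s a t && decide (c.rank.getD t 0 < c.rank.getD s 0)

/-- All successors are ranked. -/
def stays (c : Certificate) (s a : ℕ) : Bool :=
  (List.range c.states).all fun t => !c.edge s a t || decide (c.rank.getD t 0 < c.states)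

/-- All successors have the same rank. -/
def keeps (c : Certificate) (s a : ℕ) : Bool :=
  (List.range c.states).all fun t =>
    !c.edge s a t || decide (c.rank.getD t 0 = c.rank.getD s 0)

/-- Counterpart of `QualCond.RankOK`. -/
def rankOK (c : Certificate) (Q : Quant) (φ : QualCond) (s : ℕ) : Bool :=
  match φ with
  | .positive => c.targets.getD s false ||
      (List.range c.actions).all fun a => !c.plays Q s a || c.descends s a
  | .unsure => !c.targets.getD s false &&
      (List.range c.actions).all fun a => !c.plays Q s a || (c.descends s a || c.keeps s a)
  | .safe => !c.targets.getD s false &&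
      (List.range c.actions).all fun a => !c.plays Q s a || c.stays s a
  | .almostSure => c.targets.getD s false ||
      (List.range c.actions).all fun a => !c.plays Q s a || (c.stays s a && c.descends s a)

/-- The ranking is valid and ranks the initial state. -/
def ranksOK (c : Certificate) (Q : Quant) (φ : QualCond) : Bool :=
  decide (c.rank.getD c.init 0 < c.states) && (List.range c.states).all fun s =>
    decide (c.rank.getD s 0 < c.states + 1) &&
      (!decide (c.rank.getD s 0 < c.states) || c.rankOK Q φ s)

/-- The certificate shows that `w` is a yes-instance. -/
def check (R : ValuationClass) (Q : Quant) (φ : QualCond) (w : List Sym) (c : Certificate) :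
    Bool :=
  c.labelsOK && (decide (c.init < c.states) && (c.rowsOK && (decide (w = c.word) &&
    (c.valOK R && (c.stratOK && c.ranksOK Q φ)))))

section PolyTime

variable {α : Type} [TreeEnc α] {f : α → Certificate} {s a t : α → ℕ}

@[fun_prop]
theorem polyTime_row (hf : PolyTime f) (hs : PolyTime s) (ha : PolyTime a) :
    PolyTime fun x => (f x).row (s x) (a x) := by
  unfold row
  fun_prop

@[fun_prop]
theorem polyTime_label (hf : PolyTime f) (hs : PolyTime s) (ha : PolyTime a) (ht : PolyTime t) :
    PolyTime fun x => (f x).label (s x) (a x) (t x) := by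
  unfold label
  fun_prop

@[fun_prop]
theorem polyTime_edge (hf : PolyTime f) (hs : PolyTime s) (ha : PolyTime a) (ht : PolyTime t) :
    PolyTime fun x => (f x).edge (s x) (a x) (t x) := by
  unfold edge
  fun_prop

@[fun_prop]
theorem polyTime_descends (hf : PolyTime f) (hs : PolyTime s) (ha : PolyTime a) :
    PolyTime fun x => (f x).descends (s x) (a x) := by
  unfold descends
  fun_prop

@[fun_prop]
theorem polyTime_stays (hf : PolyTime f) (hs : PolyTime s) (ha : PolyTime a) :
    PolyTime fun x => (f x).stays (s x) (a x) := by
  unfold stays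
  fun_prop

@[fun_prop]
theorem polyTime_keeps (hf : PolyTime f) (hs : PolyTime s) (ha : PolyTime a) :
    PolyTime fun x => (f x).keeps (s x) (a x) := by
  unfold keeps
  fun_prop

@[fun_prop]
theorem polyTime_plays (Q : Quant) (hf : PolyTime f) (hs : PolyTime s) (ha : PolyTime a) :
    PolyTime fun x => (f x).plays Q (s x) (a x) := by
  unfold plays
  cases Q <;> fun_prop

@[fun_prop]
theorem polyTime_rankOK (Q : Quant) (φ : QualCond) (hf : PolyTime f) (hs : PolyTime s) :
    PolyTime fun x => (f x).rankOK Q φ (s x) := by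
  unfold rankOK
  cases φ <;> fun_prop

@[fun_prop]
theorem polyTime_word : PolyTime word := by
  unfold word
  fun_prop

@[fun_prop]
theorem polyTime_check (R : ValuationClass) (Q : Quant) (φ : QualCond) {w : α → List Sym}
    (hw : PolyTime w) (hf : PolyTime f) : PolyTime fun x => (f x).check R Q φ (w x) := by
  have h₁ : PolyTime fun x => decide (w x = (f x).word) :=
    .decide_eq_list Sym.polyTime_decide_eq hw (by fun_prop)
  have h₂ : PolyTime fun x => (f x).labelsOK := by unfold labelsOK; fun_prop
  have h₃ : PolyTime fun x => (f x).rowsOK := by unfold rowsOK; fun_prop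
  have h₄ : PolyTime fun x => (f x).valOK R := by unfold valOK; cases R <;> fun_prop
  have h₅ : PolyTime fun x => (f x).stratOK := by unfold stratOK; fun_prop
  have h₆ : PolyTime fun x => (f x).ranksOK Q φ := by unfold ranksOK; fun_prop
  unfold check
  fun_prop

end PolyTime

end Certificate

end ParamMDP

namespace ParamMDP

open StackProg

theorem all_range {n : ℕ} {p : ℕ → Bool} :
    (List.range n).all p = true ↔ ∀ i : Fin n, p i = true := by
  simp [Fin.forall_iff]

theorem any_range {n : ℕ} {p : ℕ → Bool} :
    (List.range n).any p = true ↔ ∃ i : Fin n, p i = true := by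
  simp [Fin.exists_iff]

theorem range_eq_map_finRange (n : ℕ) : List.range n = (List.finRange n).map Fin.val := by
  simp

namespace Certificate

/-- The table of transitions that a certificate contains. -/
def toTable (c : Certificate) (s : Fin c.states) (a : Fin c.actions) :
    Option (Fin c.states → Label c.params) :=
  if (c.row s a).isAvailable = true then some fun t => (c.label s a t).toLabel c.params else none

/-- The set of targets that a certificate contains. -/
def targetSet (c : Certificate) : Finset (Fin c.states) :=
  {s | c.targets.getD s false = true}

variable {c : Certificate}

theorem isSome_toTable (s : Fin c.states) (a : Fin c.actions) :
    (c.toTable s a).isSome = (c.row s a).isAvailable := by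
  unfold toTable
  split_ifs with h <;> simp [h]

theorem wf_label (hl : c.labelsOK = true) (s : Fin c.states) (a : Fin c.actions)
    (t : Fin c.states) : (c.label s a t).wf c.params = true := by
  simp only [labelsOK, all_range] at hl
  exact hl s a t

theorem valid_toTable (hl : c.labelsOK = true) (s a f) (hf : c.toTable s a = some f) (t) :
    (f t).Valid := by
  unfold toTable at hf
  split_ifs at hf
  obtain rfl := Option.some.inj hf
  exact RawLabel.valid_toLabel (wf_label hl s a t)

theorem rowsOK_iff (hl : c.labelsOK = true) : c.rowsOK = true ↔
    ∀ s a f, c.toTable s a = some f → ∑ t, (f t).toPoly = 1 := by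
  simp only [rowsOK, all_range]
  refine forall_congr' fun s => forall_congr' fun a => ?_
  unfold toTable
  split_ifs with h
  · simp only [h, Bool.not_true, Bool.false_or, Option.some.injEq, forall_eq']
    rw [range_eq_map_finRange, List.map_map,
      RawLabel.sumsToOne_iff (k := c.params) (by simpa using wf_label hl s a), List.map_map,
      List.map_map, ← List.ofFn_eq_map, List.sum_ofFn]
    rfl
  · simp [h]

theorem word_eq (hl : c.labelsOK = true) (h : c.init < c.states) :
    c.word = encodeInstance ⟨c.init, h⟩ c.targetSet c.toTable := by
  unfold word encodeInstance
  simp only [range_eq_map_finRange, List.flatMap_map, List.map_map]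
  congr 1
  · congr 1
    refine List.map_congr_left fun s _ => ?_
    simp [targetSet]
  · congr 1
    funext s
    congr 1
    funext a
    unfold toTable
    split_ifs with h
    · unfold encodeRow
      congr 1
      funext t
      exact (RawLabel.encode_toLabel (wf_label hl s a t)).symm
    · rfl

theorem valOK_iff (R : ValuationClass) : c.valOK R = true ↔
    R.AbstractMem (fun x : Fin c.params => c.val.getD x 0) ∧
      ∀ x : Fin c.params, c.val.getD x 0 ≤ 2 := by
  rw [and_comm]
  simp only [valOK, all_range, Bool.and_eq_true, forall_and, decide_eq_true_eq, Nat.lt_succ_iff]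
  refine and_congr_right fun _ => ?_
  cases R <;> simp [ValuationClass.AbstractMem]

theorem stratOK_iff : c.stratOK = true ↔ ∃ σ : Fin c.states → Fin c.actions,
    (∀ s : Fin c.states, (σ s : ℕ) = c.strat.getD s 0) ∧ ∀ s, (c.toTable s (σ s)).isSome := by
  simp only [stratOK, all_range, Bool.and_eq_true, decide_eq_true_eq, isSome_toTable]
  constructor
  · intro h
    exact ⟨fun s => ⟨_, (h s).1⟩, fun s => rfl, fun s => (h s).2⟩
  · rintro ⟨σ, h₁, h₂⟩ s
    rw [← h₁]
    exact ⟨(σ s).2, h₂ s⟩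

theorem edge_iff (hl : c.labelsOK = true) (s : Fin c.states) (a : Fin c.actions)
    (t : Fin c.states) : c.edge s a t = true ↔
      ∃ f, c.toTable s a = some f ∧ (f t).Pos fun x => c.val.getD x 0 := by
  unfold edge toTable
  split_ifs with h
  · simp only [h, Bool.true_and, Option.some.injEq, exists_eq_left',
      RawLabel.pos_toLabel (wf_label hl s a t)]
  · simp [h]

theorem plays_iff {σ : Fin c.states → Fin c.actions}
    (hσ : ∀ s : Fin c.states, (σ s : ℕ) = c.strat.getD s 0) (Q : Quant) (s : Fin c.states)
    (a : Fin c.actions) : c.plays Q s a = true ↔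
      Q.Plays (fun s a => (c.toTable s a).isSome) σ s a := by
  cases Q with
  | ex => rw [plays, ← hσ, decide_eq_true_iff]; exact Fin.ext_iff.symm
  | all => simp [plays, Quant.Plays, isSome_toTable]

theorem rankOK_iff (hl : c.labelsOK = true) {σ : Fin c.states → Fin c.actions}
    (hσ : ∀ s : Fin c.states, (σ s : ℕ) = c.strat.getD s 0) (Q : Quant) (φ : QualCond)
    (s : Fin c.states) : c.rankOK Q φ s = true ↔
      φ.RankOK (fun s a t => ∃ f, c.toTable s a = some f ∧ (f t).Pos fun x => c.val.getD x 0)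
        (Q.Plays (fun s a => (c.toTable s a).isSome) σ) (c.targetSet : Set (Fin c.states))
        (fun s => c.rank.getD s 0) c.states s := by
  have hT : s ∈ (c.targetSet : Set (Fin c.states)) ↔ c.targets.getD s false = true := by
    simp [targetSet]
  have himp : ∀ b d : Bool, (!b || d) = true ↔ (b = true → d = true) := by decide
  cases φ <;>
    simp only [rankOK, QualCond.RankOK, Bool.or_eq_true, Bool.and_eq_true, Bool.not_eq_true',
      ← Bool.not_eq_true, hT, all_range, any_range, himp, descends, stays, keeps, plays_iff hσ,
      edge_iff hl, decide_eq_true_eq]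

theorem ranksOK_iff (hl : c.labelsOK = true) {σ : Fin c.states → Fin c.actions}
    (hσ : ∀ s : Fin c.states, (σ s : ℕ) = c.strat.getD s 0) (Q : Quant) (φ : QualCond) :
    c.ranksOK Q φ = true ↔
      φ.ValidRanking
        (fun s a t => ∃ f, c.toTable s a = some f ∧ (f t).Pos fun x => c.val.getD x 0)
        (Q.Plays (fun s a => (c.toTable s a).isSome) σ) (c.targetSet : Set (Fin c.states))
        (fun s => c.rank.getD s 0) c.states ∧
      c.rank.getD c.init 0 < c.states ∧ ∀ s : Fin c.states, c.rank.getD s 0 ≤ c.states := by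
  have himp : ∀ b d : Bool, (!b || d) = true ↔ (b = true → d = true) := by decide
  simp only [ranksOK, QualCond.ValidRanking, Bool.and_eq_true, all_range, himp, rankOK_iff hl hσ,
    decide_eq_true_eq, Nat.lt_succ_iff, forall_and]
  tauto

/-- An accepted certificate contains a yes-instance with the word `w`. -/
theorem mem_qualReach_of_check {R : ValuationClass} {Q : Quant} {φ : QualCond} {w : List Sym}
    (h : c.check R Q φ w = true) : w ∈ qualReach R Q φ := by
  simp only [check, Bool.and_eq_true, decide_eq_true_eq] at h
  obtain ⟨hl, hi, hrows, hw, hval, hstrat, hranks⟩ := h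
  obtain ⟨σ, hσ, hav⟩ := stratOK_iff.1 hstrat
  rw [rowsOK_iff hl] at hrows
  rw [word_eq hl hi] at hw
  rw [valOK_iff] at hval
  rw [ranksOK_iff hl hσ] at hranks
  let M : PMDP (Fin c.states) (Fin c.actions) (Fin c.params) :=
    { init := ⟨c.init, hi⟩
      P := fun s a => (c.toTable s a).map fun f s' => (f s').toPoly
      exists_available := fun s => ⟨σ s, by simpa using hav s⟩ }
  have hM : M.IsSimple := (isSimple_iff fun _ _ => rfl).2 hrows
  exact ⟨_, _, _, M, c.targetSet, hM, ⟨c.toTable, valid_toTable hl, fun _ _ => rfl, hw⟩,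
    (yesInstance_iff (fun _ _ => rfl) (valid_toTable hl) hM R Q φ c.targetSet).2
      ⟨_, hval.1, hval.2, σ, hav, _, hranks⟩⟩

end Certificate

/-! ### Existence of short certificates -/

/-- A label as it is written in a certificate. -/
def Label.toRaw {k : ℕ} : Label k → RawLabel
  | param x => ⟨false, false, x, [], []⟩
  | compl x => ⟨false, true, x, [], []⟩
  | const num den => ⟨true, false, 0, num.bits, den.bits⟩

theorem Label.wf_toRaw {k : ℕ} {ℓ : Label k} (h : ℓ.Valid) : ℓ.toRaw.wf k = true := by
  cases ℓ with
  | param x => simp [toRaw, RawLabel.wf]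
  | compl x => simp [toRaw, RawLabel.wf]
  | const num den =>
    have : den ≠ 0 := h
    simpa [toRaw, RawLabel.wf, normBits_eq_nil, bval_bits] using this

theorem Label.toLabel_toRaw {k : ℕ} (ℓ : Label k) : ℓ.toRaw.toLabel k = ℓ := by
  cases ℓ <;> simp [toRaw, RawLabel.toLabel, bval_bits]

/-- A row of the table as it is written in a certificate. -/
def rawRow {n k : ℕ} : Option (Fin n → Label k) → RawRow
  | none => ⟨false, []⟩
  | some f => ⟨true, (List.finRange n).map fun t => (f t).toRaw⟩

/-- Functions on `Fin n` are recovered from their lists of values. -/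
theorem getD_map_finRange {β : Type*} {n : ℕ} (f : Fin n → β) (i : Fin n) (d : β) :
    ((List.finRange n).map f).getD i d = f i := by
  simp

section ofWitness

variable {n m k : ℕ} (init : Fin n) (T : Finset (Fin n))
  (table : Fin n → Fin m → Option (Fin n → Label k)) (v : Fin k → ℕ) (σ : Fin n → Fin m)
  (r : Fin n → ℕ)

/-- The certificate that is made from an instance, an abstract valuation, a strategy and a
ranking. -/
abbrev Certificate.ofWitness : Certificate where
  states := n
  actions := m
  params := k
  init := init
  targets := (List.finRange n).map fun s => decide (s ∈ T)
  table := (List.finRange n).map fun s => (List.finRange m).map fun a => rawRow (table s a)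
  val := (List.finRange k).map v
  strat := (List.finRange n).map fun s => (σ s : ℕ)
  rank := (List.finRange n).map r

namespace Certificate

theorem row_ofWitness (s : Fin n) (a : Fin m) :
    (ofWitness init T table v σ r).row s a = rawRow (table s a) := by
  simp only [row, getD_map_finRange]

theorem label_ofWitness {s : Fin n} {a : Fin m} {f : Fin n → Label k} (hf : table s a = some f)
    (t : Fin n) : (ofWitness init T table v σ r).label s a t = (f t).toRaw := by
  simp only [label, row_ofWitness, hf, rawRow, getD_map_finRange]

theorem toTable_ofWitness : (ofWitness init T table v σ r).toTable = table := by
  funext s a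
  unfold toTable
  rw [row_ofWitness]
  cases hf : table s a with
  | none => simp [rawRow]
  | some f =>
    simp only [rawRow, if_true, Option.some.injEq]
    funext t
    rw [label_ofWitness init T table v σ r hf, Label.toLabel_toRaw]

theorem labelsOK_ofWitness (h : ∀ s a f, table s a = some f → ∀ t, (f t).Valid) :
    (ofWitness init T table v σ r).labelsOK = true := by
  simp only [labelsOK, all_range]
  intro s a t
  cases hf : table s a with
  | none =>
    simp only [label, row_ofWitness, hf, rawRow, List.getD_nil]
    change RawLabel.wf k ⟨true, false, 0, [], [true]⟩ = true
    simp [RawLabel.wf, normBits_eq_nil]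
  | some f =>
    rw [label_ofWitness init T table v σ r hf]
    exact Label.wf_toRaw (h s a f hf t)

theorem targetSet_ofWitness : (ofWitness init T table v σ r).targetSet = T := by
  ext s
  simp [targetSet]

/-- The certificate that is made from the data of a yes-instance is accepted. -/
theorem check_ofWitness {R : ValuationClass} {Q : Quant} {φ : QualCond}
    (hvalid : ∀ s a f, table s a = some f → ∀ t, (f t).Valid)
    (hsum : ∀ s a f, table s a = some f → ∑ t, (f t).toPoly = 1)
    (hv : R.AbstractMem v) (hv2 : ∀ x, v x ≤ 2) (hσ : ∀ s, (table s (σ s)).isSome)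
    (hr : φ.ValidRanking (fun s a t => ∃ f, table s a = some f ∧ (f t).Pos v)
      (Q.Plays (fun s a => (table s a).isSome) σ) (T : Set (Fin n)) r n)
    (h₀ : r init < n) (hle : ∀ s, r s ≤ n) :
    (ofWitness init T table v σ r).check R Q φ (encodeInstance init T table) = true := by
  have hl := labelsOK_ofWitness init T table v σ r hvalid
  have ht := toTable_ofWitness init T table v σ r
  have hT := targetSet_ofWitness init T table v σ r
  have hstrat : ∀ s : Fin n, (σ s : ℕ) = (ofWitness init T table v σ r).strat.getD s 0 :=
    fun s => (getD_map_finRange (fun s => (σ s : ℕ)) s 0).symm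
  have hval : (fun x : Fin k => (ofWitness init T table v σ r).val.getD x 0) = v :=
    funext fun x => getD_map_finRange v x 0
  have hrank : (fun s : Fin n => (ofWitness init T table v σ r).rank.getD s 0) = r :=
    funext fun s => getD_map_finRange r s 0
  simp only [check, Bool.and_eq_true, decide_eq_true_eq]
  refine ⟨hl, init.2, (rowsOK_iff hl).2 ?_, ?_, (valOK_iff R).2 ⟨?_, fun x => ?_⟩,
    stratOK_iff.2 ⟨σ, hstrat, ?_⟩, (ranksOK_iff hl (σ := σ) hstrat Q φ).2 ⟨?_, ?_, fun s => ?_⟩⟩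
  · rw [ht]; exact hsum
  · rw [word_eq hl init.2, ht, hT]
  · rw [hval]; exact hv
  · exact (congrFun hval x).trans_le (hv2 x)
  · rw [ht]; exact hσ
  · rw [ht, hT, hval, hrank]; exact hr
  · exact (congrFun hrank init).trans_lt h₀
  · exact (congrFun hrank s).trans_le (hle s)

end Certificate

end ofWitness

end ParamMDP

namespace ParamMDP

open StackProg

/-- The size of a list of encodings is bounded by the length of a word with corresponding parts. -/
theorem sz_map_le {α β δ : Type} [TreeEnc β] {l : List α} {f : α → β} {g : α → List δ} {C : ℕ}
    (h : ∀ a ∈ l, sz (f a) + 1 ≤ C * (g a).length) :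
    sz (l.map f) ≤ C * (l.flatMap g).length + 1 := by
  induction l with
  | nil => simp
  | cons a l ih =>
    have h₁ := h a (by simp)
    have h₂ := ih fun b hb => h b (by simp [hb])
    simp only [List.map_cons, sz_cons, List.flatMap_cons, List.length_append, Nat.mul_add]
    omega

theorem sz_map_finRange_le {β : Type} [TreeEnc β] {n C : ℕ} {f : Fin n → β}
    (h : ∀ i, sz (f i) + 1 ≤ C) : sz ((List.finRange n).map f) ≤ C * n + 1 := by
  have := sz_map_le (l := List.finRange n) (f := f) (g := fun i => [i]) (C := C)
    fun i _ => by simpa using h i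
  simpa [List.length_flatMap] using this

theorem length_le_length_flatMap {α δ : Type} {l : List α} {g : α → List δ}
    (h : ∀ a ∈ l, 1 ≤ (g a).length) : l.length ≤ (l.flatMap g).length := by
  induction l with
  | nil => simp
  | cons a l ih =>
    have h₁ := h a (by simp)
    have h₂ := ih fun b hb => h b (by simp [hb])
    simp only [List.length_cons, List.flatMap_cons, List.length_append]
    omega

theorem length_encodeUnary (n : ℕ) : (encodeUnary n).length = n + 1 := by simp [encodeUnary]

theorem length_encodeBinary (n : ℕ) : (encodeBinary n).length = n.bits.length + 1 := by
  simp [encodeBinary]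

theorem Label.sz_toRaw {k : ℕ} (ℓ : Label k) : sz ℓ.toRaw + 1 ≤ 7 * ℓ.encode.length := by
  have key : ∀ l : RawLabel, sz l ≤ 2 * l.idx + sz l.num + sz l.den + 11 := fun l => by
    have h : sz l = sz (RawLabel.equiv.symm l) := rfl
    have := sz_bool l.isConst
    have := sz_bool l.isCompl
    simp [RawLabel.equiv] at h
    omega
  have h := key ℓ.toRaw
  cases ℓ with
  | param x =>
    simp only [toRaw, sz_nil, encode, List.length_cons, length_encodeUnary] at h ⊢
    omega
  | compl x =>
    simp only [toRaw, sz_nil, encode, List.length_cons, length_encodeUnary] at h ⊢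
    omega
  | const num den =>
    have := sz_bits_le num.bits
    have := sz_bits_le den.bits
    simp only [toRaw, encode, List.length_cons, List.length_append, length_encodeBinary] at h ⊢
    omega

/-- An available action has at least one label, since there is a state. -/
theorem sz_rawRow {n k : ℕ} (hn : 0 < n) (o : Option (Fin n → Label k)) :
    sz (rawRow o) + 1 ≤ 13 * (encodeRow o).length := by
  have key : ∀ x : RawRow, sz x ≤ sz x.labels + 4 := fun x => by
    have h : sz x = sz (RawRow.equiv.symm x) := rfl
    have := sz_bool x.isAvailable
    simp [RawRow.equiv] at h
    omega
  have h := key (rawRow o)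
  cases o with
  | none =>
    simp [rawRow, encodeRow] at h ⊢
    omega
  | some f =>
    have h₁ : sz (rawRow (some f)).labels ≤ _ :=
      sz_map_le (l := List.finRange n) (f := fun t => (f t).toRaw) (g := fun t => (f t).encode)
        (C := 7) fun t _ => (f t).sz_toRaw
    have h₂ : 1 ≤ ((List.finRange n).flatMap fun t => (f t).encode).length := by
      have := length_le_length_flatMap (l := List.finRange n) (g := fun t => (f t).encode)
        fun t _ => by have := (f t).sz_toRaw; omega
      rw [List.length_finRange] at this
      omega
    change _ ≤ 13 * ((List.finRange n).flatMap fun t => (f t).encode).length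
    omega

/-- The certificate of an instance is of quadratic size. -/
theorem Certificate.sz_ofWitness {n m k : ℕ} (init : Fin n) (T : Finset (Fin n))
    (table : Fin n → Fin m → Option (Fin n → Label k)) (v : Fin k → ℕ) (σ : Fin n → Fin m)
    (r : Fin n → ℕ) (hv : ∀ x, v x ≤ 2) (hr : ∀ s, r s ≤ n) :
    sz (ofWitness init T table v σ r) ≤
      4 * (encodeInstance init T table).length ^ 2 + 40 * (encodeInstance init T table).length := by
  have hn : 0 < n := init.pos
  have hm : 0 < m := (σ init).pos
  have hrow : ∀ s, sz ((List.finRange m).map fun a => rawRow (table s a)) + 1 ≤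
      15 * ((List.finRange m).flatMap fun a => encodeRow (table s a)).length := fun s => by
    have h₁ := sz_map_le (l := List.finRange m) (f := fun a => rawRow (table s a))
      (g := fun a => encodeRow (table s a)) (C := 13) fun a _ => sz_rawRow hn _
    have h₂ := length_le_length_flatMap (l := List.finRange m)
      (g := fun a => encodeRow (table s a)) fun a _ => by
        have := sz_rawRow hn (table s a)
        omega
    rw [List.length_finRange] at h₂
    omega
  have htable := sz_map_le (l := List.finRange n)
    (f := fun s => (List.finRange m).map fun a => rawRow (table s a))
    (g := fun s => (List.finRange m).flatMap fun a => encodeRow (table s a))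
    fun s _ => hrow s
  have htargets := sz_map_finRange_le (f := fun s => decide (s ∈ T)) (C := 4) fun s => by
    have := sz_bool (decide (s ∈ T))
    omega
  have hval := sz_map_finRange_le (f := v) (C := 6) fun x => by
    have := hv x
    rw [sz_nat]
    omega
  have hstrat := sz_map_finRange_le (f := fun s => (σ s : ℕ)) (C := 2 * m) fun s => by
    have := (σ s).2
    rw [sz_nat]
    omega
  have hrank := sz_map_finRange_le (f := r) (C := 2 * n + 2) fun s => by
    have := hr s
    rw [sz_nat]
    omega
  have hsz : sz (ofWitness init T table v σ r) =
    sz (Certificate.equiv.symm (ofWitness init T table v σ r)) := rfl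
  simp only [Certificate.equiv, Equiv.coe_fn_symm_mk, sz_prod, sz_nat] at hsz
  have hlen : (encodeInstance init T table).length = (n + 1) + (m + 1) + (k + 1) + (init + 1) + n +
      ((List.finRange n).flatMap fun s => (List.finRange m).flatMap fun a =>
        encodeRow (table s a)).length := by
    simp only [encodeInstance, List.length_append, length_encodeUnary, List.length_map,
      List.length_finRange]
  generalize (encodeInstance init T table).length = N at *
  generalize ((List.finRange n).flatMap fun s => (List.finRange m).flatMap fun a =>
        encodeRow (table s a)).length = W at *
  -- All of `n`, `m`, `k`, `init` and `W` are bounded by `N`, by `hlen`.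
  have e₁ : 2 * m * n ≤ N ^ 2 := by nlinarith
  have e₂ : (2 * n + 2) * n ≤ 2 * N ^ 2 := by nlinarith
  nlinarith

/-! ### Membership in NP -/

instance : TreeEnc (Sym ⊕ Bool) :=
  ⟨Sum.elim (fun a => TreeEnc.enc (true, a)) fun b => TreeEnc.enc (false, b)⟩

theorem enc_sum_injective : Function.Injective (TreeEnc.enc : Sym ⊕ Bool → Tree) := by
  rintro (a | a) (b | b) h
  · exact congrArg Sum.inl (Sym.enc_injective (Tree.node.inj h).2)
  · cases (Tree.node.inj h).1
  · cases (Tree.node.inj h).1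
  · exact congrArg Sum.inr (enc_injective (Tree.node.inj h).2)

/-- The word part of the input of a verifier. -/
def wordPart (l : List (Sym ⊕ Bool)) : List Sym :=
  l.flatMap fun x => x.elim (fun a => [a]) fun _ => []

/-- The certificate part of the input of a verifier. -/
def certPart (l : List (Sym ⊕ Bool)) : List Bool :=
  l.flatMap fun x => x.elim (fun _ => []) fun b => [b]

theorem wordPart_pairWord (x : List Sym × List Bool) : wordPart (NPTime.pairWord x) = x.1 := by
  simp [wordPart, NPTime.pairWord, List.flatMap_map]

theorem certPart_pairWord (x : List Sym × List Bool) : certPart (NPTime.pairWord x) = x.2 := by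
  simp [certPart, NPTime.pairWord, List.flatMap_map]

@[fun_prop]
theorem polyTime_wordPart : PolyTime wordPart := by
  have : PolyTime fun x : Sym ⊕ Bool => x.elim (fun a => [a]) fun _ => ([] : List Sym) :=
    .of_finite enc_sum_injective _
  unfold wordPart
  fun_prop

@[fun_prop]
theorem polyTime_certPart : PolyTime certPart := by
  have : PolyTime fun x : Sym ⊕ Bool => x.elim (fun _ => ([] : List Bool)) fun b => [b] :=
    .of_finite enc_sum_injective _
  unfold certPart
  fun_prop

/-- The verifier decodes a certificate and checks it against the word. -/
theorem inNP_qualReach (R : ValuationClass) (Q : Quant) (c : QualCond) :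
    NPTime.InNP (qualReach R Q c) := by
  refine ⟨4 * Polynomial.X ^ 2 + 40 * Polynomial.X,
    fun w l => (TreeDec.dec (parseTree l) : Certificate).check R Q c w, ?_, fun w => ⟨?_, ?_⟩⟩
  · have h : PolyTime fun l : List (Sym ⊕ Bool) =>
        (TreeDec.dec (parseTree (certPart l)) : Certificate).check R Q c (wordPart l) := by
      fun_prop
    simpa only [wordPart_pairWord, certPart_pairWord] using
      h.computableInPolyTime NPTime.pairWord
  · rintro ⟨n, m, k, M, T, hM, ⟨table, hvalid, hP, rfl⟩, hyes⟩
    obtain ⟨v, hv, hv2, σ, hσ, r, hr, h₀, hle⟩ := (yesInstance_iff hP hvalid hM R Q c T).1 hyes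
    refine ⟨(TreeEnc.enc (Certificate.ofWitness M.init T table v σ r)).word, ?_, ?_⟩
    · have := Certificate.sz_ofWitness M.init T table v σ r hv2 hle
      simp only [Polynomial.eval_add, Polynomial.eval_mul, Polynomial.eval_pow, Polynomial.eval_X,
        Polynomial.eval_ofNat]
      exact this
    · dsimp only
      rw [parseTree_word, TreeDec.dec_enc]
      exact Certificate.check_ofWitness M.init T table v σ r hvalid ((isSimple_iff hP).1 hM) hv hv2
        hσ hr h₀ hle
  · rintro ⟨l, -, h⟩
    exact Certificate.mem_qualReach_of_check h

end ParamMDP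

theorem mainTheorem4 (R : ParamMDP.ValuationClass) (Q : ParamMDP.Quant) (c : ParamMDP.QualCond) :
    NPTime.InNP (ParamMDP.qualReach R Q c) :=
  ParamMDP.inNP_qualReach R Q c
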